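/- **Setting.** Let $\mathcal X$ be a countable set of inputs and $d^s\in\mathbb N$ a fixed number of spatial positions. For each $n\in\mathbb N$ consider a random network with inputs $f_n^0(x)$ and layers with outputs $f_n^k(x)$, $k\ge 1$, $x\in\mathcal X$. The rows of $f^k_n(x)$ are indexed by $[d^s]$ and its columns (channels) by $\mathbb N$. Layer $k$ receives $g_n^{k-1}(x)=\phi_{k-1}(f_n^{k-1}(x))$ (entrywise), of which it uses only the first $d_n^{k-1}$ columns ("infinite width, finite fan-out"). The activations $\phi_k:\mathbb R\to\mathbb R$ are continuous and polynomially bounded, i.e. $|\phi_k(z)|\le\sum_{t\le r}c_t|z|^t$ for some $r\in\mathbb N$, $c_t\ge 0$. The absolute moments of every order of the entries of $f_n^0(x)$ are, for each $x$, bounded uniformly in $n$, the position and the channel; this covers deterministic finite-dimensional inputs that do not depend on $n$, with $\phi_0=\mathrm{id}$. Each layer $k\in\{1,\dots,\ell-1\}$ is of one of the following types: an affine layer $f_{ai}=\sum_{q}\sum_{b}A^q_{ab}\sum_{j\le d_n^{k-1}}g_{bj}W^q_{ji}+\beta_i$ with finitely many fixed $d^s\times d^s$ matrices $A^q$ and independent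 weights $W^q_{ji}\sim\mathcal N(0,\sigma_w^2/d_n^{k-1})$, $\beta_i\sim\mathcal N(0,\sigma_b^2)$ (fully connected and convolutional layers); a weight-free layer $f=Ag$ (e.g. average pooling); or a multi-head attention layer as described next. Layer $\ell$ is a multi-head attention layer with $d_n^H$ heads, query/key dimension $d_n^G$, value dimension $d_n^V\ge 1$ and $d^{-1/2}$ scaling: with $g=g_n^{\ell-1}(x)$, for every $h\in\mathbb N$, $$G_n^{\ell h}(x)=\frac{(gW^{h,Q})(gW^{h,K})^\top}{\sqrt{d_n^G}},\qquad f_n^{\ell h}(x)=\zeta\big(G_n^{\ell h}(x)\big)\,gW^{h,V},\qquad f_n^{\ell}(x)=\big[f_n^{\ell 1}(x),\dots,f_n^{\ell d_n^H}(x)\big]W^O,$$ where $\zeta:\mathbb R^{d^s\times d^s}\to\mathbb R^{d^s\times d^s}$ is continuous with $|\zeta(G)_{ai}|\le\sum_{t\le r}c_t|G_{ai}|^t$ for some $r\in\mathbb N$ and $c_t\ge0$ independent of $G$ (and likewise, with their own $\zeta$, dimensions and variances, for attention layers among the earlier layers). The weights satisfy $W^{h,Q}_{ij}\sim\mathcal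 N(0,\sigma_Q^2/d_n^{\ell-1})$, $W^{h,K}_{ij}\sim\mathcal N(0,\sigma_K^2/d_n^{\ell-1})$, $W^{h,V}_{ij}\sim\mathcal N(0,\sigma_V^2/d_n^{\ell-1})$, $W^{O}_{ij}\sim\mathcal N(0,\sigma_O^2/(d_n^Hd_n^V))$. For each $n$, all weights of the layers $1,\dots,\ell$ are mutually independent and, jointly, independent of the network inputs. **Theorem.** Let $\ell\ge 1$. Assume that $f_n^{\ell-1}=\{f^{\ell-1}_{n,aj}(x)\}_{x,a,j}$ converges in distribution, as $n\to\infty$, to a Gaussian process $f^{\ell-1}\sim\mathcal{GP}(0,\kappa^{\ell-1})$ whose channels $f^{\ell-1}_{\cdot j}$, $f^{\ell-1}_{\cdot k}$ are independent for $j\ne k$, where $\kappa^{\ell-1}_{ab}(x,x')=\mathbb E[f^{\ell-1}_{aj}(x)f^{\ell-1}_{bj}(x')]$ for every channel $j$; and that for every $n$ the channels $\{f^{\ell-1}_{n,\cdot j}:j\in\mathbb N\}$ are exchangeable over $j$. Put $\tilde\kappa_{ab}(x,x')=\mathbb E[\phi_{\ell-1}(f^{\ell-1}_{a1}(x))\,\phi_{\ell-1}(f^{\ell-1}_{b1}(x'))]$.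 If $d_n^{\ell-1}\to\infty$, $d_n^H\to\infty$ and $d_n^G\to\infty$ as $n\to\infty$, then: (I) $\{G_n^{\ell h}(x):x\in\mathcal X,h\in\mathbb N\}$ converges in distribution to a centred Gaussian process $G^\ell$ with $$\mathbb E[G^{\ell h}_{ai}(x)G^{\ell h'}_{bj}(x')]=\delta_{h=h'}\,\sigma_Q^2\sigma_K^2\,\tilde\kappa_{ab}(x,x')\,\tilde\kappa_{ij}(x,x').$$ (II) $\{f^\ell_{n,aj}(x)\}_{x,a,j}$ converges in distribution to a centred Gaussian process $f^\ell$ such that, for every channel $k$, $$\mathbb E[f^\ell_{ak}(x)f^\ell_{bk}(x')]=\kappa^\ell_{ab}(x,x')=\sigma_O^2\sigma_V^2\sum_{i,j=1}^{d^s}\tilde\kappa_{ij}(x,x')\,\mathbb E\big[\zeta(G^{\ell1}(x))_{ai}\,\zeta(G^{\ell1}(x'))_{bj}\big]$$ (all these expectations being finite), and $f^\ell_{\cdot k}$ and $f^\ell_{\cdot l}$ are independent for $k\ne l$. (With $\sigma_Q=\sigma_K=\sigma_V=\sigma_O=1$ the covariances are $\delta_{h=h'}\tilde\kappa_{ab}\tilde\kappa_{ij}$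 and $\sum_{ij}\tilde\kappa_{ij}\,\mathbb E[\zeta(G)_{ai}\,\zeta(G')_{bj}]$.) Convergence in distribution is weak convergence of laws on countable products of $\mathbb R$ with the product topology. -/

import Mathlib

open MeasureTheory ProbabilityTheory Filter Topology
open scoped NNReal ENNReal

noncomputable section

namespace AttentionGP

/-! ### Gaussian processes, kernels, exchangeability

Convention: channel, head and weight indices are natural numbers starting at `0`, so that for
instance `Finset.range d` runs through the first `d` channels.  `dS` is the spatial dimension. -/

/-- `μ` is the law of the centred Gaussian process with index set `T` and covariance function
`K`, realised as the coordinate process on `T → ℝ`. -/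
structure IsCentredGP {T : Type*} (μ : Measure (T → ℝ)) (K : T → T → ℝ) : Prop where
  gaussian : IsGaussianProcess (fun (t : T) (ω : T → ℝ) => ω t) μ
  mean_zero : ∀ t, ∫ ω, ω t ∂μ = 0
  cov : ∀ s t, ∫ ω, ω s * ω t ∂μ = K s t

/-- `μ` is the law of a centred Gaussian process `f = (f_{aj}(x))`, indexed by inputs `x`,
spatial positions `a` and channels `j`, such that every channel has kernel
`E[f_{aj}(x) f_{bj}(x')] = κ_{ab}(x, x')` and different channels are independent. -/
structure IsChannelGP {X : Type*} {dS : ℕ} (μ : Measure (X × Fin dS × ℕ → ℝ))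
    (κ : X → X → Matrix (Fin dS) (Fin dS) ℝ) : Prop where
  gaussian : IsGaussianProcess (fun (t : X × Fin dS × ℕ) (ω : X × Fin dS × ℕ → ℝ) => ω t) μ
  mean_zero : ∀ t, ∫ ω, ω t ∂μ = 0
  cov : ∀ x x' a b j, ∫ ω, ω (x, a, j) * ω (x', b, j) ∂μ = κ x x' a b
  indep : ∀ j j', j ≠ j' →
    IndepFun (fun (ω : X × Fin dS × ℕ → ℝ) (p : X × Fin dS) => ω (p.1, p.2, j))
      (fun (ω : X × Fin dS × ℕ → ℝ) (p : X × Fin dS) => ω (p.1, p.2, j')) μ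

/-- The kernel after the nonlinearity:
`κ̃_{ab}(x, x') = E[φ(f_{a1}(x)) φ(f_{b1}(x'))]`, for `f` of law `μ`. -/
def postKernel {X : Type*} {dS : ℕ} (φ : ℝ → ℝ) (μ : Measure (X × Fin dS × ℕ → ℝ))
    (x x' : X) : Matrix (Fin dS) (Fin dS) ℝ :=
  Matrix.of fun a b => ∫ ω, φ (ω (x, a, 0)) * φ (ω (x', b, 0)) ∂μ

/-- Exchangeability over the channel index: the joint law is invariant under every finitely
supported permutation of the channels. -/
def ChannelExchangeable {X : Type*} {dS : ℕ} (ν : Measure (X × Fin dS × ℕ → ℝ)) : Prop :=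
  ∀ σ : Equiv.Perm ℕ, {j | σ j ≠ j}.Finite →
    ν.map (fun ω (t : X × Fin dS × ℕ) => ω (t.1, t.2.1, σ t.2.2)) = ν

/-! ### Nonlinearities -/

/-- `|φ(z)| ≤ ∑_{t ≤ m} c_t |z|^t`. -/
def PolyBounded (φ : ℝ → ℝ) : Prop :=
  ∃ (m : ℕ) (c : ℕ → ℝ), (∀ t, 0 ≤ c t) ∧
    ∀ z, |φ z| ≤ ∑ t ∈ Finset.range (m + 1), c t * |z| ^ t

/-- `|ζ(G)_{ai}| ≤ ∑_{t ≤ m} c_t |G_{ai}|^t`. -/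
def EntrywisePolyBounded {dS : ℕ}
    (ζ : Matrix (Fin dS) (Fin dS) ℝ → Matrix (Fin dS) (Fin dS) ℝ) : Prop :=
  ∃ (m : ℕ) (c : ℕ → ℝ), (∀ t, 0 ≤ c t) ∧
    ∀ G a i, |ζ G a i| ≤ ∑ t ∈ Finset.range (m + 1), c t * |G a i| ^ t

/-! ### Multi-head attention layers

`g` always denotes a layer input of shape `dS × ℕ`, of which a layer only uses the first `din`
columns; outputs have infinitely many columns (infinite width, finite fan-out). -/

/-- Hyperparameters of a multi-head attention layer; dimensions depend on the index `n` in the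
sequence of networks: number of heads, query/key dimension, value dimension per head. -/
structure Attention (dS : ℕ) where
  heads : ℕ → ℕ
  dimG : ℕ → ℕ
  dimV : ℕ → ℕ
  σQ : ℝ≥0
  σK : ℝ≥0
  σV : ℝ≥0
  σO : ℝ≥0
  ζ : Matrix (Fin dS) (Fin dS) ℝ → Matrix (Fin dS) (Fin dS) ℝ

/-- Index of a single weight of an attention layer: `query h i j` stands for `W^{h,Q}_{ij}`,
likewise for `key` and `value`; `output h k i` stands for the entry of `W^O` in the `i`-th column
and in the `k`-th row of the block of rows that belongs to head `h`. -/
inductive AttnParam where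
  | query (h i j : ℕ)
  | key (h i j : ℕ)
  | value (h i j : ℕ)
  | output (h k i : ℕ)

namespace Attention

variable {dS : ℕ} (S : Attention dS)

/-- Continuous, entrywise polynomially bounded `ζ`. -/
def Regular : Prop := Continuous S.ζ ∧ EntrywisePolyBounded S.ζ

/-- Variances of the Gaussian weights of the `n`-th layer with input dimension `din`. -/
def paramVar (n din : ℕ) : AttnParam → ℝ≥0
  | .query _ _ _ => S.σQ ^ 2 / (din : ℝ≥0)
  | .key _ _ _ => S.σK ^ 2 / (din : ℝ≥0)
  | .value _ _ _ => S.σV ^ 2 / (din : ℝ≥0)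
  | .output _ _ _ => S.σO ^ 2 / ((S.heads n : ℝ≥0) * (S.dimV n : ℝ≥0))

/-- `Q^h = g W^{h,Q}`. -/
def query (din : ℕ) (W : AttnParam → ℝ) (g : Fin dS → ℕ → ℝ) (h : ℕ) (a : Fin dS) (j : ℕ) : ℝ :=
  ∑ i ∈ Finset.range din, g a i * W (.query h i j)

/-- `K^h = g W^{h,K}`. -/
def key (din : ℕ) (W : AttnParam → ℝ) (g : Fin dS → ℕ → ℝ) (h : ℕ) (a : Fin dS) (j : ℕ) : ℝ :=
  ∑ i ∈ Finset.range din, g a i * W (.key h i j)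

/-- `V^h = g W^{h,V}`. -/
def value (din : ℕ) (W : AttnParam → ℝ) (g : Fin dS → ℕ → ℝ) (h : ℕ) (a : Fin dS) (j : ℕ) : ℝ :=
  ∑ i ∈ Finset.range din, g a i * W (.value h i j)

/-- The logits `G^h = Q^h (K^h)ᵀ / √(d^G)`. -/
def logit (n din : ℕ) (W : AttnParam → ℝ) (g : Fin dS → ℕ → ℝ) (h : ℕ) :
    Matrix (Fin dS) (Fin dS) ℝ :=
  Matrix.of fun a b =>
    (∑ j ∈ Finset.range (S.dimG n), query din W g h a j * key din W g h b j)
      / Real.sqrt (S.dimG n)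

/-- The output `ζ(G^h) V^h` of head `h`. -/
def headOut (n din : ℕ) (W : AttnParam → ℝ) (g : Fin dS → ℕ → ℝ) (h : ℕ) (a : Fin dS) (k : ℕ) :
    ℝ :=
  ∑ b, S.ζ (S.logit n din W g h) a b * value din W g h b k

/-- The layer output: the outputs of all heads, stacked, times `W^O`. -/
def apply (n din : ℕ) (W : AttnParam → ℝ) (g : Fin dS → ℕ → ℝ) : Fin dS → ℕ → ℝ := fun a i =>
  ∑ h ∈ Finset.range (S.heads n), ∑ k ∈ Finset.range (S.dimV n),
    S.headOut n din W g h a k * W (.output h k i)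

end Attention

/-! ### The layers of the network -/

/-- Layer types.
* `affine F A σw σb`: weights shared over space,
  `f_{ai} = ∑_{k < F} ∑_b (A k)_{ab} ∑_j g_{bj} W^k_{ji} + β_i`.  Fully connected layers are the
  case `F = 1`, `A 0 = 1`; convolutional layers have one (scaled) shift matrix `A k` per element
  of the filter.
* `pool A`: the weight-free layer `f = A g`, such as average pooling.
* `attention S`: multi-head attention. -/
inductive Layer (dS : ℕ) where
  | affine (F : ℕ) (A : Fin F → Matrix (Fin dS) (Fin dS) ℝ) (σw σb : ℝ≥0)
  | pool (A : Matrix (Fin dS) (Fin dS) ℝ)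
  | attention (S : Attention dS)

namespace Layer

variable {dS : ℕ}

/-- Index type of the weights of a layer: for an affine layer `inl (k, j, i)` is `W^k_{ji}` and
`inr i` is `β_i`. -/
def Param : Layer dS → Type
  | .affine F _ _ _ => (Fin F × ℕ × ℕ) ⊕ ℕ
  | .pool _ => Empty
  | .attention _ => AttnParam

/-- Variances of the Gaussian weights. -/
def paramVar (n din : ℕ) : (L : Layer dS) → L.Param → ℝ≥0
  | .affine _ _ σw σb => fun p =>
      Sum.elim (fun _ => σw ^ 2 / (din : ℝ≥0)) (fun _ => σb ^ 2) p
  | .pool _ => fun p => Empty.elim p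
  | .attention S => fun p => S.paramVar n din p

/-- The map from layer inputs to layer outputs, for given weights. -/
def apply (n din : ℕ) : (L : Layer dS) → (L.Param → ℝ) → (Fin dS → ℕ → ℝ) → (Fin dS → ℕ → ℝ)
  | .affine _ A _ _ => fun W g a i =>
      (∑ k, ∑ b, A k a b * ∑ j ∈ Finset.range din, g b j * W (Sum.inl (k, j, i)))
        + W (Sum.inr i)
  | .pool A => fun _ g a i => ∑ b, A a b * g b i
  | .attention S => fun W g => S.apply n din W g

/-- Regularity of the nonlinearity inside a layer. -/
def Regular : Layer dS → Prop
  | .attention S => S.Regular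
  | _ => True

end Layer

/-- A sequence (in `n`) of networks: `layer k` is the `k`-th layer (`k ≥ 1`; `layer 0` is not
used), `width k n` is the dimension `d_n^k` and `act k` the nonlinearity `φ_k` that follows layer
`k`; `k = 0` refers to the network input. -/
structure Network (dS : ℕ) where
  layer : ℕ → Layer dS
  width : ℕ → ℕ → ℕ
  act : ℕ → ℝ → ℝ

/-- The outputs `f^k` of the layers, before the nonlinearity, for given weights and given network
input `f^0 = inp`; the input of layer `k + 1` is `g^k = φ_k(f^k)`. -/
def Network.out {dS : ℕ} (N : Network dS) (n : ℕ) (W : ∀ k, (N.layer k).Param → ℝ)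
    (inp : Fin dS → ℕ → ℝ) : ℕ → Fin dS → ℕ → ℝ
  | 0 => inp
  | k + 1 => (N.layer (k + 1)).apply n (N.width k n) (W (k + 1))
      (fun a j => N.act k (Network.out N n W inp k a j))

/-- All absolute moments are bounded uniformly in the network, the position and the channel (for
each network input `x`).  Deterministic finite-dimensional inputs that do not depend on `n` are a
trivial example. -/
def UniformMoments {X : Type*} {dS : ℕ} {Ω : ℕ → Type*} [∀ n, MeasurableSpace (Ω n)]
    (P : ∀ n, Measure (Ω n)) (Y : ∀ n, X → Fin dS → ℕ → Ω n → ℝ) : Prop :=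
  ∀ (x : X) (p : ℕ), ∃ C : ℝ≥0, ∀ n a j, ∫⁻ ω, ‖Y n x a j ω‖ₑ ^ p ∂(P n) ≤ C

end AttentionGP

end

noncomputable section

namespace AttentionGP

/-! ### Gaussian limits on countable products -/

section GaussianLimit

variable {T : Type*}

/-! Logits and outputs are both linear in a family of Gaussian weights that is independent of the
coefficients: the logits in the query weights, with coefficients made of layer inputs and keys, and
the outputs in `W^O`, with the head outputs as coefficients. With the coefficients frozen, a finite
linear combination of such variables is centred Gaussian with a random variance `S_n`, so its
characteristic function is `E exp(-S_n / 2)`. If `S_n` tends to a constant `q` in mean, this tends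
to `exp(-q / 2)`. Uniform second moments give tightness on the countable product, and a limit point
is determined by its characteristic functional. This is `exists_gaussian_limit`; it reduces the
theorem to laws of large numbers for empirical covariances.

For the logits, the empirical covariance within one head factorises into `σ_Q²` times an average of
`g g'` over input channels times an average of products of keys over the key dimension. The first
average converges by `Null.average_channels`: exchangeability makes all correlations between two
channels equal, and they vanish asymptotically because the channels of the limit are independent.
The second concentrates around `σ_K²` times the first, because it averages quadratic forms in
independent blocks of key weights (`Null.average_quadratic`). Distinct heads use disjoint query
weights, whence the Kronecker delta.

For the outputs, the empirical covariance averages, over heads and value columns, products of two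
entries of `ζ` and two values. The value weights are averaged out by `Null.average_quadratic` again,
with the `ζ` factors as coefficients; the value dimension need not grow, since the number of heads
does. There remains an average over heads of functions of the logits. The logit limit just proved
has independent heads, and the heads are exchangeable because relabelling their weights preserves
the joint law with the inputs; so `Null.average_of_tendstoInDistribution` applies
(`null_average_zeta`).

All of this needs moments of every order, uniform in `n` and in the indices (`BddMoments`). They
propagate through the layers by `BddMoments.gaussSum`, turn weak convergence into convergence of
expectations (`tendsto_integral_of_bddMoments`), and make the sequences that vanish in mean stable
under products (`Null.bdd_mul`). -/

theorem isTightMeasureSet_of_lintegral_sq_le [Countable T] {S : Set (Measure (T → ℝ))} (C : T → ℝ≥0)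
    (h : ∀ μ ∈ S, ∀ t, ∫⁻ ω, ‖ω t‖ₑ ^ 2 ∂μ ≤ C t) : IsTightMeasureSet S := by
  rw [isTightMeasureSet_iff_exists_isCompact_measure_compl_le]
  intro ε hε
  obtain ⟨δ, hδ, hsum⟩ := ENNReal.exists_pos_sum_of_countable hε.ne' T
  -- By Chebyshev the coordinate `t` leaves `[-M t, M t]` with probability at most `C t / M t ^ 2 ≤
  -- δ t`. The `+ 1` keeps `M t` positive when `C t = 0`.
  set M : T → ℝ≥0 := fun t => NNReal.sqrt ((C t + 1) / δ t) with hM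
  have hMsq : ∀ t, M t ^ 2 = (C t + 1) / δ t := fun t => NNReal.sq_sqrt _
  refine ⟨Set.univ.pi fun t => Set.Icc (-(M t : ℝ)) (M t),
    isCompact_univ_pi fun t => isCompact_Icc, fun μ hμ => ?_⟩
  have hsub : (Set.univ.pi fun t => Set.Icc (-(M t : ℝ)) (M t))ᶜ ⊆
      ⋃ t, {ω : T → ℝ | ((M t ^ 2 : ℝ≥0) : ℝ≥0∞) ≤ ‖ω t‖ₑ ^ 2} := by
    intro ω hω
    simp only [Set.mem_compl_iff, Set.mem_pi, Set.mem_univ, true_implies, not_forall] at hω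
    obtain ⟨t, ht⟩ := hω
    refine Set.mem_iUnion.2 ⟨t, ?_⟩
    have h1 : (M t : ℝ) < |ω t| := by
      by_contra hcon
      exact ht (abs_le.1 (not_lt.1 hcon))
    have h2 : (M t : ℝ≥0∞) ≤ ‖ω t‖ₑ := by
      rw [← enorm_norm, ← ofReal_norm, norm_norm, Real.norm_eq_abs,
        ← ENNReal.ofReal_coe_nnreal]
      exact ENNReal.ofReal_le_ofReal h1.le
    simpa using pow_le_pow_left' h2 2
  refine (measure_mono hsub).trans ((measure_iUnion_le _).trans ?_)
  refine (ENNReal.tsum_le_tsum fun t => ?_).trans hsum.le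
  have hpos : 0 < M t ^ 2 := by
    rw [hMsq]; exact div_pos (by positivity) (hδ t)
  have hmark := mul_meas_ge_le_lintegral₀ (μ := μ) (f := fun ω : T → ℝ => ‖ω t‖ₑ ^ 2)
    (Measurable.aemeasurable (by fun_prop)) ((M t ^ 2 : ℝ≥0) : ℝ≥0∞)
  have h3 : ((M t ^ 2 : ℝ≥0) : ℝ≥0∞) * μ {ω : T → ℝ | ((M t ^ 2 : ℝ≥0) : ℝ≥0∞) ≤ ‖ω t‖ₑ ^ 2} ≤
      ((M t ^ 2 : ℝ≥0) : ℝ≥0∞) * δ t := by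
    refine (hmark.trans (h μ hμ t)).trans ?_
    rw [← ENNReal.coe_mul, ENNReal.coe_le_coe, hMsq, div_mul_cancel₀ _ (hδ t).ne']
    exact le_self_add
  exact (ENNReal.mul_le_mul_iff_right (ENNReal.coe_ne_zero.2 hpos.ne') ENNReal.coe_ne_top).1 h3

theorem apply_restrict_eq_sum [DecidableEq T] {I : Finset T} (L : StrongDual ℝ (I → ℝ))
    (ω : T → ℝ) : L (I.restrict ω) =
      ∑ t ∈ I, (if ht : t ∈ I then L (Pi.single ⟨t, ht⟩ 1) else 0) * ω t := by
  rw [← Finset.sum_attach]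
  simp only [Finset.coe_mem, dite_true]
  have h : I.restrict ω = ∑ t ∈ I.attach, ω t • (Pi.single t (1 : ℝ) : I → ℝ) := by
    funext i
    simp [Finset.sum_apply, Pi.single_apply]
  rw [h, map_sum]
  exact Finset.sum_congr rfl fun t _ => by rw [map_smul, smul_eq_mul, mul_comm]

/-- The characteristic functional of the centred Gaussian process with covariance `K`. -/
def HasGaussianCharFun (γ : Measure (T → ℝ)) (K : T → T → ℝ) : Prop :=
  ∀ (I : Finset T) (c : T → ℝ), ∫ ω, Complex.exp (((∑ t ∈ I, c t * ω t : ℝ) : ℂ) * Complex.I) ∂γ =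
    Complex.exp (((-(∑ s ∈ I, ∑ t ∈ I, c s * c t * K s t) / 2 : ℝ) : ℂ))

namespace HasGaussianCharFun

variable {γ : Measure (T → ℝ)} {K : T → T → ℝ}

/-- A characteristic function is bounded by one, so the exponent cannot be positive. Positive
semidefiniteness of `K` therefore comes for free. -/
theorem quadratic_nonneg [IsProbabilityMeasure γ] (h : HasGaussianCharFun γ K) (I : Finset T) (c : T → ℝ) :
    0 ≤ ∑ s ∈ I, ∑ t ∈ I, c s * c t * K s t := by
  have h1 : ‖∫ ω, Complex.exp (((∑ t ∈ I, c t * ω t : ℝ) : ℂ) * Complex.I) ∂γ‖ ≤ 1 := by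
    refine (norm_integral_le_of_norm_le_const (C := 1) (ae_of_all _ fun ω => ?_)).trans (by simp)
    rw [Complex.norm_exp_ofReal_mul_I]
  rw [h, Complex.norm_exp, Complex.ofReal_re, Real.exp_le_one_iff] at h1
  linarith

/-- Applying the hypothesis to the coefficients `u * c t` for all real `u` yields the full
characteristic function of the linear combination. -/
theorem map_linearCombination [IsProbabilityMeasure γ] (h : HasGaussianCharFun γ K) (I : Finset T) (c : T → ℝ) :
    γ.map (fun ω => ∑ t ∈ I, c t * ω t) =
      gaussianReal 0 (∑ s ∈ I, ∑ t ∈ I, c s * c t * K s t).toNNReal := by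
  have hm : Measurable fun ω : T → ℝ => ∑ t ∈ I, c t * ω t := by fun_prop
  have := Measure.isProbabilityMeasure_map (μ := γ) hm.aemeasurable
  refine Measure.ext_of_charFun (funext fun u => ?_)
  rw [charFun_gaussianReal, charFun_apply_real, integral_map hm.aemeasurable (by fun_prop)]
  have := h I (fun t => u * c t)
  have e1 : ∀ ω : T → ℝ, (((∑ t ∈ I, u * c t * ω t : ℝ) : ℂ) * Complex.I) =
      (u : ℂ) * ((∑ t ∈ I, c t * ω t : ℝ) : ℂ) * Complex.I := by
    intro ω
    rw [← Complex.ofReal_mul, Finset.mul_sum]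
    simp only [mul_assoc]
  simp only [e1] at this
  rw [this]
  have e2 : ∑ s ∈ I, ∑ t ∈ I, u * c s * (u * c t) * K s t =
      u ^ 2 * ∑ s ∈ I, ∑ t ∈ I, c s * c t * K s t := by
    simp only [Finset.mul_sum]
    exact Finset.sum_congr rfl fun s _ => Finset.sum_congr rfl fun t _ => by ring
  rw [e2]
  congr 1
  have e3 : (((∑ s ∈ I, ∑ t ∈ I, c s * c t * K s t).toNNReal : ℝ≥0) : ℝ) =
      ∑ s ∈ I, ∑ t ∈ I, c s * c t * K s t := Real.coe_toNNReal _ (h.quadratic_nonneg I c)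
  rw [show (((∑ s ∈ I, ∑ t ∈ I, c s * c t * K s t).toNNReal : ℝ≥0) : ℂ) =
    ((((∑ s ∈ I, ∑ t ∈ I, c s * c t * K s t).toNNReal : ℝ≥0) : ℝ) : ℂ) from rfl, e3]
  push_cast
  ring

theorem isCentredGP [IsProbabilityMeasure γ] (h : HasGaussianCharFun γ K) (hK : ∀ s t, K s t = K t s) : IsCentredGP γ K := by
  have hlaw : ∀ (I : Finset T) (c : T → ℝ), HasLaw (fun ω => ∑ t ∈ I, c t * ω t)
      (gaussianReal 0 (∑ s ∈ I, ∑ t ∈ I, c s * c t * K s t).toNNReal) γ := fun I c =>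
    ⟨Measurable.aemeasurable (by fun_prop), h.map_linearCombination I c⟩
  have hgp : IsGaussianProcess (fun (t : T) (ω : T → ℝ) => ω t) γ := by
    refine ⟨fun I => ⟨?_⟩⟩
    refine isGaussian_of_isGaussian_map fun L => ?_
    classical
    have hr : Measurable fun ω : T → ℝ => I.restrict fun t => ω t := by
      exact Finset.measurable_restrict I
    rw [Measure.map_map (by fun_prop) hr]
    have : (L ∘ fun ω : T → ℝ => I.restrict fun t => ω t) = fun ω =>
        ∑ t ∈ I, (if ht : t ∈ I then L (Pi.single ⟨t, ht⟩ 1) else 0) * ω t :=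
      funext fun ω => apply_restrict_eq_sum L ω
    rw [this, (hlaw I _).map_eq]
    infer_instance
  have hsq : ∀ (I : Finset T) (c : T → ℝ), ∫ ω, (∑ t ∈ I, c t * ω t) ^ 2 ∂γ =
      ∑ s ∈ I, ∑ t ∈ I, c s * c t * K s t := by
    intro I c
    have h1 := (hlaw I c).variance_eq
    rw [variance_id_gaussianReal, variance_of_integral_eq_zero (hlaw I c).aemeasurable
      (by rw [(hlaw I c).integral_eq, integral_id_gaussianReal])] at h1
    simpa [Real.coe_toNNReal _ (h.quadratic_nonneg I c)] using h1
  have hself : ∀ t, ∫ ω, ω t * ω t ∂γ = K t t := by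
    intro t
    have := hsq {t} 1
    simpa [pow_two] using this
  refine ⟨hgp, fun t => ?_, fun s t => ?_⟩
  · have := (hlaw {t} 1).integral_eq
    simpa using this
  · by_cases hst : s = t
    · subst hst; exact hself s
    classical
    -- Polarisation: the second moment of `ω s + ω t` and the diagonal case determine the mixed
    -- moment, by symmetry of `K`.
    have h1 := hsq {s, t} 1
    simp only [Finset.sum_pair hst, Pi.one_apply, one_mul] at h1
    have hi : ∀ a b, Integrable (fun ω : T → ℝ => ω a * ω b) γ := fun a b =>
      (hgp.hasGaussianLaw_eval a).memLp_two.integrable_mul (hgp.hasGaussianLaw_eval b).memLp_two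
    have h2 : ∫ ω, (ω s + ω t) ^ 2 ∂γ =
        ∫ ω, ω s * ω s ∂γ + ∫ ω, ω t * ω t ∂γ + 2 * ∫ ω, ω s * ω t ∂γ := by
      rw [← integral_const_mul, ← integral_add (hi _ _) (hi _ _),
        ← integral_add (by exact (hi _ _).add (hi _ _)) ((hi _ _).const_mul _)]
      exact integral_congr_ae (ae_of_all _ fun ω => by ring)
    rw [h2, hself, hself, hK t s] at h1
    linarith

/-- A law on a product is determined by its finite marginals, and these by their characteristic
functions on the dual. -/
theorem unique {γ' : Measure (T → ℝ)} [IsProbabilityMeasure γ] [IsProbabilityMeasure γ']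
    (h : HasGaussianCharFun γ K) (h' : HasGaussianCharFun γ' K) : γ = γ' := by
  have hr : ∀ I : Finset T, Measurable (I.restrict : (T → ℝ) → (I → ℝ)) := fun I =>
    Finset.measurable_restrict I
  have : ∀ I : Finset T, IsProbabilityMeasure (γ.map I.restrict) := fun I =>
    Measure.isProbabilityMeasure_map (hr I).aemeasurable
  have : ∀ I : Finset T, IsProbabilityMeasure (γ'.map I.restrict) := fun I =>
    Measure.isProbabilityMeasure_map (hr I).aemeasurable
  refine IsProjectiveLimit.unique (P := fun I : Finset T => γ.map I.restrict) (fun I => rfl)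
    fun I => ?_
  refine Measure.ext_of_charFunDual (funext fun L => ?_)
  classical
  rw [charFunDual_apply, charFunDual_apply, integral_map (hr I).aemeasurable (by fun_prop),
    integral_map (hr I).aemeasurable (by fun_prop)]
  simp only [apply_restrict_eq_sum L]
  rw [h, h']

end HasGaussianCharFun

/-- Convergence of characteristic functionals together with bounded second moments yields the
existence of the Gaussian limit process and convergence in distribution to it. -/
theorem exists_isCentredGP_tendstoInDistribution [Countable T]
    {Ω : ℕ → Type*} [∀ n, MeasurableSpace (Ω n)] (P : ∀ n, Measure (Ω n))
    [∀ n, IsProbabilityMeasure (P n)] (Y : ∀ n, Ω n → T → ℝ) (hY : ∀ n, Measurable (Y n))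
    (C : T → ℝ≥0) (hC : ∀ n t, ∫⁻ ω, ‖Y n ω t‖ₑ ^ 2 ∂(P n) ≤ C t)
    (K : T → T → ℝ) (hK : ∀ s t, K s t = K t s)
    (hchar : ∀ (I : Finset T) (c : T → ℝ), Tendsto
      (fun n => ∫ ω, Complex.exp (((∑ t ∈ I, c t * Y n ω t : ℝ) : ℂ) * Complex.I) ∂(P n)) atTop
      (𝓝 (Complex.exp (((-(∑ s ∈ I, ∑ t ∈ I, c s * c t * K s t) / 2 : ℝ) : ℂ))))) :
    ∃ γ : ProbabilityMeasure (T → ℝ), IsCentredGP (γ : Measure (T → ℝ)) K ∧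
      TendstoInDistribution Y atTop id P (γ : Measure (T → ℝ)) := by
  set law : ℕ → ProbabilityMeasure (T → ℝ) := fun n =>
    ⟨(P n).map (Y n), Measure.isProbabilityMeasure_map (hY n).aemeasurable⟩ with hlaw
  have htight : IsTightMeasureSet
      {((μ : ProbabilityMeasure (T → ℝ)) : Measure (T → ℝ)) | μ ∈ Set.range law} := by
    refine isTightMeasureSet_of_lintegral_sq_le C ?_
    rintro _ ⟨_, ⟨n, rfl⟩, rfl⟩ t
    change ∫⁻ ω, ‖ω t‖ₑ ^ 2 ∂((P n).map (Y n)) ≤ C t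
    rw [lintegral_map (by fun_prop) (hY n)]
    exact hC n t
  have hcomp := isCompact_closure_of_isTightMeasureSet htight
  -- By Prokhorov the laws lie in a compact set, so they converge along every ultrafilter; `hchar`
  -- identifies the characteristic functional of each such limit. Since it does not depend on the
  -- ultrafilter, the whole sequence converges.
  have key : ∀ U : Ultrafilter ℕ, (U : Filter ℕ) ≤ atTop → ∃ γ : ProbabilityMeasure (T → ℝ),
      HasGaussianCharFun (γ : Measure (T → ℝ)) K ∧ Tendsto law U (𝓝 γ) := by
    intro U hU
    obtain ⟨γ, -, hγ⟩ := hcomp.ultrafilter_le_nhds (U.map law) (by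
      refine le_principal_iff.2 (mem_of_superset ?_ subset_closure)
      exact mem_map.2 (Filter.univ_mem' fun n => Set.mem_range_self n))
    have hγ' : Tendsto law U (𝓝 γ) := hγ
    refine ⟨γ, fun I c => ?_, hγ'⟩
    rw [ProbabilityMeasure.tendsto_iff_forall_integral_rclike_tendsto ℂ] at hγ'
    have h1 := hγ' (BoundedContinuousFunction.ofNormedAddCommGroup
      (fun ω : T → ℝ => Complex.exp (((∑ t ∈ I, c t * ω t : ℝ) : ℂ) * Complex.I)) (by fun_prop) 1
      (fun ω => by rw [Complex.norm_exp_ofReal_mul_I]))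
    refine tendsto_nhds_unique h1 ?_
    refine ((hchar I c).mono_left hU).congr fun n => ?_
    change _ = ∫ ω : T → ℝ, Complex.exp (((∑ t ∈ I, c t * ω t : ℝ) : ℂ) * Complex.I)
      ∂((P n).map (Y n))
    rw [integral_map (hY n).aemeasurable (Continuous.aestronglyMeasurable (by fun_prop))]
  obtain ⟨γ, hγ, -⟩ := key (Ultrafilter.of atTop) (Ultrafilter.of_le _)
  refine ⟨γ, hγ.isCentredGP hK, fun n => (hY n).aemeasurable, measurable_id.aemeasurable, ?_⟩
  have hlim : Tendsto law atTop (𝓝 γ) := by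
    rw [tendsto_iff_ultrafilter]
    intro U hU
    obtain ⟨γ', hγ', hlim'⟩ := key U hU
    have : γ' = γ := Subtype.ext
      (HasGaussianCharFun.unique (γ := (γ' : Measure (T → ℝ))) (γ' := (γ : Measure (T → ℝ))) hγ' hγ)
    rw [← this]
    exact hlim'
  convert hlim using 2
  refine congrArg 𝓝 (Subtype.ext ?_)
  exact Measure.map_id

end GaussianLimit

/-! ### Families with uniformly bounded moments -/

section Moments

variable {ι κ : Type*} {Ω : ℕ → Type*} [∀ n, MeasurableSpace (Ω n)]

/-- All moments of the family `Y` are bounded, uniformly in `n` and in the index. -/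
structure BddMoments (P : ∀ n, Measure (Ω n)) (Y : ∀ n, ι → Ω n → ℝ) : Prop where
  measurable : ∀ n i, Measurable (Y n i)
  bound : ∀ p : ℕ, ∃ C : ℝ≥0, ∀ n i, eLpNorm (Y n i) p (P n) ≤ C

theorem eLpNorm_natCast_eq {α : Type*} [MeasurableSpace α] {μ : Measure α} (X : α → ℝ) {p : ℕ}
    (hp : p ≠ 0) : eLpNorm X p μ = (∫⁻ ω, ‖X ω‖ₑ ^ p ∂μ) ^ (1 / (p : ℝ)) := by
  rw [eLpNorm_eq_lintegral_rpow_enorm_toReal (by exact_mod_cast hp) (by simp)]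
  simp

theorem lintegral_enorm_pow_eq {α : Type*} [MeasurableSpace α] {μ : Measure α} (X : α → ℝ) {p : ℕ}
    (hp : p ≠ 0) : ∫⁻ ω, ‖X ω‖ₑ ^ p ∂μ = eLpNorm X p μ ^ p := by
  rw [eLpNorm_natCast_eq X hp, ← ENNReal.rpow_natCast, ← ENNReal.rpow_mul]
  rw [one_div_mul_cancel (by exact_mod_cast hp), ENNReal.rpow_one]

/-- The exponents of Cauchy–Schwarz: `p`-th moments of a product are controlled by the `2p`-th
moments of the factors. -/
instance holderTriple_two_mul (p : ℕ) :
    ENNReal.HolderTriple ((2 * p : ℕ) : ℝ≥0∞) ((2 * p : ℕ) : ℝ≥0∞) (p : ℝ≥0∞) where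
  inv_add_inv_eq_inv := by
    rcases Nat.eq_zero_or_pos p with rfl | hp
    · simp
    · push_cast
      rw [ENNReal.mul_inv (Or.inl (by simp)) (Or.inl (by simp)), ← add_mul, ENNReal.inv_two_add_inv_two,
        one_mul]

namespace BddMoments

variable {P : ∀ n, Measure (Ω n)} {Y Z : ∀ n, ι → Ω n → ℝ}

theorem comp (hY : BddMoments P Y) (e : ∀ n, κ → ι) : BddMoments P fun n k => Y n (e n k) :=
  ⟨fun n k => hY.measurable n _, fun p => (hY.bound p).imp fun _ hC n k => hC n _⟩

/-- On a probability space higher norms dominate lower ones, so arbitrarily large exponents `q p`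
suffice. For Gaussian sums only even moments are computed. -/
theorem of_lintegral_pow_le [∀ n, IsProbabilityMeasure (P n)] (hm : ∀ n i, Measurable (Y n i))
    (q : ℕ → ℕ) (hq : ∀ p, p ≤ q p)
    (h : ∀ p, ∃ C : ℝ≥0, ∀ n i, ∫⁻ ω, ‖Y n i ω‖ₑ ^ q p ∂(P n) ≤ C) : BddMoments P Y := by
  refine ⟨hm, fun p => ?_⟩
  rcases Nat.eq_zero_or_pos p with rfl | hp
  · exact ⟨0, fun n i => by simp⟩
  obtain ⟨C, hC⟩ := h p
  have hqp : q p ≠ 0 := (hp.trans_le (hq p)).ne'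
  refine ⟨C ^ (1 / (q p : ℝ)), fun n i => ?_⟩
  refine (eLpNorm_le_eLpNorm_of_exponent_le (q := (q p : ℝ≥0∞)) (by exact_mod_cast hq p)
    (hm n i).aestronglyMeasurable).trans ?_
  rw [eLpNorm_natCast_eq _ hqp, ENNReal.coe_rpow_of_nonneg _ (by positivity)]
  exact ENNReal.rpow_le_rpow (hC n i) (by positivity)

theorem lintegral_pow_le [∀ n, IsProbabilityMeasure (P n)] (hY : BddMoments P Y) (p : ℕ) :
    ∃ C : ℝ≥0, ∀ n i, ∫⁻ ω, ‖Y n i ω‖ₑ ^ p ∂(P n) ≤ C := by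
  rcases Nat.eq_zero_or_pos p with rfl | hp
  · exact ⟨1, fun n i => by simp⟩
  obtain ⟨C, hC⟩ := hY.bound p
  refine ⟨C ^ p, fun n i => ?_⟩
  rw [lintegral_enorm_pow_eq _ hp.ne', ENNReal.coe_pow]
  exact pow_le_pow_left' (hC n i) p

theorem memLp (hY : BddMoments P Y) (p : ℕ) (n : ℕ) (i : ι) : MemLp (Y n i) p (P n) := by
  obtain ⟨C, hC⟩ := hY.bound p
  exact ⟨(hY.measurable n i).aestronglyMeasurable, (hC n i).trans_lt ENNReal.coe_lt_top⟩

theorem integrable (hY : BddMoments P Y) (n : ℕ) (i : ι) : Integrable (Y n i) (P n) :=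
  memLp_one_iff_integrable.1 (by exact_mod_cast hY.memLp 1 n i)

theorem integral_abs_le (hY : BddMoments P Y) :
    ∃ C : ℝ, 0 ≤ C ∧ ∀ n i, ∫ ω, |Y n i ω| ∂(P n) ≤ C := by
  obtain ⟨C, hC⟩ := hY.bound 1
  refine ⟨C, C.2, fun n i => ?_⟩
  have h := hC n i
  rw [Nat.cast_one, eLpNorm_one_eq_lintegral_enorm] at h
  have : ∫ ω, |Y n i ω| ∂(P n) = (∫⁻ ω, ‖Y n i ω‖ₑ ∂(P n)).toReal :=
    integral_norm_eq_lintegral_enorm (hY.measurable n i).aestronglyMeasurable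
  rw [this]
  exact ENNReal.toReal_le_of_le_ofReal C.2 (by rwa [ENNReal.ofReal_coe_nnreal])

theorem congr (hZ : BddMoments P Z) (h : ∀ n i ω, Y n i ω = Z n i ω) : BddMoments P Y := by
  have : Y = Z := funext fun n => funext fun i => funext fun ω => h n i ω
  rwa [this]

theorem mono (hZ : BddMoments P Z) (hm : ∀ n i, Measurable (Y n i))
    (h : ∀ n i ω, |Y n i ω| ≤ |Z n i ω|) : BddMoments P Y :=
  ⟨hm, fun p => (hZ.bound p).imp fun _ hC n i =>
    (eLpNorm_mono fun ω => by simpa using h n i ω).trans (hC n i)⟩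

theorem of_abs_le [∀ n, IsProbabilityMeasure (P n)] {c : ℕ → ι → ℝ} (B : ℝ)
    (h : ∀ n i, |c n i| ≤ B) : BddMoments P fun n i (_ : Ω n) => c n i := by
  refine of_lintegral_pow_le (fun n i => measurable_const) id (fun p => le_rfl)
    fun p => ⟨B.toNNReal ^ p, fun n i => ?_⟩
  rw [lintegral_const, measure_univ, mul_one, ENNReal.coe_pow]
  refine pow_le_pow_left' ?_ p
  rw [← ofReal_norm]
  exact ENNReal.ofReal_le_ofReal (h n i)

theorem const [∀ n, IsProbabilityMeasure (P n)] (c : ℝ) :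
    BddMoments P fun n (_ : ι) (_ : Ω n) => c := of_abs_le |c| fun _ _ => le_rfl

theorem add (hY : BddMoments P Y) (hZ : BddMoments P Z) :
    BddMoments P fun n i ω => Y n i ω + Z n i ω := by
  refine ⟨fun n i => (hY.measurable n i).add (hZ.measurable n i), fun p => ?_⟩
  obtain ⟨C, hC⟩ := hY.bound p
  obtain ⟨D, hD⟩ := hZ.bound p
  rcases Nat.eq_zero_or_pos p with rfl | hp
  · exact ⟨0, fun n i => by simp⟩
  refine ⟨C + D, fun n i => ?_⟩
  refine (eLpNorm_add_le (hY.measurable n i).aestronglyMeasurable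
    (hZ.measurable n i).aestronglyMeasurable (by exact_mod_cast hp)).trans ?_
  rw [ENNReal.coe_add]
  exact add_le_add (hC n i) (hD n i)

theorem mul (hY : BddMoments P Y) (hZ : BddMoments P Z) :
    BddMoments P fun n i ω => Y n i ω * Z n i ω := by
  refine ⟨fun n i => (hY.measurable n i).mul (hZ.measurable n i), fun p => ?_⟩
  obtain ⟨C, hC⟩ := hY.bound (2 * p)
  obtain ⟨D, hD⟩ := hZ.bound (2 * p)
  refine ⟨C * D, fun n i => ?_⟩
  refine (eLpNorm_smul_le_mul_eLpNorm (p := ((2 * p : ℕ) : ℝ≥0∞)) (q := ((2 * p : ℕ) : ℝ≥0∞))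
    (r := (p : ℝ≥0∞)) (hZ.measurable n i).aestronglyMeasurable
    (hY.measurable n i).aestronglyMeasurable).trans ?_
  rw [ENNReal.coe_mul]
  exact mul_le_mul' (hC n i) (hD n i)

theorem const_mul (hY : BddMoments P Y) (c : ℝ) : BddMoments P fun n i ω => c * Y n i ω := by
  refine ⟨fun n i => (hY.measurable n i).const_mul c, fun p => ?_⟩
  obtain ⟨C, hC⟩ := hY.bound p
  refine ⟨‖c‖₊ * C, fun n i => ?_⟩
  refine (eLpNorm_const_smul_le (c := c) (f := Y n i)).trans ?_
  rw [ENNReal.coe_mul]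
  exact mul_le_mul' le_rfl (hC n i)

theorem abs (hY : BddMoments P Y) : BddMoments P fun n i ω => |Y n i ω| :=
  hY.mono (fun n i => (hY.measurable n i).abs) fun n i ω => by rw [abs_abs]

theorem sub (hY : BddMoments P Y) (hZ : BddMoments P Z) :
    BddMoments P fun n i ω => Y n i ω - Z n i ω := by
  simpa [sub_eq_add_neg] using hY.add (hZ.const_mul (-1))

theorem pow [∀ n, IsProbabilityMeasure (P n)] (hY : BddMoments P Y) (k : ℕ) :
    BddMoments P fun n i ω => Y n i ω ^ k := by
  induction k with
  | zero => simpa using const 1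
  | succ k ih => simpa [pow_succ] using ih.mul hY

theorem sum [∀ n, IsProbabilityMeasure (P n)] (s : Finset κ) {Y : κ → ∀ n, ι → Ω n → ℝ}
    (hY : ∀ k ∈ s, BddMoments P (Y k)) : BddMoments P fun n i ω => ∑ k ∈ s, Y k n i ω := by
  classical
  induction s using Finset.induction_on with
  | empty => simpa using const 0
  | insert a s ha ih =>
    simp only [Finset.sum_insert ha]
    exact (hY a (Finset.mem_insert_self a s)).add
      (ih fun k hk => hY k (Finset.mem_insert_of_mem hk))

/-- Weighted sums of total weight at most `B`. -/
theorem average {Y : ∀ n, ι → κ → Ω n → ℝ} (hY : BddMoments P fun n (q : ι × κ) => Y n q.1 q.2)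
    (s : ∀ n, ι → Finset κ) (w : ℕ → ι → ℝ) (B : ℝ≥0) (hw : ∀ n i, |w n i| * (s n i).card ≤ B) :
    BddMoments P fun n i ω => w n i * ∑ k ∈ s n i, Y n i k ω := by
  have hm : ∀ n i k, Measurable (Y n i k) := fun n i k => hY.measurable n (i, k)
  refine ⟨fun n i => (Finset.measurable_fun_sum _ fun k _ => hm n i k).const_mul _, fun p => ?_⟩
  rcases Nat.eq_zero_or_pos p with rfl | hp
  · exact ⟨0, fun n i => by simp⟩
  obtain ⟨C, hC⟩ := hY.bound p
  refine ⟨B * C, fun n i => ?_⟩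
  refine (eLpNorm_const_smul_le (c := w n i) (f := fun ω => ∑ k ∈ s n i, Y n i k ω)).trans ?_
  have h1 : eLpNorm (fun ω => ∑ k ∈ s n i, Y n i k ω) p (P n) ≤ (s n i).card * C := by
    have : (fun ω => ∑ k ∈ s n i, Y n i k ω) = ∑ k ∈ s n i, Y n i k := by ext; simp
    rw [this]
    refine (eLpNorm_sum_le (fun k _ => (hm n i k).aestronglyMeasurable)
      (by exact_mod_cast hp)).trans ?_
    refine (Finset.sum_le_sum fun k _ => hC n (i, k)).trans ?_
    simp
  refine (mul_le_mul' le_rfl h1).trans ?_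
  rw [← mul_assoc, ENNReal.coe_mul]
  refine mul_le_mul' ?_ le_rfl
  have h2 : ‖w n i‖₊ * ((s n i).card : ℝ≥0) ≤ B := by
    rw [← NNReal.coe_le_coe]; simpa using hw n i
  calc ‖w n i‖ₑ * ((s n i).card : ℝ≥0∞) = ((‖w n i‖₊ * ((s n i).card : ℝ≥0) : ℝ≥0) : ℝ≥0∞) := by
        rw [ENNReal.coe_mul]; simp [enorm]
    _ ≤ B := ENNReal.coe_le_coe.2 h2

theorem polyBounded_comp [∀ n, IsProbabilityMeasure (P n)] (hY : BddMoments P Y) {m : ℕ}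
    {c : ℕ → ℝ} (hZ : ∀ n i, Measurable (Z n i))
    (h : ∀ n i ω, |Z n i ω| ≤ ∑ t ∈ Finset.range (m + 1), c t * |Y n i ω| ^ t) :
    BddMoments P Z := by
  refine (BddMoments.sum (P := P) (Finset.range (m + 1))
    (Y := fun t n i ω => c t * |Y n i ω| ^ t) fun t _ => (hY.abs.pow t).const_mul _).mono hZ
    fun n i ω => (h n i ω).trans (le_abs_self _)

end BddMoments

/-- Convergence to zero in mean of a sequence with bounded moments. -/
structure Null (P : ∀ n, Measure (Ω n)) (X : ∀ n, Ω n → ℝ) : Prop where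
  bdd : BddMoments P fun n (_ : Unit) => X n
  tendsto : Tendsto (fun n => ∫ ω, |X n ω| ∂(P n)) atTop (𝓝 0)

namespace Null

variable {P : ∀ n, Measure (Ω n)} {X Z : ∀ n, Ω n → ℝ}

theorem add (hX : Null P X) (hZ : Null P Z) : Null P fun n ω => X n ω + Z n ω := by
  refine ⟨hX.bdd.add hZ.bdd, ?_⟩
  have := hX.tendsto.add hZ.tendsto
  rw [add_zero] at this
  refine squeeze_zero (fun n => integral_nonneg fun ω => abs_nonneg _) (fun n => ?_) this
  rw [← integral_add (hX.bdd.integrable n ()).abs (hZ.bdd.integrable n ()).abs]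
  exact integral_mono ((hX.bdd.add hZ.bdd).integrable n ()).abs
    ((hX.bdd.integrable n ()).abs.add (hZ.bdd.integrable n ()).abs) fun ω => abs_add_le _ _

theorem const_mul (hX : Null P X) (c : ℝ) : Null P fun n ω => c * X n ω := by
  refine ⟨hX.bdd.const_mul c, ?_⟩
  simp only [abs_mul, integral_const_mul]
  simpa using hX.tendsto.const_mul |c|

theorem zero [∀ n, IsProbabilityMeasure (P n)] : Null P fun n (_ : Ω n) => 0 :=
  ⟨BddMoments.const 0, by simp⟩

theorem sum [∀ n, IsProbabilityMeasure (P n)] (s : Finset κ) {X : κ → ∀ n, Ω n → ℝ}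
    (hX : ∀ k ∈ s, Null P (X k)) : Null P fun n ω => ∑ k ∈ s, X k n ω := by
  classical
  induction s using Finset.induction_on with
  | empty => simpa using zero
  | insert a s ha ih =>
    simp only [Finset.sum_insert ha]
    exact (hX a (Finset.mem_insert_self a s)).add
      (ih fun k hk => hX k (Finset.mem_insert_of_mem hk))

/-- From `|A| ≤ δ A² + 1 / (4δ)` one gets `|A X| ≤ δ A² |X| + |X| / (4δ)`. The first term has mean
at most `δ C`, uniformly in `n`; the second tends to zero for fixed `δ`. -/
theorem bdd_mul {A : ∀ n, Ω n → ℝ} (hA : BddMoments P fun n (_ : Unit) => A n) (hX : Null P X) :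
    Null P fun n ω => A n ω * X n ω := by
  refine ⟨hA.mul hX.bdd, ?_⟩
  have hAX : BddMoments P fun n (_ : Unit) ω => A n ω * A n ω * X n ω := (hA.mul hA).mul hX.bdd
  obtain ⟨C, hC0, hC⟩ := hAX.integral_abs_le
  rw [Metric.tendsto_atTop]
  intro ε hε
  -- This makes `δ C < ε / 2`; the threshold `2δε` for the mean of `|X|` makes the other term
  -- smaller than `2δε / (4δ) = ε / 2`.
  set δ : ℝ := ε / (2 * (C + 1)) with hδ
  have hδ0 : 0 < δ := by positivity
  obtain ⟨N, hN⟩ := Metric.tendsto_atTop.1 hX.tendsto (2 * δ * ε) (by positivity)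
  refine ⟨N, fun n hn => ?_⟩
  have h1 := hN n hn
  rw [Real.dist_eq, sub_zero, abs_of_nonneg (integral_nonneg fun ω => abs_nonneg _)] at h1 ⊢
  have hpt : ∀ ω, |A n ω * X n ω| ≤ δ * |A n ω * A n ω * X n ω| + (1 / (4 * δ)) * |X n ω| := by
    intro ω
    rw [abs_mul, abs_mul, abs_mul]
    have h2 : |A n ω| ≤ δ * (|A n ω| * |A n ω|) + 1 / (4 * δ) := by
      have h3 : 0 ≤ (2 * δ * |A n ω| - 1) ^ 2 / (4 * δ) := by positivity
      have h4 : (2 * δ * |A n ω| - 1) ^ 2 / (4 * δ) =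
          δ * (|A n ω| * |A n ω|) + 1 / (4 * δ) - |A n ω| := by
        field_simp
        ring
      linarith
    have h5 := mul_le_mul_of_nonneg_right h2 (abs_nonneg (X n ω))
    linarith
  have hi1 := (hAX.integrable n ()).abs.const_mul δ
  have hi2 := (hX.bdd.integrable n ()).abs.const_mul (1 / (4 * δ))
  have h6 := integral_mono ((hA.mul hX.bdd).integrable n ()).abs (hi1.add hi2) hpt
  simp only [Pi.add_apply] at h6
  rw [integral_add hi1 hi2, integral_const_mul, integral_const_mul] at h6
  have h7 := mul_le_mul_of_nonneg_left (hC n ()) hδ0.le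
  have h8 : δ * C < ε / 2 := by
    rw [hδ, div_mul_eq_mul_div, div_lt_div_iff₀ (by positivity) (by norm_num)]
    nlinarith
  have h9 : 1 / (4 * δ) * ∫ ω, |X n ω| ∂(P n) < ε / 2 := by
    have := mul_lt_mul_of_pos_left h1 (show (0 : ℝ) < 1 / (4 * δ) by positivity)
    refine this.trans_le (le_of_eq ?_)
    field_simp
    ring
  linarith

theorem mul (hX : Null P X) (hZ : Null P Z) : Null P fun n ω => X n ω * Z n ω :=
  hZ.bdd_mul hX.bdd

theorem congr (hX : Null P X) (h : ∀ n ω, Z n ω = X n ω) : Null P Z := by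
  have : Z = X := funext fun n => funext fun ω => h n ω
  rwa [this]

theorem of_eventually (hZ : BddMoments P fun n (_ : Unit) => Z n) (hX : Null P X)
    (h : ∀ᶠ n in atTop, ∀ ω, Z n ω = X n ω) : Null P Z := by
  refine ⟨hZ, hX.tendsto.congr' ?_⟩
  filter_upwards [h] with n hn
  simp only [hn]

theorem of_sq [∀ n, IsProbabilityMeasure (P n)] (hX : BddMoments P fun n (_ : Unit) => X n)
    (h : Tendsto (fun n => ∫ ω, X n ω ^ 2 ∂(P n)) atTop (𝓝 0)) : Null P X := by
  refine ⟨hX, ?_⟩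
  have hs := (Real.continuous_sqrt.tendsto 0).comp h
  rw [Real.sqrt_zero] at hs
  refine squeeze_zero (fun n => integral_nonneg fun ω => abs_nonneg _) (fun n => ?_) hs
  refine Real.le_sqrt_of_sq_le ?_
  have h1 : MemLp (fun ω => |X n ω|) 2 (P n) := by exact_mod_cast hX.abs.memLp 2 n ()
  -- Nonnegativity of the variance of `|X|` is the inequality `(E|X|)² ≤ E X²`.
  have h2 := variance_nonneg (fun ω => |X n ω|) (P n)
  rw [variance_eq_sub h1] at h2
  simpa using h2

/-- Weak law of large numbers for families with asymptotically vanishing common correlation. -/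
theorem average [∀ n, IsProbabilityMeasure (P n)] {Y : ∀ n, ι → Ω n → ℝ} (hY : BddMoments P Y)
    (s : ∀ n, Finset ι) (hs : Tendsto (fun n => (s n).card) atTop atTop) (r : ℕ → ℝ)
    (hr : Tendsto r atTop (𝓝 0))
    (hcorr : ∀ n, ∀ i ∈ s n, ∀ j ∈ s n, i ≠ j → ∫ ω, Y n i ω * Y n j ω ∂(P n) = r n) :
    Null P fun n ω => ((s n).card : ℝ)⁻¹ * ∑ i ∈ s n, Y n i ω := by
  classical
  have hYY : BddMoments P fun n (q : ι × ι) ω => Y n q.1 ω * Y n q.2 ω :=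
    (hY.comp fun _ (q : ι × ι) => q.1).mul (hY.comp fun _ (q : ι × ι) => q.2)
  have hbdd : BddMoments P fun n (_ : Unit) ω => ((s n).card : ℝ)⁻¹ * ∑ i ∈ s n, Y n i ω := by
    refine BddMoments.average (κ := ι) (Y := fun n (_ : Unit) i => Y n i)
      (hY.comp fun _ (q : Unit × ι) => q.2) (fun n _ => s n) (fun n _ => ((s n).card : ℝ)⁻¹) 1 ?_
    intro n _
    rw [abs_of_nonneg (by positivity)]
    exact inv_mul_le_one_of_le₀ le_rfl (by positivity)
  refine of_sq hbdd ?_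
  obtain ⟨C, hC0, hC⟩ := hYY.integral_abs_le
  have hlim : Tendsto (fun n => C * ((s n).card : ℝ)⁻¹ + |r n|) atTop (𝓝 0) := by
    have h1 : Tendsto (fun n => ((s n).card : ℝ)⁻¹) atTop (𝓝 0) :=
      tendsto_inv_atTop_zero.comp (tendsto_natCast_atTop_atTop.comp hs)
    simpa using (h1.const_mul C).add hr.abs
  refine squeeze_zero (fun n => integral_nonneg fun ω => sq_nonneg _) (fun n => ?_) hlim
  have e1 : ∀ ω, (((s n).card : ℝ)⁻¹ * ∑ i ∈ s n, Y n i ω) ^ 2 =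
      ((s n).card : ℝ)⁻¹ ^ 2 * ∑ i ∈ s n, ∑ j ∈ s n, Y n i ω * Y n j ω := by
    intro ω
    rw [mul_pow, pow_two (∑ i ∈ s n, Y n i ω), Finset.sum_mul_sum]
  simp only [e1]
  rw [integral_const_mul, integral_finsetSum _ fun i _ =>
    integrable_finsetSum _ fun j _ => hYY.integrable n (i, j)]
  -- Each row has one diagonal term, at most `C`, and otherwise the common correlation `r n`.
  -- Division by the squared cardinality leaves `C / card + |r n|`.
  have e2 : ∑ i ∈ s n, ∫ ω, ∑ j ∈ s n, Y n i ω * Y n j ω ∂(P n) ≤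
      ∑ i ∈ s n, (C + (s n).card * |r n|) := by
    refine Finset.sum_le_sum fun i hi => ?_
    rw [integral_finsetSum _ fun j _ => hYY.integrable n (i, j)]
    have : ∀ j ∈ s n, ∫ ω, Y n i ω * Y n j ω ∂(P n) ≤ (if j = i then C else 0) + |r n| := by
      intro j hj
      split_ifs with h
      · exact ((le_abs_self _).trans abs_integral_le_integral_abs).trans
          ((hC n (i, j)).trans (le_add_of_nonneg_right (abs_nonneg _)))
      · rw [hcorr n i hi j hj (Ne.symm h), zero_add]
        exact le_abs_self _
    refine (Finset.sum_le_sum this).trans (le_of_eq ?_)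
    rw [Finset.sum_add_distrib, Finset.sum_ite_eq' , if_pos hi]
    simp
  refine (mul_le_mul_of_nonneg_left e2 (by positivity)).trans ?_
  rcases Nat.eq_zero_or_pos (s n).card with h0 | hpos
  · simp [h0]
  · have hc : (0 : ℝ) < (s n).card := by exact_mod_cast hpos
    simp only [Finset.sum_const, nsmul_eq_mul]
    refine le_of_eq ?_
    field_simp

end Null

end Moments

/-! ### Convergence of expectations -/

section Truncation

variable {α : Type*} [MeasurableSpace α] {ν : Measure α} [IsProbabilityMeasure ν]

theorem integral_sq_le_of_lintegral {X : α → ℝ} {C : ℝ≥0} (hX : MemLp X 2 ν)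
    (hXC : ∫⁻ ω, ‖X ω‖ₑ ^ 2 ∂ν ≤ C) : ∫ ω, X ω ^ 2 ∂ν ≤ C := by
  rw [integral_eq_lintegral_of_nonneg_ae (ae_of_all _ fun ω => sq_nonneg _)
    (hX.aestronglyMeasurable.pow 2)]
  refine ENNReal.toReal_le_of_le_ofReal C.2 ?_
  rw [ENNReal.ofReal_coe_nnreal]
  refine le_trans (le_of_eq (lintegral_congr fun ω => ?_)) hXC
  rw [← sq_abs, ENNReal.ofReal_pow (abs_nonneg _), ← Real.norm_eq_abs, ofReal_norm]

/-- The truncation error vanishes where `|X| ≤ M`, and elsewhere it is at most `|X| ≤ X² / M`. -/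
theorem abs_integral_sub_integral_truncation_le {X : α → ℝ} {C : ℝ≥0} (hX : MemLp X 2 ν)
    (hXC : ∫⁻ ω, ‖X ω‖ₑ ^ 2 ∂ν ≤ C) {M : ℝ} (hM : 0 < M) :
    |∫ ω, X ω ∂ν - ∫ ω, max (-M) (min (X ω) M) ∂ν| ≤ C / M := by
  have hXi : Integrable X ν := hX.integrable one_le_two
  have hTi : Integrable (fun ω => max (-M) (min (X ω) M)) ν :=
    (integrable_const (-M)).sup (hXi.inf (integrable_const M))
  rw [← integral_sub hXi hTi]
  refine abs_integral_le_integral_abs.trans ?_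
  have hpt : ∀ ω, |X ω - max (-M) (min (X ω) M)| ≤ X ω ^ 2 / M := by
    intro ω
    rw [le_div_iff₀ hM]
    rcases le_total (X ω) (-M) with h1 | h1
    · rw [min_eq_left (by linarith), max_eq_left h1, abs_of_nonpos (by linarith)]
      nlinarith
    · rcases le_total (X ω) M with h2 | h2
      · rw [min_eq_left h2, max_eq_right h1]; simp; positivity
      · rw [min_eq_right h2, max_eq_right (by linarith), abs_of_nonneg (by linarith)]
        nlinarith
  have hsq : Integrable (fun ω => X ω ^ 2 / M) ν := hX.integrable_sq.div_const M
  refine (integral_mono (hXi.sub hTi).abs hsq hpt).trans ?_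
  rw [integral_div]
  exact div_le_div_of_nonneg_right (integral_sq_le_of_lintegral hX hXC) hM.le

end Truncation

section UniformIntegrability

variable {E : Type*} [TopologicalSpace E] [MeasurableSpace E] [BorelSpace E]
  [HasOuterApproxClosed E]
  {Ω : ℕ → Type*} [∀ n, MeasurableSpace (Ω n)] {P : ∀ n, Measure (Ω n)}
  [∀ n, IsProbabilityMeasure (P n)] {μ : Measure E} [IsProbabilityMeasure μ]
  {f : ∀ n, Ω n → E}

/-- Fatou's lemma for weak convergence: the portmanteau inequality on open sets makes integrals of
nonnegative continuous functions lower semicontinuous. -/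
theorem lintegral_sq_le_of_tendstoInDistribution (hf : TendstoInDistribution f atTop id P μ)
    {h : E → ℝ} (hh : Continuous h) {C : ℝ≥0}
    (hC : ∀ n, ∫⁻ ω, ‖h (f n ω)‖ₑ ^ 2 ∂(P n) ≤ C) : ∫⁻ x, ‖h x‖ₑ ^ 2 ∂μ ≤ C := by
  have hopen := fun G hG => ProbabilityMeasure.le_liminf_measure_open_of_tendsto hf.tendsto
    (G := G) hG
  have key := lintegral_le_liminf_lintegral_of_forall_isOpen_measure_le_liminf_measure
    (f := fun x => h x ^ 2) (by fun_prop) (fun x => sq_nonneg _) hopen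
  have e : ∀ x, ENNReal.ofReal (h x ^ 2) = ‖h x‖ₑ ^ 2 := fun x => by
    rw [← sq_abs, ENNReal.ofReal_pow (abs_nonneg _), ← Real.norm_eq_abs, ofReal_norm]
  simp only [e] at key
  change ∫⁻ x, ‖h x‖ₑ ^ 2 ∂(μ.map id) ≤
    liminf (fun n => ∫⁻ x, ‖h x‖ₑ ^ 2 ∂((P n).map (f n))) atTop at key
  rw [Measure.map_id] at key
  refine key.trans ?_
  refine (liminf_le_liminf (v := fun _ => (C : ℝ≥0∞)) (Eventually.of_forall fun n => ?_)).trans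
    (by simp)
  rw [lintegral_map' (by fun_prop) (hf.forall_aemeasurable n)]
  exact hC n

/-- Under bounded moments, convergence in distribution implies convergence of expectations. -/
theorem tendsto_integral_of_bddMoments (hf : TendstoInDistribution f atTop id P μ)
    {h : E → ℝ} (hh : Continuous h) (hb : BddMoments P fun n (_ : Unit) ω => h (f n ω)) :
    MemLp h 2 μ ∧ Tendsto (fun n => ∫ ω, h (f n ω) ∂(P n)) atTop (𝓝 (∫ x, h x ∂μ)) := by
  obtain ⟨C, hC⟩ := hb.lintegral_pow_le 2
  have hlim := lintegral_sq_le_of_tendstoInDistribution hf hh fun n => hC n ()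
  have hmem : MemLp h 2 μ := by
    refine ⟨hh.aestronglyMeasurable, ?_⟩
    have := lintegral_enorm_pow_eq (μ := μ) h (p := 2) two_ne_zero
    rw [this] at hlim
    by_contra hcon
    rw [not_lt, top_le_iff] at hcon
    simp [hcon] at hlim
  refine ⟨hmem, ?_⟩
  have hbm : ∀ n, MemLp (fun ω => h (f n ω)) 2 (P n) := fun n => by exact_mod_cast hb.memLp 2 n ()
  rw [Metric.tendsto_atTop]
  intro ε hε
  -- Truncating `h` at `M` costs at most `C / M`, uniformly in `n` and also in the limit; the
  -- truncated function is bounded and continuous, so weak convergence applies to it.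
  obtain ⟨M, hM0, hM⟩ : ∃ M : ℝ, 0 < M ∧ C / M < ε / 3 := by
    refine ⟨3 * (C + 1) / ε, by positivity, ?_⟩
    rw [div_lt_iff₀ (by positivity)]
    field_simp
    linarith
  have htr : Tendsto (fun n => ∫ ω, max (-M) (min (h (f n ω)) M) ∂(P n)) atTop
      (𝓝 (∫ x, max (-M) (min (h x) M) ∂μ)) := by
    have h1 := (ProbabilityMeasure.tendsto_iff_forall_integral_tendsto.1 hf.tendsto)
      (BoundedContinuousFunction.ofNormedAddCommGroup
        (fun x => max (-M) (min (h x) M)) (by fun_prop) M fun x => by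
          rw [Real.norm_eq_abs, abs_le]
          exact ⟨le_max_left _ _, max_le (by linarith) (min_le_right _ _)⟩)
    change Tendsto (fun n => ∫ x, max (-M) (min (h x) M) ∂((P n).map (f n))) atTop
      (𝓝 (∫ x, max (-M) (min (h x) M) ∂(μ.map id))) at h1
    rw [Measure.map_id] at h1
    refine h1.congr fun n => ?_
    rw [integral_map (hf.forall_aemeasurable n)
      (Continuous.aestronglyMeasurable (by fun_prop))]
  obtain ⟨N, hN⟩ := Metric.tendsto_atTop.1 htr (ε / 3) (by positivity)
  refine ⟨N, fun n hn => ?_⟩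
  have h1 := hN n hn
  have h2 := abs_integral_sub_integral_truncation_le (hbm n) (hC n ()) hM0
  have h3 := abs_integral_sub_integral_truncation_le hmem hlim hM0
  rw [Real.dist_eq] at h1 ⊢
  rw [abs_le] at h2 h3
  rw [abs_lt] at h1 ⊢
  constructor <;> linarith [h1.1, h1.2, h2.1, h2.2, h3.1, h3.2]

end UniformIntegrability

/-! ### Independent Gaussian weights -/

section GaussianWeights

variable {I J Ω : Type*}

/-- The σ-algebra generated by the variables `V p`, `p ∈ S`. -/
@[reducible]
def sigmaOf (V : I → Ω → ℝ) (S : Set I) : MeasurableSpace Ω :=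
  ⨆ p ∈ S, MeasurableSpace.comap (V p) inferInstance

theorem measurable_sigmaOf (V : I → Ω → ℝ) {S : Set I} {p : I} (hp : p ∈ S) :
    Measurable[sigmaOf V S] (V p) := by
  have h : MeasurableSpace.comap (V p) inferInstance ≤ sigmaOf V S :=
    le_iSup₂_of_le (f := fun p (_ : p ∈ S) => MeasurableSpace.comap (V p) inferInstance) p hp le_rfl
  exact (comap_measurable (V p)).mono h le_rfl

variable {𝓖 : MeasurableSpace Ω} [mΩ : MeasurableSpace Ω]

theorem sigmaOf_le {V : I → Ω → ℝ} (hV : ∀ p, Measurable (V p)) (S : Set I) :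
    sigmaOf V S ≤ mΩ := iSup₂_le fun p _ => (hV p).comap_le

/-- The `V p` are independent centred Gaussians of variance `v p`, jointly independent of `𝓖`. -/
structure GaussWeights (P : Measure Ω) (𝓖 : MeasurableSpace Ω) (V : I → Ω → ℝ) (v : I → ℝ≥0) :
    Prop where
  le : 𝓖 ≤ mΩ
  measurable : ∀ p, Measurable[mΩ] (V p)
  hasLaw : ∀ p, HasLaw (V p) (gaussianReal 0 (v p)) P
  iIndepFun : iIndepFun V P
  indep : Indep 𝓖 (sigmaOf V Set.univ) P

/-- Adjoining `𝓖` to the weights as one more independent σ-algebra lets the general regrouping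
theorem treat blocks that contain both `𝓖` and weights. -/
theorem iIndep_option {P : Measure Ω} [IsProbabilityMeasure P]
    {V : I → Ω → ℝ} (hV : iIndepFun V P) (h : Indep 𝓖 (sigmaOf V Set.univ) P) :
    iIndep (fun o : Option I => o.elim 𝓖 fun p => MeasurableSpace.comap (V p) inferInstance) P := by
  classical
  rw [iIndep_iff]
  intro s f hf
  have hsome : ∀ p ∈ Finset.eraseNone s,
      MeasurableSet[MeasurableSpace.comap (V p) inferInstance] (f (some p)) := fun p hp =>
    hf (some p) (Finset.mem_eraseNone.1 hp)
  have h1 := (iIndep_iff _ _).1 ((iIndepFun_iff_iIndep _ _ _).1 hV) (Finset.eraseNone s)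
    (f := fun p => f (some p)) hsome
  have hms : MeasurableSet[sigmaOf V Set.univ] (⋂ p ∈ Finset.eraseNone s, f (some p)) := by
    refine MeasurableSet.biInter (Finset.countable_toSet _) fun p hp => ?_
    have hle : MeasurableSpace.comap (V p) inferInstance ≤ sigmaOf V Set.univ :=
      (measurable_sigmaOf V (Set.mem_univ p)).comap_le
    exact hle _ (hsome p hp)
  by_cases hn : none ∈ s
  · have hs : s = Finset.insertNone (Finset.eraseNone s) := by
      rw [Finset.insertNone_eraseNone, Finset.insert_eq_of_mem hn]
    have e1 : ⋂ i ∈ s, f i = f none ∩ ⋂ p ∈ Finset.eraseNone s, f (some p) := by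
      ext ω
      simp only [Set.mem_iInter, Set.mem_inter_iff, Finset.mem_eraseNone]
      constructor
      · exact fun h => ⟨h none hn, fun p hp => h _ hp⟩
      · rintro ⟨h, h'⟩ (_ | p) hi
        · exact h
        · exact h' p hi
    rw [e1, (Indep_iff _ _ _).1 h _ _ (hf none hn) hms, h1]
    conv_rhs => rw [hs]
    rw [Finset.prod_insertNone]
  · have hs : s = (Finset.eraseNone s).map Function.Embedding.some := by
      rw [Finset.map_some_eraseNone, Finset.erase_eq_of_notMem hn]
    have e1 : ⋂ i ∈ s, f i = ⋂ p ∈ Finset.eraseNone s, f (some p) := by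
      ext ω
      simp only [Set.mem_iInter, Finset.mem_eraseNone]
      constructor
      · exact fun h p hp => h _ hp
      · rintro h' (_ | p) hi
        · exact absurd hi hn
        · exact h' p hi
    rw [e1, h1]
    conv_rhs => rw [hs]
    rw [Finset.prod_map]
    rfl

namespace GaussWeights

variable {P : Measure Ω} [IsProbabilityMeasure P] {V : I → Ω → ℝ}
  {v : I → ℝ≥0}

/-- The device for successive conditioning: weights outside `S` remain independent Gaussians after
those in `S` have been moved into the conditioning σ-algebra. With `S = ∅` it merely selects
weights. -/
theorem comp (h : GaussWeights P 𝓖 V v) {e : J → I} (he : Function.Injective e) (S : Set I)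
    (hS : ∀ j, e j ∉ S) :
    GaussWeights P (𝓖 ⊔ sigmaOf V S) (fun j => V (e j)) fun j => v (e j) where
  le := sup_le h.le (sigmaOf_le h.measurable S)
  measurable j := h.measurable _
  hasLaw j := h.hasLaw _
  iIndepFun := h.iIndepFun.precomp he
  indep := by
    have h1 := indep_iSup_of_disjoint (m := fun o : Option I =>
      o.elim 𝓖 fun p => MeasurableSpace.comap (V p) inferInstance)
      (by rintro (_ | p); exacts [h.le, (h.measurable p).comap_le])
      (iIndep_option h.iIndepFun h.indep)
      (S := insert none (some '' S)) (T := some '' Set.range e) (by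
        rw [Set.disjoint_left]
        rintro _ (rfl | ⟨p, hp, rfl⟩) ⟨q, ⟨j, rfl⟩, hq⟩
        · cases hq
        · cases hq
          exact hS j hp)
    refine indep_of_indep_of_le_left (indep_of_indep_of_le_right h1 ?_) ?_
    · refine iSup₂_le fun j _ => ?_
      exact le_iSup₂_of_le (some (e j)) ⟨e j, ⟨j, rfl⟩, rfl⟩ le_rfl
    · refine sup_le ?_ (iSup₂_le fun p hp => ?_)
      · exact le_iSup₂_of_le none (Set.mem_insert _ _) le_rfl
      · exact le_iSup₂_of_le (some p) (Set.mem_insert_of_mem _ ⟨p, hp, rfl⟩) le_rfl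

/-- The law of a linear combination of independent centred Gaussians of equal variance. -/
theorem _root_.AttentionGP.map_sum_pi_gaussianReal {s : Finset I} (w : ℝ≥0) (z : s → ℝ) :
    (Measure.pi fun _ : s => gaussianReal 0 w).map (fun y => ∑ r, z r * y r) =
      gaussianReal 0 ((w : ℝ) * ∑ r, z r ^ 2).toNNReal := by
  have hm : Measurable fun y : s → ℝ => ∑ r, z r * y r := by fun_prop
  have := Measure.isProbabilityMeasure_map (μ := Measure.pi fun _ : s => gaussianReal 0 w)
    hm.aemeasurable
  refine Measure.ext_of_charFun (funext fun u => ?_)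
  rw [charFun_gaussianReal, charFun_apply_real, integral_map hm.aemeasurable
    (Continuous.aestronglyMeasurable (by fun_prop))]
  have e1 : ∀ y : s → ℝ, Complex.exp ((u : ℂ) * ((∑ r, z r * y r : ℝ) : ℂ) * Complex.I) =
      ∏ r, Complex.exp (((u * z r : ℝ) : ℂ) * (y r : ℂ) * Complex.I) := by
    intro y
    rw [← Complex.exp_sum]
    congr 1
    push_cast
    rw [Finset.mul_sum, Finset.sum_mul]
    exact Finset.sum_congr rfl fun r _ => by ring
  simp only [e1]
  rw [integral_fintype_prod_eq_prod (f := fun (r : s) (x : ℝ) =>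
    Complex.exp (((u * z r : ℝ) : ℂ) * (x : ℂ) * Complex.I))]
  simp only [← charFun_apply_real, charFun_gaussianReal]
  rw [← Complex.exp_sum]
  congr 1
  have e2 : ((((w : ℝ) * ∑ r, z r ^ 2).toNNReal : ℝ≥0) : ℝ) = (w : ℝ) * ∑ r, z r ^ 2 :=
    Real.coe_toNNReal _ (by positivity)
  rw [show ((((w : ℝ) * ∑ r, z r ^ 2).toNNReal : ℝ≥0) : ℂ) =
    (((((w : ℝ) * ∑ r, z r ^ 2).toNNReal : ℝ≥0) : ℝ) : ℂ) from rfl, e2]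
  push_cast
  simp only [mul_zero, zero_mul, zero_sub, Finset.sum_neg_distrib, ← Finset.sum_div]
  rw [mul_assoc, Finset.sum_mul, Finset.mul_sum]
  congr 2
  exact Finset.sum_congr rfl fun r _ => by ring

/-- The `2q`-th absolute moment of the standard Gaussian. -/
def _root_.AttentionGP.gaussianMoment (q : ℕ) : ℝ≥0∞ := ∫⁻ y, ‖y‖ₑ ^ (2 * q) ∂(gaussianReal 0 1)

theorem _root_.AttentionGP.gaussianMoment_lt_top (q : ℕ) : gaussianMoment q < ∞ := by
  rcases Nat.eq_zero_or_pos q with rfl | hq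
  · simp [gaussianMoment]
  · rw [gaussianMoment, lintegral_enorm_pow_eq (fun y : ℝ => y) (by lia)]
    have h := (memLp_id_gaussianReal' (μ := 0) (v := 1) ((2 * q : ℕ) : ℝ≥0∞)
      (ENNReal.natCast_ne_top _)).2
    exact ENNReal.pow_lt_top h

theorem _root_.AttentionGP.lintegral_pow_gaussianReal (q : ℕ) {τ : ℝ} (hτ : 0 ≤ τ) :
    ∫⁻ y, ‖y‖ₑ ^ (2 * q) ∂(gaussianReal 0 τ.toNNReal) = ‖τ‖ₑ ^ q * gaussianMoment q := by
  have h := gaussianReal_map_const_mul (μ := 0) (v := 1) (Real.sqrt τ)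
  have e : (gaussianReal 0 1).map (fun y => Real.sqrt τ * y) = gaussianReal 0 τ.toNNReal := by
    rw [h, mul_zero, mul_one]
    congr 1
    ext
    simp [Real.sq_sqrt hτ, hτ]
  rw [← e, lintegral_map (by fun_prop) (by fun_prop), gaussianMoment,
    ← lintegral_const_mul _ (by fun_prop)]
  refine lintegral_congr fun y => ?_
  rw [enorm_mul, mul_pow, pow_mul, ← enorm_pow, Real.sq_sqrt hτ]

section ConstantVariance

variable {w : ℝ≥0}

/-- This replaces conditional expectations: as the joint law is a product, Fubini allows the
coefficients to be frozen while the weights are integrated out. -/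
theorem map_prodMk (h : GaussWeights P 𝓖 V fun _ => w) (s : Finset I) {c : I → Ω → ℝ}
    (hc : ∀ r, Measurable[𝓖] (c r)) :
    P.map (fun ω => ((fun r : s => c r ω), fun r : s => V r ω)) =
      (P.map fun ω (r : s) => c r ω).prod (Measure.pi fun _ : s => gaussianReal 0 w) := by
  have hc' : ∀ r, Measurable (c r) := fun r => (hc r).mono h.le le_rfl
  have hind : IndepFun (fun ω (r : s) => c r ω) (fun ω (r : s) => V r ω) P := by
    rw [IndepFun_iff_Indep]
    refine indep_of_indep_of_le_left (indep_of_indep_of_le_right h.indep ?_) ?_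
    · have : Measurable[sigmaOf V Set.univ] fun ω (r : s) => V r ω :=
        (@measurable_pi_iff Ω s (fun _ => ℝ) (sigmaOf V Set.univ) _ _).2 fun r =>
          measurable_sigmaOf V (Set.mem_univ _)
      exact this.comap_le
    · have : Measurable[𝓖] fun ω (r : s) => c r ω := 
        (@measurable_pi_iff Ω s (fun _ => ℝ) 𝓖 _ _).2 fun r => hc r
      exact this.comap_le
  rw [(indepFun_iff_map_prod_eq_prod_map_map
    (measurable_pi_lambda _ fun r : s => hc' r).aemeasurable
    (measurable_pi_lambda _ fun r : s => h.measurable r).aemeasurable).1 hind]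
  congr 1
  have h2 : ProbabilityTheory.iIndepFun (fun r : s => V r) P :=
    h.iIndepFun.precomp Subtype.val_injective
  rw [h2.map_fun_eq_pi_map fun r : s => (h.measurable r).aemeasurable]
  congr 1
  funext r
  exact (h.hasLaw r).map_eq

/-- With frozen coefficients the sum is Gaussian of variance `w ∑ c²`, and the `2q`-th moment scales
as the `q`-th power of the variance. -/
theorem lintegral_enorm_pow_sum (h : GaussWeights P 𝓖 V fun _ => w) (s : Finset I)
    {c : I → Ω → ℝ} (hc : ∀ r, Measurable[𝓖] (c r)) (q : ℕ) :
    ∫⁻ ω, ‖∑ r ∈ s, c r ω * V r ω‖ₑ ^ (2 * q) ∂P =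
      (∫⁻ ω, ‖(w : ℝ) * ∑ r ∈ s, c r ω ^ 2‖ₑ ^ q ∂P) * gaussianMoment q := by
  have hc' : ∀ r, Measurable (c r) := fun r => (hc r).mono h.le le_rfl
  have hV := h.measurable
  have hmc : Measurable fun ω (r : s) => c r ω := measurable_pi_lambda _ fun r => hc' r
  have hmV : Measurable fun ω (r : s) => V r ω := measurable_pi_lambda _ fun r => hV r
  have hF : Measurable fun x : (s → ℝ) × (s → ℝ) => ‖∑ r, x.1 r * x.2 r‖ₑ ^ (2 * q) := by fun_prop
  have h1 : ∫⁻ ω, ‖∑ r ∈ s, c r ω * V r ω‖ₑ ^ (2 * q) ∂P =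
      ∫⁻ x, ‖∑ r, x.1 r * x.2 r‖ₑ ^ (2 * q)
        ∂(P.map (fun ω => ((fun r : s => c r ω), fun r : s => V r ω))) := by
    rw [lintegral_map hF (hmc.prodMk hmV)]
    refine lintegral_congr fun ω => ?_
    rw [← Finset.sum_coe_sort s fun r => c r ω * V r ω]
  rw [h1, h.map_prodMk s hc, lintegral_prod _ hF.aemeasurable]
  have h2 : ∀ z : s → ℝ, ∫⁻ y, ‖∑ r, z r * y r‖ₑ ^ (2 * q)
      ∂(Measure.pi fun _ : s => gaussianReal 0 w) =
      ‖(w : ℝ) * ∑ r, z r ^ 2‖ₑ ^ q * gaussianMoment q := by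
    intro z
    rw [← lintegral_pow_gaussianReal q (τ := (w : ℝ) * ∑ r, z r ^ 2) (by positivity),
      ← map_sum_pi_gaussianReal, lintegral_map (by fun_prop) (by fun_prop)]
  simp only [h2]
  rw [lintegral_mul_const _ (by fun_prop), lintegral_map (by fun_prop) hmc]
  congr 1
  refine lintegral_congr fun ω => ?_
  rw [← Finset.sum_coe_sort s fun r => c r ω ^ 2]

/-- The inner Fubini integral is the characteristic function, at `1`, of a Gaussian whose variance
is the random `w ∑ c²`. -/
theorem integral_cexp_sum (h : GaussWeights P 𝓖 V fun _ => w) (s : Finset I)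
    {c : I → Ω → ℝ} (hc : ∀ r, Measurable[𝓖] (c r)) :
    ∫ ω, Complex.exp (((∑ r ∈ s, c r ω * V r ω : ℝ) : ℂ) * Complex.I) ∂P =
      ((∫ ω, Real.exp (-((w : ℝ) * ∑ r ∈ s, c r ω ^ 2) / 2) ∂P : ℝ) : ℂ) := by
  have hc' : ∀ r, Measurable (c r) := fun r => (hc r).mono h.le le_rfl
  have hV := h.measurable
  have hmc : Measurable fun ω (r : s) => c r ω := measurable_pi_lambda _ fun r => hc' r
  have hmV : Measurable fun ω (r : s) => V r ω := measurable_pi_lambda _ fun r => hV r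
  have hF : Continuous fun x : (s → ℝ) × (s → ℝ) =>
    Complex.exp (((∑ r, x.1 r * x.2 r : ℝ) : ℂ) * Complex.I) := by fun_prop
  have h1 : ∫ ω, Complex.exp (((∑ r ∈ s, c r ω * V r ω : ℝ) : ℂ) * Complex.I) ∂P =
      ∫ x, Complex.exp (((∑ r, x.1 r * x.2 r : ℝ) : ℂ) * Complex.I)
        ∂(P.map (fun ω => ((fun r : s => c r ω), fun r : s => V r ω))) := by
    rw [integral_map (hmc.prodMk hmV).aemeasurable hF.aestronglyMeasurable]
    refine integral_congr_ae (ae_of_all _ fun ω => ?_)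
    dsimp only
    rw [← Finset.sum_coe_sort s fun r => c r ω * V r ω]
  have := Measure.isProbabilityMeasure_map (μ := P) hmc.aemeasurable
  rw [h1, h.map_prodMk s hc, integral_prod]
  · have h2 : ∀ z : s → ℝ, ∫ y, Complex.exp (((∑ r, z r * y r : ℝ) : ℂ) * Complex.I)
        ∂(Measure.pi fun _ : s => gaussianReal 0 w) =
        ((Real.exp (-((w : ℝ) * ∑ r, z r ^ 2) / 2) : ℝ) : ℂ) := by
      intro z
      have h3 := charFun_gaussianReal (μ := 0) (v := ((w : ℝ) * ∑ r, z r ^ 2).toNNReal) 1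
      rw [← map_sum_pi_gaussianReal, charFun_apply_real, integral_map (Measurable.aemeasurable (by fun_prop))
        (Continuous.aestronglyMeasurable (by fun_prop))] at h3
      simp only [Complex.ofReal_one, one_mul] at h3
      rw [h3]
      have e2 : ((((w : ℝ) * ∑ r, z r ^ 2).toNNReal : ℝ≥0) : ℝ) = (w : ℝ) * ∑ r, z r ^ 2 :=
        Real.coe_toNNReal _ (by positivity)
      rw [show ((((w : ℝ) * ∑ r, z r ^ 2).toNNReal : ℝ≥0) : ℂ) =
        (((((w : ℝ) * ∑ r, z r ^ 2).toNNReal : ℝ≥0) : ℝ) : ℂ) from rfl, e2, Complex.ofReal_exp]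
      congr 1
      push_cast
      ring
    simp only [h2]
    rw [integral_complex_ofReal, integral_map hmc.aemeasurable
      (Continuous.aestronglyMeasurable (by fun_prop))]
    congr 1
    refine integral_congr_ae (ae_of_all _ fun ω => ?_)
    dsimp only
    rw [← Finset.sum_coe_sort s fun r => c r ω ^ 2]
  · refine (integrable_const (1 : ℝ)).mono' hF.aestronglyMeasurable (ae_of_all _ fun x => ?_)
    rw [Complex.norm_exp_ofReal_mul_I]

theorem integral_mul_weight (h : GaussWeights P 𝓖 V fun _ => w) [DecidableEq I] (r r' : I) :
    ∫ ω, V r ω * V r' ω ∂P = if r = r' then (w : ℝ) else 0 := by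
  have hmean : ∀ r, ∫ ω, V r ω ∂P = 0 := fun r => by
    rw [(h.hasLaw r).integral_eq, integral_id_gaussianReal]
  split_ifs with hr
  · subst hr
    have h1 := (h.hasLaw r).variance_eq
    rw [variance_id_gaussianReal, variance_of_integral_eq_zero (h.measurable r).aemeasurable
      (hmean r)] at h1
    rw [← h1]
    exact integral_congr_ae (ae_of_all _ fun ω => (pow_two _).symm)
  · rw [(h.iIndepFun.indepFun hr).integral_fun_mul_eq_mul_integral
      (h.measurable r).aestronglyMeasurable (h.measurable r').aestronglyMeasurable, hmean,
      zero_mul]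

/-- Second-order conditional moments of linear combinations of the weights. -/
theorem integral_mul_sum_mul_sum (h : GaussWeights P 𝓖 V fun _ => w) (s : Finset I)
    {B : Ω → ℝ} {c c' : I → Ω → ℝ} (hB : Measurable[𝓖] B) (hc : ∀ r, Measurable[𝓖] (c r))
    (hc' : ∀ r, Measurable[𝓖] (c' r))
    (hint : ∀ r r', Integrable (fun ω => B ω * (c r ω * c' r' ω)) P) :
    ∫ ω, B ω * ((∑ r ∈ s, c r ω * V r ω) * ∑ r ∈ s, c' r ω * V r ω) ∂P =
      ∫ ω, B ω * (w * ∑ r ∈ s, c r ω * c' r ω) ∂P := by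
  classical
  have hL2 : ∀ r, MemLp (V r) 2 P := fun r =>
    (h.hasLaw r).hasGaussianLaw.memLp_two
  have hVV : ∀ r r', Integrable (fun ω => V r ω * V r' ω) P := fun r r' =>
    (hL2 r).integrable_mul (hL2 r')
  -- The coefficient is `𝓖`-measurable, so each expectation splits, and only the diagonal terms `r =
  -- r'` survive.
  have hind : ∀ r r', IndepFun (fun ω => B ω * (c r ω * c' r' ω)) (fun ω => V r ω * V r' ω) P := by
    intro r r'
    rw [IndepFun_iff_Indep]
    refine indep_of_indep_of_le_left (indep_of_indep_of_le_right h.indep ?_) ?_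
    · exact ((measurable_sigmaOf V (Set.mem_univ r)).mul
        (measurable_sigmaOf V (Set.mem_univ r'))).comap_le
    · exact (hB.mul ((hc r).mul (hc' r'))).comap_le
  have e1 : ∀ ω, B ω * ((∑ r ∈ s, c r ω * V r ω) * ∑ r ∈ s, c' r ω * V r ω) =
      ∑ r ∈ s, ∑ r' ∈ s, (B ω * (c r ω * c' r' ω)) * (V r ω * V r' ω) := by
    intro ω
    rw [Finset.sum_mul_sum, Finset.mul_sum]
    refine Finset.sum_congr rfl fun r _ => ?_
    rw [Finset.mul_sum]
    exact Finset.sum_congr rfl fun r' _ => by ring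
  have hI : ∀ r r', Integrable (fun ω => (B ω * (c r ω * c' r' ω)) * (V r ω * V r' ω)) P :=
    fun r r' => (hind r r').integrable_mul (hint r r') (hVV r r')
  simp only [e1]
  rw [integral_finsetSum _ fun r _ => integrable_finsetSum _ fun r' _ => hI r r']
  have e2 : ∀ r ∈ s, ∫ ω, ∑ r' ∈ s, (B ω * (c r ω * c' r' ω)) * (V r ω * V r' ω) ∂P =
      ∫ ω, w * (B ω * (c r ω * c' r ω)) ∂P := by
    intro r hr
    rw [integral_finsetSum _ fun r' _ => hI r r', Finset.sum_eq_single_of_mem r hr]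
    · rw [(hind r r).integral_fun_mul_eq_mul_integral (hint r r).aestronglyMeasurable
        (hVV r r).aestronglyMeasurable, h.integral_mul_weight, if_pos rfl, integral_const_mul,
        mul_comm]
    · intro r' _ hne
      rw [(hind r r').integral_fun_mul_eq_mul_integral (hint r r').aestronglyMeasurable
        (hVV r r').aestronglyMeasurable, h.integral_mul_weight, if_neg (Ne.symm hne), mul_zero]
  rw [Finset.sum_congr rfl e2, ← integral_finsetSum _ fun r _ => (hint r r).const_mul _]
  refine integral_congr_ae (ae_of_all _ fun ω => ?_)
  dsimp only
  rw [Finset.mul_sum, Finset.mul_sum]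
  exact Finset.sum_congr rfl fun r _ => by ring

end ConstantVariance

end GaussWeights

end GaussianWeights

/-! ### Sequences of Gaussian linear combinations -/

section GaussianSums

variable {Ω : ℕ → Type*} {ι Q R T : Type*}

/-- The `2q`-th moment is a Gaussian constant times the `q`-th moment of the conditional variance,
which is a sum of squared coefficients of total weight at most `B`. The conditioning σ-algebra may
vary with `i`, so that the coefficients can involve other weights. -/
theorem BddMoments.gaussSum {𝓖 : ∀ n, ι → MeasurableSpace (Ω n)} [∀ n, MeasurableSpace (Ω n)]
    {P : ∀ n, Measure (Ω n)} [∀ n, IsProbabilityMeasure (P n)]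
    {V : ∀ n, ι → R → Ω n → ℝ} {w : ℕ → ι → ℝ≥0}
    (hV : ∀ n i, GaussWeights (P n) (𝓖 n i) (V n i) fun _ => w n i) {c : ∀ n, ι → R → Ω n → ℝ}
    (hc : BddMoments P fun n (p : ι × R) => c n p.1 p.2)
    (hcm : ∀ n i r, Measurable[𝓖 n i] (c n i r)) (s : ∀ n, ι → Finset R) (a : ℕ → ι → ℝ) (B : ℝ≥0)
    (hB : ∀ n i, a n i ^ 2 * w n i * (s n i).card ≤ B) :
    BddMoments P fun n i ω => a n i * ∑ r ∈ s n i, c n i r ω * V n i r ω := by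
  have hcm' : ∀ n i r, Measurable (c n i r) := fun n i r => hc.measurable n (i, r)
  have hVm : ∀ n i r, Measurable (V n i r) := fun n i r => (hV n i).measurable r
  have hsq : BddMoments P fun n i ω => (a n i ^ 2 * w n i) * ∑ r ∈ s n i, c n i r ω ^ 2 := by
    refine BddMoments.average (Y := fun n i r ω => c n i r ω ^ 2) (hc.pow 2) s
      (fun n i => a n i ^ 2 * w n i) B fun n i => ?_
    rw [abs_of_nonneg (by positivity)]
    exact hB n i
  refine of_lintegral_pow_le (fun n i => (Finset.measurable_fun_sum _ fun r _ =>
    (hcm' n i r).mul (hVm n i r)).const_mul _) (fun q => 2 * q) (fun p => by lia) fun q => ?_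
  obtain ⟨C, hC⟩ := hsq.lintegral_pow_le q
  refine ⟨C * (gaussianMoment q).toNNReal, fun n i => ?_⟩
  have h1 := (hV n i).lintegral_enorm_pow_sum (s n i) (c := fun r ω => a n i * c n i r ω)
    (fun r => (hcm n i r).const_mul _) q
  have e1 : ∀ ω, a n i * ∑ r ∈ s n i, c n i r ω * V n i r ω =
      ∑ r ∈ s n i, a n i * c n i r ω * V n i r ω := fun ω => by
    rw [Finset.mul_sum]
    exact Finset.sum_congr rfl fun r _ => by ring
  have e2 : ∀ ω, (w n i : ℝ) * ∑ r ∈ s n i, (a n i * c n i r ω) ^ 2 =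
      (a n i ^ 2 * w n i) * ∑ r ∈ s n i, c n i r ω ^ 2 := fun ω => by
    rw [Finset.mul_sum, Finset.mul_sum]
    exact Finset.sum_congr rfl fun r _ => by ring
  simp only [e1, h1, e2]
  rw [ENNReal.coe_mul, ENNReal.coe_toNNReal (gaussianMoment_lt_top q).ne]
  exact mul_le_mul' (hC n i) le_rfl

variable {𝓖 : ∀ n, MeasurableSpace (Ω n)} [∀ n, MeasurableSpace (Ω n)]
  {P : ∀ n, Measure (Ω n)} [∀ n, IsProbabilityMeasure (P n)]

/-- Averages over independent blocks of weights of centred quadratic forms vanish. -/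
theorem Null.average_quadratic {V : ∀ n, Q × R → Ω n → ℝ} {w : ℕ → ℝ≥0}
    (hV : ∀ n, GaussWeights (P n) (𝓖 n) (V n) fun _ => w n) {c c' : ∀ n, R → Ω n → ℝ}
    {A : ∀ n, Q → Ω n → ℝ} (hc : BddMoments P c) (hc' : BddMoments P c') (hA : BddMoments P A)
    (hcm : ∀ n r, Measurable[𝓖 n] (c n r)) (hcm' : ∀ n r, Measurable[𝓖 n] (c' n r))
    (hAm : ∀ n q, Measurable[𝓖 n] (A n q)) (s : ∀ n, Finset R) (B : ℝ≥0)
    (hB : ∀ n, (w n : ℝ) * (s n).card ≤ B)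
    (t : ∀ n, Finset Q) (ht : Tendsto (fun n => (t n).card) atTop atTop) :
    Null P fun n ω => ((t n).card : ℝ)⁻¹ * ∑ q ∈ t n, A n q ω *
      ((∑ r ∈ s n, c n r ω * V n (q, r) ω) * (∑ r ∈ s n, c' n r ω * V n (q, r) ω) -
        w n * ∑ r ∈ s n, c n r ω * c' n r ω) := by
  classical
  -- Conditioning on `𝓖` and on every block other than `q`.
  have hblock : ∀ n q, GaussWeights (P n) (𝓖 n ⊔ sigmaOf (V n) (Prod.fst ⁻¹' {q}ᶜ))
      (fun r => V n (q, r)) fun _ => w n := fun n q =>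
    (hV n).comp (e := fun r => (q, r)) (Prod.mk_right_injective q) _ (by simp)
  have hLin : ∀ {c : ∀ n, R → Ω n → ℝ}, BddMoments P c → (∀ n r, Measurable[𝓖 n] (c n r)) →
      BddMoments P fun n q ω => ∑ r ∈ s n, c n r ω * V n (q, r) ω := by
    intro c hc hcm
    simpa using BddMoments.gaussSum (V := fun n q r => V n (q, r)) (w := fun n _ => w n) hblock
      (c := fun n _ r => c n r) (hc.comp fun _ (p : Q × R) => p.2)
      (fun n q r => (hcm n r).mono le_sup_left le_rfl) (fun n _ => s n) (fun _ _ => 1) B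
      (fun n _ => by simpa using hB n)
  have hmean : BddMoments P fun n (_ : Q) ω => (w n : ℝ) * ∑ r ∈ s n, c n r ω * c' n r ω := by
    refine BddMoments.average (Y := fun n (_ : Q) r ω => c n r ω * c' n r ω)
      ((hc.mul hc').comp fun _ (p : Q × R) => p.2) (fun n _ => s n) (fun n _ => w n) B fun n _ => ?_
    rw [abs_of_nonneg (by positivity)]
    exact hB n
  have hD := ((hLin hc hcm).mul (hLin hc' hcm')).sub hmean
  have hY := hA.mul hD
  refine Null.average hY t ht (fun _ => 0) tendsto_const_nhds fun n q _ q' _ hne => ?_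
  -- `q`-block against everything else
  have hVn : ∀ r, Measurable[𝓖 n ⊔ sigmaOf (V n) (Prod.fst ⁻¹' {q}ᶜ)] (V n (q', r)) := fun r =>
    (measurable_sigmaOf (V n) (S := Prod.fst ⁻¹' {q}ᶜ) (p := (q', r)) (by
      simpa using Ne.symm hne)).mono le_sup_right le_rfl
  have lift : ∀ {X : Ω n → ℝ}, Measurable[𝓖 n] X →
      Measurable[𝓖 n ⊔ sigmaOf (V n) (Prod.fst ⁻¹' {q}ᶜ)] X := fun h => h.mono le_sup_left le_rfl
  -- Everything in the product of the two summands except the centred form of block `q`. That form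
  -- has conditional mean zero, so the correlation vanishes exactly; the `A n q` need only be
  -- `𝓖`-measurable, not independent of each other.
  set B' : Ω n → ℝ := fun ω => A n q ω * (A n q' ω *
      ((∑ r ∈ s n, c n r ω * V n (q', r) ω) * (∑ r ∈ s n, c' n r ω * V n (q', r) ω) -
        w n * ∑ r ∈ s n, c n r ω * c' n r ω)) with hB'
  have hB'm : Measurable[𝓖 n ⊔ sigmaOf (V n) (Prod.fst ⁻¹' {q}ᶜ)] B' :=
    (lift (hAm n q)).mul ((lift (hAm n q')).mul
      (((Finset.measurable_fun_sum _ fun r _ => (lift (hcm n r)).mul (hVn r)).mul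
        (Finset.measurable_fun_sum _ fun r _ => (lift (hcm' n r)).mul (hVn r))).sub
        ((Finset.measurable_fun_sum _ fun r _ =>
          (lift (hcm n r)).mul (lift (hcm' n r))).const_mul _)))
  have hBall : BddMoments P fun n (p : Q × Q) ω => A n p.1 ω * (A n p.2 ω *
      ((∑ r ∈ s n, c n r ω * V n (p.2, r) ω) * (∑ r ∈ s n, c' n r ω * V n (p.2, r) ω) -
        w n * ∑ r ∈ s n, c n r ω * c' n r ω)) :=
    (hA.comp fun _ (p : Q × Q) => p.1).mul (hY.comp fun _ (p : Q × Q) => p.2)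
  have hcc : BddMoments P fun n (p : R × R) ω => c n p.1 ω * c' n p.2 ω :=
    (hc.comp fun _ (p : R × R) => p.1).mul (hc'.comp fun _ (p : R × R) => p.2)
  have hint : ∀ r r', Integrable (fun ω => B' ω * (c n r ω * c' n r' ω)) (P n) := fun r r' =>
    ((hBall.comp fun _ (_ : Unit) => (q, q')).mul
      (hcc.comp fun _ (_ : Unit) => (r, r'))).integrable n ()
  have key := (hblock n q).integral_mul_sum_mul_sum (s n) hB'm (fun r => lift (hcm n r))
    (fun r => lift (hcm' n r)) hint
  have e1 : ∀ ω, A n q ω * ((∑ r ∈ s n, c n r ω * V n (q, r) ω) *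
      (∑ r ∈ s n, c' n r ω * V n (q, r) ω) - w n * ∑ r ∈ s n, c n r ω * c' n r ω) *
      (A n q' ω * ((∑ r ∈ s n, c n r ω * V n (q', r) ω) *
      (∑ r ∈ s n, c' n r ω * V n (q', r) ω) - w n * ∑ r ∈ s n, c n r ω * c' n r ω)) =
      B' ω * ((∑ r ∈ s n, c n r ω * V n (q, r) ω) * ∑ r ∈ s n, c' n r ω * V n (q, r) ω) -
        B' ω * (w n * ∑ r ∈ s n, c n r ω * c' n r ω) := fun ω => by
    rw [hB']; ring
  simp only [e1]
  rw [integral_sub, key, sub_self]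
  · exact ((hBall.comp fun _ (_ : Unit) => (q, q')).mul (((hLin hc hcm).mul (hLin hc' hcm')).comp
      fun _ (_ : Unit) => q)).integrable n ()
  · exact ((hBall.comp fun _ (_ : Unit) => (q, q')).mul (hmean.comp
      fun _ (_ : Unit) => q)).integrable n ()

/-- The function `exp(-x / 2)` is Lipschitz on the half-line; the constant `1` is not sharp but
suffices. -/
theorem abs_exp_neg_half_sub_le {x y : ℝ} (hx : 0 ≤ x) (hy : 0 ≤ y) :
    |Real.exp (-x / 2) - Real.exp (-y / 2)| ≤ |x - y| := by
  wlog h : x ≤ y generalizing x y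
  · rw [abs_sub_comm, abs_sub_comm x]
    exact this hy hx (not_le.1 h).le
  have h1 : Real.exp (-y / 2) ≤ Real.exp (-x / 2) := Real.exp_le_exp.2 (by linarith)
  rw [abs_of_nonneg (by linarith), abs_of_nonpos (by linarith)]
  have h2 : Real.exp (-y / 2) = Real.exp (-x / 2) * Real.exp (-(y - x) / 2) := by
    rw [← Real.exp_add]; ring_nf
  have h3 : Real.exp (-x / 2) ≤ 1 := Real.exp_le_one_iff.2 (by linarith)
  have h4 := Real.add_one_le_exp (-(y - x) / 2)
  have h5 : Real.exp (-(y - x) / 2) ≤ 1 := Real.exp_le_one_iff.2 (by linarith)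
  rw [h2]
  nlinarith [Real.exp_pos (-x / 2)]

/-- Gaussian limit of linear combinations of independent Gaussian weights with random
coefficients whose empirical covariances converge. -/
theorem exists_gaussian_limit [Countable T] {V : ∀ n, R → Ω n → ℝ} {w : ℕ → ℝ≥0}
    (hV : ∀ n, GaussWeights (P n) (𝓖 n) (V n) fun _ => w n) (s : ∀ n, T → Finset R)
    {b : ∀ n, T → R → Ω n → ℝ} (hb : ∀ n t r, Measurable[𝓖 n] (b n t r))
    (hs : ∀ n t r, r ∉ s n t → ∀ ω, b n t r ω = 0) {Y : ∀ n, Ω n → T → ℝ}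
    (hYeq : ∀ n ω t, Y n ω t = ∑ r ∈ s n t, b n t r ω * V n r ω)
    (hY : ∀ t, BddMoments P fun n (_ : Unit) ω => Y n ω t) {K : T → T → ℝ}
    (hK : ∀ t t', Null P fun n ω => w n * ∑ r ∈ s n t, b n t r ω * b n t' r ω - K t t') :
    ∃ γ : ProbabilityMeasure (T → ℝ), IsCentredGP (γ : Measure (T → ℝ)) K ∧
      TendstoInDistribution Y atTop id P (γ : Measure (T → ℝ)) := by
  classical
  -- Since the coefficients vanish off `s n t`, sums attached to different `t` can be taken over one
  -- common finite set.
  have hsum : ∀ n t (U : Finset R), s n t ⊆ U → ∀ ω (F : R → ℝ),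
      ∑ r ∈ s n t, b n t r ω * F r = ∑ r ∈ U, b n t r ω * F r := fun n t U hU ω F =>
    Finset.sum_subset hU fun r _ hr => by rw [hs n t r hr, zero_mul]
  -- The empirical covariance is symmetric in `t` and `t'`, and its limit in mean is unique.
  have hsymm : ∀ t t', K t t' = K t' t := by
    intro t t'
    have e : ∀ n ω, ∑ r ∈ s n t, b n t r ω * b n t' r ω = ∑ r ∈ s n t', b n t' r ω * b n t r ω := by
      intro n ω
      rw [hsum n t (s n t ∪ s n t') Finset.subset_union_left ω (fun r => b n t' r ω),
        hsum n t' (s n t ∪ s n t') Finset.subset_union_right ω (fun r => b n t r ω)]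
      exact Finset.sum_congr rfl fun r _ => mul_comm _ _
    have h1 := ((hK t t').add ((hK t' t).const_mul (-1))).tendsto
    have h2 : ∀ n, ∫ ω, |(w n * ∑ r ∈ s n t, b n t r ω * b n t' r ω - K t t') +
        -1 * (w n * ∑ r ∈ s n t', b n t' r ω * b n t r ω - K t' t)| ∂(P n) = |K t' t - K t t'| := by
      intro n
      have : ∀ ω, (w n * ∑ r ∈ s n t, b n t r ω * b n t' r ω - K t t') +
        -1 * (w n * ∑ r ∈ s n t', b n t' r ω * b n t r ω - K t' t) = K t' t - K t t' := fun ω => by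
        rw [e n ω]; ring
      simp only [this]
      simp
    simp only [h2] at h1
    have := tendsto_nhds_unique h1 tendsto_const_nhds
    rw [eq_comm, abs_eq_zero, sub_eq_zero] at this
    exact this.symm
  have hbdd : ∀ t, ∃ C : ℝ≥0, ∀ n, ∫⁻ ω, ‖Y n ω t‖ₑ ^ 2 ∂(P n) ≤ C := fun t => by
    obtain ⟨C, hC⟩ := (hY t).lintegral_pow_le 2
    exact ⟨C, fun n => hC n ()⟩
  choose C hC using hbdd
  refine exists_isCentredGP_tendstoInDistribution P Y
    (fun n => measurable_pi_iff.2 fun t => (hY t).measurable n ()) C (fun n t => hC t n) K hsymm ?_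
  intro I c
  set q : ℝ := ∑ s ∈ I, ∑ t ∈ I, c s * c t * K s t with hq
  -- The conditional variance of `∑ c t * Y n ω t`; by bilinearity it converges in mean to `q`.
  set S : ∀ n, Ω n → ℝ := fun n ω =>
    w n * ∑ r ∈ I.biUnion (s n), (∑ t ∈ I, c t * b n t r ω) ^ 2 with hS
  have hSnonneg : ∀ n ω, 0 ≤ S n ω := fun n ω => by positivity
  have hSnull : Null P fun n ω => S n ω - q := by
    refine (Null.sum I fun t _ => Null.sum I fun t' _ =>
      (hK t t').const_mul (c t * c t')).congr fun n ω => ?_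
    simp only [mul_sub, Finset.sum_sub_distrib]
    rw [hq, hS]
    congr 1
    dsimp only
    have e : ∀ t ∈ I, ∀ t' ∈ I, c t * c t' * (w n * ∑ r ∈ s n t, b n t r ω * b n t' r ω) =
        ∑ r ∈ I.biUnion (s n), w n * ((c t * b n t r ω) * (c t' * b n t' r ω)) := by
      intro t ht t' _
      rw [hsum n t _ (Finset.subset_biUnion_of_mem (s n) ht) ω (fun r => b n t' r ω),
        Finset.mul_sum, Finset.mul_sum]
      exact Finset.sum_congr rfl fun r _ => by ring
    rw [Finset.sum_congr rfl fun t ht => Finset.sum_congr rfl fun t' ht' => e t ht t' ht']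
    have e' : ∀ r, w n * (∑ t ∈ I, c t * b n t r ω) ^ 2 =
        ∑ t ∈ I, ∑ t' ∈ I, w n * ((c t * b n t r ω) * (c t' * b n t' r ω)) := fun r => by
      rw [pow_two, Finset.sum_mul_sum, Finset.mul_sum]
      exact Finset.sum_congr rfl fun t _ => Finset.mul_sum _ _ _
    rw [Finset.mul_sum, Finset.sum_congr rfl fun r _ => e' r, Finset.sum_comm]
    refine Finset.sum_congr rfl fun t _ => ?_
    rw [Finset.sum_comm]
  have hq0 : 0 ≤ q := by
    by_contra hcon
    have h1 := hSnull.tendsto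
    have h2 : ∀ n, -q ≤ ∫ ω, |S n ω - q| ∂(P n) := by
      intro n
      have h3 := integral_mono (μ := P n) (integrable_const (-q)) (hSnull.bdd.integrable n ()).abs
        (fun ω => (by linarith [hSnonneg n ω] : -q ≤ S n ω - q).trans (le_abs_self _))
      simpa using h3
    have := ge_of_tendsto' h1 h2
    linarith
  have hchar : ∀ n, ∫ ω, Complex.exp (((∑ t ∈ I, c t * Y n ω t : ℝ) : ℂ) * Complex.I) ∂(P n) =
      ((∫ ω, Real.exp (-(S n ω) / 2) ∂(P n) : ℝ) : ℂ) := by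
    intro n
    have h1 := (hV n).integral_cexp_sum (I.biUnion (s n)) (c := fun r ω => ∑ t ∈ I, c t * b n t r ω)
      fun r => Finset.measurable_fun_sum _ fun t _ => (hb n t r).const_mul _
    rw [← h1]
    refine integral_congr_ae (ae_of_all _ fun ω => ?_)
    dsimp only
    congr 3
    rw [Finset.sum_congr rfl fun t ht => by
      rw [hYeq, hsum n t _ (Finset.subset_biUnion_of_mem (s n) ht) ω (fun r => V n r ω),
        Finset.mul_sum]]
    rw [Finset.sum_comm]
    refine Finset.sum_congr rfl fun r _ => ?_
    rw [Finset.sum_mul]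
    exact Finset.sum_congr rfl fun t _ => by ring
  simp only [hchar]
  refine (Complex.continuous_ofReal.tendsto _).comp ?_ |>.congr' (by rfl) |>.trans (by
    rw [Complex.ofReal_exp])
  -- By the Lipschitz bound, the distance is at most the mean of `|S n - q|`.
  rw [tendsto_iff_dist_tendsto_zero]
  refine squeeze_zero (fun n => dist_nonneg) (fun n => ?_) hSnull.tendsto
  have hSm : Measurable (S n) := by
    have := (hSnull.bdd.measurable n ()).add_const q
    simpa using this
  have hi : Integrable (fun ω => Real.exp (-(S n ω) / 2)) (P n) := by
    refine (integrable_const (1 : ℝ)).mono' (by fun_prop) (ae_of_all _ fun ω => ?_)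
    rw [Real.norm_eq_abs, abs_of_pos (Real.exp_pos _)]
    exact Real.exp_le_one_iff.2 (by linarith [hSnonneg n ω])
  rw [Real.dist_eq]
  have h1 : ∫ ω, Real.exp (-(S n ω) / 2) ∂(P n) - Real.exp (-q / 2) =
      ∫ ω, (Real.exp (-(S n ω) / 2) - Real.exp (-q / 2)) ∂(P n) := by
    rw [integral_sub hi (integrable_const _)]; simp
  rw [h1]
  refine abs_integral_le_integral_abs.trans ?_
  exact integral_mono (hi.sub (integrable_const _)).abs (hSnull.bdd.integrable n ()).abs
    fun ω => abs_exp_neg_half_sub_le (hSnonneg n ω) hq0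

end GaussianSums

/-! ### Measurability of the layer maps -/

section LayerMeasurability

variable {dS : ℕ} {Ω : Type*} {m : MeasurableSpace Ω}

namespace Attention

variable {W : AttnParam → Ω → ℝ} {g : Fin dS → ℕ → Ω → ℝ}

theorem measurable_query (d : ℕ) (hg : ∀ a j, Measurable (g a j)) {h : ℕ}
    (hW : ∀ i j, Measurable (W (.query h i j))) (a : Fin dS) (j : ℕ) :
    Measurable fun ω => query d (fun p => W p ω) (fun a j => g a j ω) h a j :=
  Finset.measurable_fun_sum _ fun i _ => (hg a i).mul (hW i j)

theorem measurable_key (d : ℕ) (hg : ∀ a j, Measurable (g a j)) {h : ℕ}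
    (hW : ∀ i j, Measurable (W (.key h i j))) (a : Fin dS) (j : ℕ) :
    Measurable fun ω => key d (fun p => W p ω) (fun a j => g a j ω) h a j :=
  Finset.measurable_fun_sum _ fun i _ => (hg a i).mul (hW i j)

theorem measurable_value (d : ℕ) (hg : ∀ a j, Measurable (g a j)) {h : ℕ}
    (hW : ∀ i j, Measurable (W (.value h i j))) (a : Fin dS) (j : ℕ) :
    Measurable fun ω => value d (fun p => W p ω) (fun a j => g a j ω) h a j :=
  Finset.measurable_fun_sum _ fun i _ => (hg a i).mul (hW i j)

variable (S : Attention dS)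

theorem measurable_logit (n d : ℕ) (hg : ∀ a j, Measurable (g a j)) {h : ℕ}
    (hQ : ∀ i j, Measurable (W (.query h i j))) (hK : ∀ i j, Measurable (W (.key h i j)))
    (a b : Fin dS) :
    Measurable fun ω => S.logit n d (fun p => W p ω) (fun a j => g a j ω) h a b :=
  (Finset.measurable_fun_sum _ fun j _ =>
    (measurable_query d hg hQ a j).mul (measurable_key d hg hK b j)).div_const _

theorem measurable_zeta_logit (hζ : Continuous S.ζ) (n d : ℕ) (hg : ∀ a j, Measurable (g a j))
    {h : ℕ} (hQ : ∀ i j, Measurable (W (.query h i j))) (hK : ∀ i j, Measurable (W (.key h i j)))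
    (a b : Fin dS) :
    Measurable fun ω => S.ζ (S.logit n d (fun p => W p ω) (fun a j => g a j ω) h) a b := by
  have h1 : Continuous fun F : Fin dS → Fin dS → ℝ => S.ζ (Matrix.of F) a b :=
    (continuous_apply b).comp ((continuous_apply a).comp (hζ.comp continuous_id))
  exact h1.measurable.comp (measurable_pi_iff.2 fun c => measurable_pi_iff.2 fun e =>
    S.measurable_logit n d hg hQ hK c e)

theorem measurable_headOut (hζ : Continuous S.ζ) (n d : ℕ) (hg : ∀ a j, Measurable (g a j))
    {h : ℕ} (hQ : ∀ i j, Measurable (W (.query h i j))) (hK : ∀ i j, Measurable (W (.key h i j)))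
    (hV : ∀ i j, Measurable (W (.value h i j))) (a : Fin dS) (k : ℕ) :
    Measurable fun ω => S.headOut n d (fun p => W p ω) (fun a j => g a j ω) h a k :=
  Finset.measurable_fun_sum _ fun b _ =>
    (S.measurable_zeta_logit hζ n d hg hQ hK a b).mul (measurable_value d hg hV b k)

theorem measurable_apply (hζ : Continuous S.ζ) (n d : ℕ) (hg : ∀ a j, Measurable (g a j))
    (hW : ∀ p, Measurable (W p)) (a : Fin dS) (i : ℕ) :
    Measurable fun ω => S.apply n d (fun p => W p ω) (fun a j => g a j ω) a i :=
  Finset.measurable_fun_sum _ fun _ _ => Finset.measurable_fun_sum _ fun k _ =>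
    (S.measurable_headOut hζ n d hg (fun _ _ => hW _) (fun _ _ => hW _) (fun _ _ => hW _) a k).mul
      (hW _)

end Attention

theorem Layer.measurable_apply : ∀ (L : Layer dS) (_ : L.Regular) (n d : ℕ)
    {g : Fin dS → ℕ → Ω → ℝ} (_ : ∀ a j, Measurable (g a j)) {W : L.Param → Ω → ℝ}
    (_ : ∀ p, Measurable (W p)) (a : Fin dS) (i : ℕ),
    Measurable fun ω => L.apply n d (fun p => W p ω) (fun a j => g a j ω) a i
  | .affine F A σw σb, _, n, d, g, hg, W, hW, a, i => by
    refine Measurable.add ?_ (hW (Sum.inr i))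
    exact Finset.measurable_fun_sum _ fun k _ => Finset.measurable_fun_sum _ fun b _ =>
      (Finset.measurable_fun_sum _ fun j _ => (hg b j).mul (hW (Sum.inl (k, j, i)))).const_mul _
  | .pool A, _, n, d, g, hg, W, hW, a, i =>
    Finset.measurable_fun_sum _ fun b _ => (hg b i).const_mul _
  | .attention S, hL, n, d, g, hg, W, hW, a, i => S.measurable_apply hL.1 n d hg hW a i

end LayerMeasurability

/-! ### Moments of the layer outputs -/

section LayerMoments

variable {dS : ℕ} {Ω : ℕ → Type*} {𝓖 : ∀ n, MeasurableSpace (Ω n)} [∀ n, MeasurableSpace (Ω n)]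
  {P : ∀ n, Measure (Ω n)} [∀ n, IsProbabilityMeasure (P n)]

/-- Equality holds unless `d = 0`, where the quotient is `0` by convention. The inequality makes the
moment bounds valid for all `n`, without positive widths. -/
theorem div_natCast_mul_le (σ : ℝ≥0) (d : ℕ) : ((σ / d : ℝ≥0) : ℝ) * d ≤ σ := by
  rcases Nat.eq_zero_or_pos d with rfl | hd
  · simp
  · have : (0 : ℝ) < d := by exact_mod_cast hd
    push_cast
    rw [div_mul_cancel₀ _ this.ne']

theorem PolyBounded.bddMoments_comp {ι : Type*} {φ : ℝ → ℝ} (hφ : PolyBounded φ)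
    (hc : Continuous φ) {Y : ∀ n, ι → Ω n → ℝ} (hY : BddMoments P Y) :
    BddMoments P fun n i ω => φ (Y n i ω) := by
  obtain ⟨m, c, -, h⟩ := hφ
  exact hY.polyBounded_comp (fun n i => hc.measurable.comp (hY.measurable n i))
    fun n i ω => h _

/-- Weights that belong to the queries and keys. -/
def AttnParam.logitWeights : Set AttnParam :=
  {p | ∃ h i j, p = .query h i j ∨ p = .key h i j}

/-- Weights that belong to the keys. -/
def AttnParam.keyWeights : Set AttnParam := {p | ∃ h i j, p = .key h i j}

/-- Weights that belong to the queries, keys and values. -/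
def AttnParam.headWeights : Set AttnParam :=
  {p | ∃ h i j, p = .query h i j ∨ p = .key h i j ∨ p = .value h i j}

namespace Attention

variable (S : Attention dS) {d : ℕ → ℕ} {V : ∀ n, AttnParam → Ω n → ℝ}
  {g : ∀ n, Fin dS → ℕ → Ω n → ℝ}

theorem bddMoments_key (hV : ∀ n, GaussWeights (P n) (𝓖 n) (V n) (S.paramVar n (d n)))
    (hg : BddMoments P fun n (p : Fin dS × ℕ) => g n p.1 p.2)
    (hgm : ∀ n a j, Measurable[𝓖 n] (g n a j)) :
    BddMoments P fun n (p : ℕ × Fin dS × ℕ) ω =>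
      key (d n) (fun q => V n q ω) (fun a j => g n a j ω) p.1 p.2.1 p.2.2 := by
  have h := BddMoments.gaussSum (P := P) (ι := ℕ × Fin dS × ℕ) (R := ℕ)
    (𝓖 := fun n _ => 𝓖 n ⊔ sigmaOf (V n) ∅)
    (V := fun n p i => V n (.key p.1 i p.2.2)) (w := fun n _ => S.σK ^ 2 / (d n : ℝ≥0))
    (fun n p => (hV n).comp (e := fun i => AttnParam.key p.1 i p.2.2)
      (fun i i' h => by cases h; rfl) ∅ (by simp))
    (c := fun n p i => g n p.2.1 i) (hg.comp fun _ (p : (ℕ × Fin dS × ℕ) × ℕ) => (p.1.2.1, p.2))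
    (fun n p i => (hgm n _ i).mono le_sup_left le_rfl) (fun n _ => Finset.range (d n))
    (fun _ _ => 1) (S.σK ^ 2) (fun n _ => by
      simpa only [one_pow, one_mul, Finset.card_range] using div_natCast_mul_le (S.σK ^ 2) (d n))
  simp only [one_mul] at h
  exact h

theorem bddMoments_value (hV : ∀ n, GaussWeights (P n) (𝓖 n) (V n) (S.paramVar n (d n)))
    (hg : BddMoments P fun n (p : Fin dS × ℕ) => g n p.1 p.2)
    (hgm : ∀ n a j, Measurable[𝓖 n] (g n a j)) :
    BddMoments P fun n (p : ℕ × Fin dS × ℕ) ω =>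
      value (d n) (fun q => V n q ω) (fun a j => g n a j ω) p.1 p.2.1 p.2.2 := by
  have h := BddMoments.gaussSum (P := P) (ι := ℕ × Fin dS × ℕ) (R := ℕ)
    (𝓖 := fun n _ => 𝓖 n ⊔ sigmaOf (V n) ∅)
    (V := fun n p i => V n (.value p.1 i p.2.2)) (w := fun n _ => S.σV ^ 2 / (d n : ℝ≥0))
    (fun n p => (hV n).comp (e := fun i => AttnParam.value p.1 i p.2.2)
      (fun i i' h => by cases h; rfl) ∅ (by simp))
    (c := fun n p i => g n p.2.1 i) (hg.comp fun _ (p : (ℕ × Fin dS × ℕ) × ℕ) => (p.1.2.1, p.2))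
    (fun n p i => (hgm n _ i).mono le_sup_left le_rfl) (fun n _ => Finset.range (d n))
    (fun _ _ => 1) (S.σV ^ 2) (fun n _ => by
      simpa only [one_pow, one_mul, Finset.card_range] using div_natCast_mul_le (S.σV ^ 2) (d n))
  simp only [one_mul] at h
  exact h

/-- Here the keys are frozen, so the logits become linear in the query weights. The companions below
freeze the inputs for the keys, all queries and keys for the values, and everything but `W^O` for
the outputs. -/
theorem gaussWeights_query (hV : ∀ n, GaussWeights (P n) (𝓖 n) (V n) (S.paramVar n (d n))) (n : ℕ) :
    GaussWeights (P n) (𝓖 n ⊔ sigmaOf (V n) AttnParam.keyWeights)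
      (fun r : ℕ × ℕ × ℕ => V n (.query r.1 r.2.1 r.2.2)) fun _ => S.σQ ^ 2 / (d n : ℝ≥0) :=
  (hV n).comp (e := fun r : ℕ × ℕ × ℕ => AttnParam.query r.1 r.2.1 r.2.2)
    (by rintro ⟨a, b, c⟩ ⟨a', b', c'⟩ h; cases h; rfl) _
    (by rintro ⟨a, b, c⟩ ⟨h, i, j, hp⟩; cases hp)

/-- The index is (column, row): columns are the blocks of `Null.average_quadratic`, and rows are
summed inside a block. For the values, a block is a pair (head, column). -/
theorem gaussWeights_key (hV : ∀ n, GaussWeights (P n) (𝓖 n) (V n) (S.paramVar n (d n))) (h n : ℕ) :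
    GaussWeights (P n) (𝓖 n ⊔ sigmaOf (V n) ∅)
      (fun r : ℕ × ℕ => V n (.key h r.2 r.1)) fun _ => S.σK ^ 2 / (d n : ℝ≥0) :=
  (hV n).comp (e := fun r : ℕ × ℕ => AttnParam.key h r.2 r.1)
    (by rintro ⟨a, b⟩ ⟨a', b'⟩ h; cases h; rfl) _ (by simp)

theorem gaussWeights_value (hV : ∀ n, GaussWeights (P n) (𝓖 n) (V n) (S.paramVar n (d n)))
    (n : ℕ) : GaussWeights (P n) (𝓖 n ⊔ sigmaOf (V n) AttnParam.logitWeights)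
      (fun r : (ℕ × ℕ) × ℕ => V n (.value r.1.1 r.2 r.1.2)) fun _ => S.σV ^ 2 / (d n : ℝ≥0) :=
  (hV n).comp (e := fun r : (ℕ × ℕ) × ℕ => AttnParam.value r.1.1 r.2 r.1.2)
    (by rintro ⟨⟨a, b⟩, c⟩ ⟨⟨a', b'⟩, c'⟩ h; cases h; rfl) _
    (by rintro ⟨⟨a, b⟩, c⟩ ⟨h, i, j, hp | hp⟩ <;> cases hp)

theorem gaussWeights_output (hV : ∀ n, GaussWeights (P n) (𝓖 n) (V n) (S.paramVar n (d n)))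
    (n : ℕ) : GaussWeights (P n) (𝓖 n ⊔ sigmaOf (V n) AttnParam.headWeights)
      (fun r : ℕ × ℕ × ℕ => V n (.output r.1 r.2.1 r.2.2))
      fun _ => S.σO ^ 2 / ((S.heads n : ℝ≥0) * (S.dimV n : ℝ≥0)) :=
  (hV n).comp (e := fun r : ℕ × ℕ × ℕ => AttnParam.output r.1 r.2.1 r.2.2)
    (by rintro ⟨a, b, c⟩ ⟨a', b', c'⟩ h; cases h; rfl) _
    (by rintro ⟨a, b, c⟩ ⟨h, i, j, hp | hp | hp⟩ <;> cases hp)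

theorem measurable_key_keyWeights (hgm : ∀ n a j, Measurable[𝓖 n] (g n a j)) (n h : ℕ) (a : Fin dS)
    (j : ℕ) : Measurable[𝓖 n ⊔ sigmaOf (V n) AttnParam.keyWeights] fun ω =>
      key (d n) (fun q => V n q ω) (fun a j => g n a j ω) h a j :=
  measurable_key (m := 𝓖 n ⊔ sigmaOf (V n) AttnParam.keyWeights) _
    (fun a j => (hgm n a j).mono le_sup_left le_rfl)
    (fun i j => (measurable_sigmaOf (V n) (S := AttnParam.keyWeights) ⟨h, i, j, rfl⟩).mono
      le_sup_right le_rfl) a j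

theorem measurable_zeta_logitWeights (hζ : Continuous S.ζ)
    (hgm : ∀ n a j, Measurable[𝓖 n] (g n a j)) (n h : ℕ) (a b : Fin dS) :
    Measurable[𝓖 n ⊔ sigmaOf (V n) AttnParam.logitWeights] fun ω =>
      S.ζ (S.logit n (d n) (fun q => V n q ω) (fun a j => g n a j ω) h) a b :=
  S.measurable_zeta_logit (m := 𝓖 n ⊔ sigmaOf (V n) AttnParam.logitWeights) hζ _ _
    (fun a j => (hgm n a j).mono le_sup_left le_rfl)
    (fun i j => (measurable_sigmaOf (V n) (S := AttnParam.logitWeights)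
      ⟨h, i, j, Or.inl rfl⟩).mono le_sup_right le_rfl)
    (fun i j => (measurable_sigmaOf (V n) (S := AttnParam.logitWeights)
      ⟨h, i, j, Or.inr rfl⟩).mono le_sup_right le_rfl) a b

theorem measurable_headOut_headWeights (hζ : Continuous S.ζ)
    (hgm : ∀ n a j, Measurable[𝓖 n] (g n a j)) (n h : ℕ) (a : Fin dS) (k : ℕ) :
    Measurable[𝓖 n ⊔ sigmaOf (V n) AttnParam.headWeights] fun ω =>
      S.headOut n (d n) (fun q => V n q ω) (fun a j => g n a j ω) h a k :=
  S.measurable_headOut (m := 𝓖 n ⊔ sigmaOf (V n) AttnParam.headWeights) hζ _ _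
    (fun a j => (hgm n a j).mono le_sup_left le_rfl)
    (fun i j => (measurable_sigmaOf (V n) (S := AttnParam.headWeights)
      ⟨h, i, j, Or.inl rfl⟩).mono le_sup_right le_rfl)
    (fun i j => (measurable_sigmaOf (V n) (S := AttnParam.headWeights)
      ⟨h, i, j, Or.inr (Or.inl rfl)⟩).mono le_sup_right le_rfl)
    (fun i j => (measurable_sigmaOf (V n) (S := AttnParam.headWeights)
      ⟨h, i, j, Or.inr (Or.inr rfl)⟩).mono le_sup_right le_rfl) a k

theorem logit_eq_sum (n d : ℕ) (W : AttnParam → ℝ) (g : Fin dS → ℕ → ℝ) (h : ℕ) (a b : Fin dS) :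
    S.logit n d W g h a b = (Real.sqrt (S.dimG n))⁻¹ *
      ∑ r ∈ Finset.range d ×ˢ Finset.range (S.dimG n),
        (g a r.1 * key d W g h b r.2) * W (.query h r.1 r.2) := by
  rw [Finset.sum_product_right, logit, Matrix.of_apply, div_eq_inv_mul]
  congr 1
  refine Finset.sum_congr rfl fun j _ => ?_
  rw [query, Finset.sum_mul]
  exact Finset.sum_congr rfl fun i _ => by ring

theorem bddMoments_logit (hV : ∀ n, GaussWeights (P n) (𝓖 n) (V n) (S.paramVar n (d n)))
    (hg : BddMoments P fun n (p : Fin dS × ℕ) => g n p.1 p.2)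
    (hgm : ∀ n a j, Measurable[𝓖 n] (g n a j)) :
    BddMoments P fun n (p : ℕ × Fin dS × Fin dS) ω =>
      S.logit n (d n) (fun q => V n q ω) (fun a j => g n a j ω) p.1 p.2.1 p.2.2 := by
  have h := BddMoments.gaussSum (P := P) (ι := ℕ × Fin dS × Fin dS) (R := ℕ × ℕ)
    (𝓖 := fun n _ => (𝓖 n ⊔ sigmaOf (V n) AttnParam.keyWeights) ⊔
      sigmaOf (fun r : ℕ × ℕ × ℕ => V n (.query r.1 r.2.1 r.2.2)) ∅)
    (V := fun n p r => V n (.query p.1 r.1 r.2)) (w := fun n _ => S.σQ ^ 2 / (d n : ℝ≥0))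
    (fun n p => (S.gaussWeights_query hV n).comp (e := fun r : ℕ × ℕ => (p.1, r))
      (Prod.mk_right_injective _) ∅ (by simp))
    (c := fun n p r ω => g n p.2.1 r.1 ω *
      key (d n) (fun q => V n q ω) (fun a j => g n a j ω) p.1 p.2.2 r.2)
    ((hg.comp fun _ (p : (ℕ × Fin dS × Fin dS) × ℕ × ℕ) => (p.1.2.1, p.2.1)).mul
      ((S.bddMoments_key hV hg hgm).comp fun _ (p : (ℕ × Fin dS × Fin dS) × ℕ × ℕ) =>
        (p.1.1, p.1.2.2, p.2.2)))
    (fun n p r => (((hgm n _ _).mono le_sup_left le_rfl).mul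
      (measurable_key_keyWeights hgm n _ _ _)).mono le_sup_left le_rfl)
    (fun n _ => Finset.range (d n) ×ˢ Finset.range (S.dimG n))
    -- The squared scaling `1 / d^G` and the weight variance `σ_Q² / d` compensate the `d · d^G`
    -- summands.
    (fun n _ => (Real.sqrt (S.dimG n))⁻¹) (S.σQ ^ 2) (fun n _ => by
      rw [inv_pow, Real.sq_sqrt (Nat.cast_nonneg _), Finset.card_product, Finset.card_range,
        Finset.card_range, Nat.cast_mul]
      have h1 := div_natCast_mul_le (S.σQ ^ 2) (d n)
      have h2 : (S.dimG n : ℝ)⁻¹ * S.dimG n ≤ 1 := inv_mul_le_one_of_le₀ le_rfl (by positivity)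
      have h3 : (0 : ℝ) ≤ ((S.σQ ^ 2 / (d n : ℝ≥0) : ℝ≥0) : ℝ) * d n := by positivity
      calc (S.dimG n : ℝ)⁻¹ * ((S.σQ ^ 2 / (d n : ℝ≥0) : ℝ≥0) : ℝ) * ((d n : ℝ) * S.dimG n)
          = ((S.dimG n : ℝ)⁻¹ * S.dimG n) * (((S.σQ ^ 2 / (d n : ℝ≥0) : ℝ≥0) : ℝ) * d n) := by ring
        _ ≤ 1 * (((S.σQ ^ 2 / (d n : ℝ≥0) : ℝ≥0) : ℝ) * d n) := mul_le_mul_of_nonneg_right h2 h3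
        _ ≤ _ := by rw [one_mul]; exact h1)
  simpa only [logit_eq_sum] using h

theorem bddMoments_zeta (hS : S.Regular)
    (hV : ∀ n, GaussWeights (P n) (𝓖 n) (V n) (S.paramVar n (d n)))
    (hg : BddMoments P fun n (p : Fin dS × ℕ) => g n p.1 p.2)
    (hgm : ∀ n a j, Measurable[𝓖 n] (g n a j)) :
    BddMoments P fun n (p : ℕ × Fin dS × Fin dS) ω =>
      S.ζ (S.logit n (d n) (fun q => V n q ω) (fun a j => g n a j ω) p.1) p.2.1 p.2.2 := by
  obtain ⟨hζ, m, c, -, hc⟩ := hS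
  exact (S.bddMoments_logit hV hg hgm).polyBounded_comp (fun n p =>
    S.measurable_zeta_logit hζ n (d n) (fun a j => hg.measurable n (a, j))
      (fun i j => (hV n).measurable _) (fun i j => (hV n).measurable _) p.2.1 p.2.2)
    fun n p ω => hc _ _ _

theorem bddMoments_headOut (hS : S.Regular)
    (hV : ∀ n, GaussWeights (P n) (𝓖 n) (V n) (S.paramVar n (d n)))
    (hg : BddMoments P fun n (p : Fin dS × ℕ) => g n p.1 p.2)
    (hgm : ∀ n a j, Measurable[𝓖 n] (g n a j)) :
    BddMoments P fun n (p : ℕ × Fin dS × ℕ) ω =>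
      S.headOut n (d n) (fun q => V n q ω) (fun a j => g n a j ω) p.1 p.2.1 p.2.2 :=
  BddMoments.sum Finset.univ fun b _ =>
    ((S.bddMoments_zeta hS hV hg hgm).comp fun _ (p : ℕ × Fin dS × ℕ) => (p.1, p.2.1, b)).mul
      ((S.bddMoments_value hV hg hgm).comp fun _ (p : ℕ × Fin dS × ℕ) => (p.1, b, p.2.2))

theorem apply_eq_sum (n d : ℕ) (W : AttnParam → ℝ) (g : Fin dS → ℕ → ℝ) (a : Fin dS) (i : ℕ) :
    S.apply n d W g a i = ∑ r ∈ Finset.range (S.heads n) ×ˢ Finset.range (S.dimV n),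
      S.headOut n d W g r.1 a r.2 * W (.output r.1 r.2 i) := by
  rw [Finset.sum_product, apply]

theorem bddMoments_apply (hS : S.Regular)
    (hV : ∀ n, GaussWeights (P n) (𝓖 n) (V n) (S.paramVar n (d n)))
    (hg : BddMoments P fun n (p : Fin dS × ℕ) => g n p.1 p.2)
    (hgm : ∀ n a j, Measurable[𝓖 n] (g n a j)) :
    BddMoments P fun n (p : Fin dS × ℕ) ω =>
      S.apply n (d n) (fun q => V n q ω) (fun a j => g n a j ω) p.1 p.2 := by
  have h := BddMoments.gaussSum (P := P) (ι := Fin dS × ℕ) (R := ℕ × ℕ)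
    (𝓖 := fun n _ => (𝓖 n ⊔ sigmaOf (V n) AttnParam.headWeights) ⊔
      sigmaOf (fun r : ℕ × ℕ × ℕ => V n (.output r.1 r.2.1 r.2.2)) ∅)
    (V := fun n p r => V n (.output r.1 r.2 p.2))
    (w := fun n _ => S.σO ^ 2 / ((S.heads n : ℝ≥0) * (S.dimV n : ℝ≥0)))
    (fun n p => (S.gaussWeights_output hV n).comp (e := fun r : ℕ × ℕ => (r.1, r.2, p.2))
      (by rintro ⟨a, b⟩ ⟨a', b'⟩ h; cases h; rfl) ∅ (by simp))
    (c := fun n p r ω => S.headOut n (d n) (fun q => V n q ω) (fun a j => g n a j ω) r.1 p.1 r.2)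
    ((S.bddMoments_headOut hS hV hg hgm).comp fun _ (p : (Fin dS × ℕ) × ℕ × ℕ) =>
        (p.2.1, p.1.1, p.2.2))
    (fun n p r => (S.measurable_headOut_headWeights hS.1 hgm n _ _ _).mono le_sup_left le_rfl)
    (fun n _ => Finset.range (S.heads n) ×ˢ Finset.range (S.dimV n))
    (fun n _ => 1) (S.σO ^ 2) (fun n _ => by
      have := div_natCast_mul_le (S.σO ^ 2) (S.heads n * S.dimV n)
      simpa using this)
  simpa only [one_mul, apply_eq_sum] using h

end Attention

theorem BddMoments.sum_matrix_mul {ι : Type*} {Y : Fin dS → ∀ n, ι → Ω n → ℝ}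
    (hY : ∀ b, BddMoments P (Y b)) (A : Matrix (Fin dS) (Fin dS) ℝ) :
    BddMoments P fun n (p : Fin dS × ι) ω => ∑ b, A p.1 b * Y b n p.2 ω := by
  refine BddMoments.sum Finset.univ fun b _ => ?_
  have hA : BddMoments P fun n (p : Fin dS × ι) (_ : Ω n) => A p.1 b :=
    BddMoments.of_abs_le (∑ a, |A a b|) fun _ p =>
      Finset.single_le_sum (f := fun a => |A a b|) (fun _ _ => abs_nonneg _) (Finset.mem_univ p.1)
  exact hA.mul ((hY b).comp fun _ (p : Fin dS × ι) => p.2)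

theorem Layer.bddMoments_apply : ∀ (L : Layer dS) (_ : L.Regular) {d : ℕ → ℕ}
    {W : ∀ n, L.Param → Ω n → ℝ}
    (_ : ∀ n, GaussWeights (P n) (𝓖 n) (W n) (L.paramVar n (d n)))
    {g : ∀ n, Fin dS → ℕ → Ω n → ℝ}
    (_ : BddMoments P fun n (p : Fin dS × ℕ) => g n p.1 p.2)
    (_ : ∀ n a j, Measurable[𝓖 n] (g n a j)),
    BddMoments P fun n (p : Fin dS × ℕ) ω =>
      L.apply n (d n) (fun q => W n q ω) (fun a j => g n a j ω) p.1 p.2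
  | .affine F A σw σb, _, d, W, hW, g, hg, hgm => by
    have hlin := BddMoments.gaussSum (P := P) (ι := Fin F × Fin dS × ℕ) (R := ℕ)
      (𝓖 := fun n _ => 𝓖 n ⊔ sigmaOf (W n) ∅)
      (V := fun n p j => W n (Sum.inl (p.1, j, p.2.2))) (w := fun n _ => σw ^ 2 / (d n : ℝ≥0))
      (fun n p => (hW n).comp (e := fun j => Sum.inl (p.1, j, p.2.2))
        (fun i i' h => by cases h; rfl) ∅ (fun _ => id))
      (c := fun n p i => g n p.2.1 i)
      (hg.comp fun _ (p : (Fin F × Fin dS × ℕ) × ℕ) => (p.1.2.1, p.2))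
      (fun n p i => (hgm n _ i).mono le_sup_left le_rfl) (fun n _ => Finset.range (d n))
      (fun _ _ => 1) (σw ^ 2) (fun n _ => by
        simpa only [one_pow, one_mul, Finset.card_range] using div_natCast_mul_le (σw ^ 2) (d n))
    simp only [one_mul] at hlin
    -- A bias is a Gaussian sum with a single summand and coefficient `1`.
    have hbias := BddMoments.gaussSum (P := P) (ι := ℕ) (R := Unit)
      (𝓖 := fun n _ => 𝓖 n ⊔ sigmaOf (W n) ∅)
      (V := fun n i _ => W n (Sum.inr i)) (w := fun n _ => σb ^ 2)
      (fun n p => (hW n).comp (e := fun _ => Sum.inr p)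
        (fun i i' h => rfl) ∅ (fun _ => id))
      (c := fun n _ _ _ => 1) (BddMoments.const 1)
      (fun n p i => measurable_const) (fun n _ => {()})
      (fun _ _ => 1) (σb ^ 2) (fun n _ => by simp)
    simp only [one_mul, Finset.sum_singleton] at hbias
    refine BddMoments.add (BddMoments.sum Finset.univ fun k _ => ?_)
      (hbias.comp fun _ (p : Fin dS × ℕ) => p.2)
    exact BddMoments.sum_matrix_mul (ι := ℕ) (Y := fun b n i ω =>
      ∑ j ∈ Finset.range (d n), g n b j ω * W n (Sum.inl (k, j, i)) ω)
      (fun b => hlin.comp fun _ (i : ℕ) => (k, b, i)) (A k)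
  | .pool A, _, d, W, hW, g, hg, hgm =>
    BddMoments.sum_matrix_mul (ι := ℕ) (Y := fun b n i ω => g n b i ω)
      (fun b => hg.comp fun _ (i : ℕ) => (b, i)) A
  | .attention S, hL, d, W, hW, g, hg, hgm => S.bddMoments_apply hL hW hg hgm

end LayerMoments

/-! ### The network below the attention layer -/

section NetworkOutputs

variable {X : Type*} {dS : ℕ} {Ω : ℕ → Type*} {N : Network dS} {m : ℕ}

/-- The weights of the layers `1, …, m` and the weights `V`, in a single family. -/
abbrev Network.weights (N : Network dS) (m : ℕ) {I Ω : Type*}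
    (W : (k : ℕ) → (N.layer k).Param → Ω → ℝ) (V : I → Ω → ℝ) :
    ((k : Set.Icc 1 m) × (N.layer k).Param) ⊕ I → Ω → ℝ :=
  Sum.elim (fun p : (k : Set.Icc 1 m) × (N.layer k).Param => W p.1 p.2) V

/-- The variances of the weights of the layers `1, …, m` and the variances `v`. -/
abbrev Network.weightVar (N : Network dS) (m n : ℕ) {I : Type*} (v : I → ℝ≥0) :
    ((k : Set.Icc 1 m) × (N.layer k).Param) ⊕ I → ℝ≥0 :=
  Sum.elim (fun p : (k : Set.Icc 1 m) × (N.layer k).Param =>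
    (N.layer p.1).paramVar n (N.width (p.1 - 1) n) p.2) v

/-- Indices of the weights of the layers `1, …, k`. -/
def Network.weightsUpTo (N : Network dS) (m k : ℕ) (I : Type*) :
    Set (((k : Set.Icc 1 m) × (N.layer k).Param) ⊕ I) :=
  {p | ∃ q : (k : Set.Icc 1 m) × (N.layer k).Param, (q.1 : ℕ) ≤ k ∧ p = Sum.inl q}

theorem Network.gaussWeights_weights {Ω I : Type*} [MeasurableSpace Ω] {P : Measure Ω}
    {n : ℕ} {inp : X → Fin dS → ℕ → Ω → ℝ} {W : (k : ℕ) → (N.layer k).Param → Ω → ℝ}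
    {V : I → Ω → ℝ} {v : I → ℝ≥0} (hinp : ∀ x a j, Measurable (inp x a j))
    (hW : ∀ k p, Measurable (W k p)) (hV : ∀ p, Measurable (V p))
    (hWlaw : ∀ k, k < m → ∀ p, HasLaw (W (k + 1) p)
      (gaussianReal 0 ((N.layer (k + 1)).paramVar n (N.width k n) p)) P)
    (hVlaw : ∀ p, HasLaw (V p) (gaussianReal 0 (v p)) P)
    (hindep : iIndepFun (N.weights m W V) P)
    (hinpindep : IndepFun (fun ω (t : X × Fin dS × ℕ) => inp t.1 t.2.1 t.2.2 ω)
      (fun ω p => N.weights m W V p ω) P) :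
    GaussWeights P (MeasurableSpace.comap (fun ω (t : X × Fin dS × ℕ) => inp t.1 t.2.1 t.2.2 ω)
      inferInstance) (N.weights m W V) (N.weightVar m n v) where
  le := Measurable.comap_le (measurable_pi_iff.2 fun t => hinp _ _ _)
  measurable := by
    rintro (p | p)
    exacts [hW _ _, hV _]
  hasLaw := by
    rintro (⟨⟨k, hk⟩, p⟩ | p)
    · obtain ⟨j, rfl⟩ : ∃ j, k = j + 1 := ⟨k - 1, by have := hk.1; lia⟩
      exact hWlaw j hk.2 p
    · exact hVlaw p
  iIndepFun := hindep
  indep := by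
    refine indep_of_indep_of_le_right ((IndepFun_iff_Indep _ _ _).1 hinpindep)
      (iSup₂_le fun p _ => ?_)
    exact Measurable.comap_le ((measurable_pi_apply p).comp
      (comap_measurable fun ω p => N.weights m W V p ω))

variable {𝓖 : ∀ n, MeasurableSpace (Ω n)} [∀ n, MeasurableSpace (Ω n)]
  {P : ∀ n, Measure (Ω n)} [∀ n, IsProbabilityMeasure (P n)]

/-- Induction on the layer. The measurability half is indispensable: because the output of layer `k`
involves only the network input and the weights up to layer `k`, the next weights are independent of
it. -/
theorem Network.bddMoments_out {I : Type*} {W : ∀ n, (k : ℕ) → (N.layer k).Param → Ω n → ℝ}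
    {V : ∀ n, I → Ω n → ℝ} {v : ℕ → I → ℝ≥0}
    (hact : ∀ k ≤ m, Continuous (N.act k) ∧ PolyBounded (N.act k))
    (hlayer : ∀ k, 1 ≤ k → k ≤ m → (N.layer k).Regular)
    (hU : ∀ n, GaussWeights (P n) (𝓖 n) (N.weights m (W n) (V n)) (N.weightVar m n (v n)))
    {inp : ∀ n, Fin dS → ℕ → Ω n → ℝ} (hinp : ∀ n a j, Measurable[𝓖 n] (inp n a j))
    (hb : BddMoments P fun n (p : Fin dS × ℕ) => inp n p.1 p.2) :
    ∀ k ≤ m, (BddMoments P fun n (p : Fin dS × ℕ) ω =>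
        N.out n (fun k q => W n k q ω) (fun a j => inp n a j ω) k p.1 p.2) ∧
      ∀ n a j, Measurable[𝓖 n ⊔ sigmaOf (N.weights m (W n) (V n)) (N.weightsUpTo m k I)]
        fun ω => N.out n (fun k q => W n k q ω) (fun a j => inp n a j ω) k a j := by
  intro k
  induction k with
  | zero => exact fun _ => ⟨hb, fun n a j => (hinp n a j).mono le_sup_left le_rfl⟩
  | succ k ih =>
    intro hk
    obtain ⟨h1, h2⟩ := ih (by lia)
    obtain ⟨hc, hp⟩ := hact k (by lia)
    have hL := hlayer (k + 1) (by lia) hk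
    have hmem : k + 1 ∈ Set.Icc 1 m := ⟨by lia, hk⟩
    have hWk : ∀ n, GaussWeights (P n)
        (𝓖 n ⊔ sigmaOf (N.weights m (W n) (V n)) (N.weightsUpTo m k I)) (W n (k + 1))
        ((N.layer (k + 1)).paramVar n (N.width k n)) := fun n =>
      (hU n).comp (e := fun p => Sum.inl ⟨⟨k + 1, hmem⟩, p⟩)
        (fun p q h => by simpa using h) _ (by
          rintro p ⟨q, hq, h⟩
          cases h
          exact absurd hq (by simp))
    refine ⟨(N.layer (k + 1)).bddMoments_apply hL hWk (hp.bddMoments_comp hc h1)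
      fun n a j => hc.measurable.comp (h2 n a j), fun n a j => ?_⟩
    have hle : 𝓖 n ⊔ sigmaOf (N.weights m (W n) (V n)) (N.weightsUpTo m k I) ≤
        𝓖 n ⊔ sigmaOf (N.weights m (W n) (V n)) (N.weightsUpTo m (k + 1) I) :=
      sup_le_sup_left (biSup_mono fun p ⟨q, hq, h⟩ => ⟨q, by lia, h⟩) _
    refine (N.layer (k + 1)).measurable_apply
      (m := 𝓖 n ⊔ sigmaOf (N.weights m (W n) (V n)) (N.weightsUpTo m (k + 1) I)) hL n
      (N.width k n) (g := fun a j ω => N.act k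
        (N.out n (fun k q => W n k q ω) (fun a j => inp n a j ω) k a j))
      (fun a j => hc.measurable.comp ((h2 n a j).mono hle le_rfl)) (W := W n (k + 1))
      (fun p => ?_) a j
    exact (measurable_sigmaOf (N.weights m (W n) (V n)) (S := N.weightsUpTo m (k + 1) I)
      (p := Sum.inl ⟨⟨k + 1, hmem⟩, p⟩) ⟨⟨⟨k + 1, hmem⟩, p⟩, le_rfl, rfl⟩).mono le_sup_right le_rfl

/-- Moves the weights of the first `m` layers into the conditioning σ-algebra, which then plays the
role of `𝓖` for the attention layer. -/
theorem Network.gaussWeights_last {Ω I : Type*} {𝓖 : MeasurableSpace Ω} [MeasurableSpace Ω]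
    {P : Measure Ω} [IsProbabilityMeasure P] {n : ℕ} {W : (k : ℕ) → (N.layer k).Param → Ω → ℝ}
    {V : I → Ω → ℝ} {v : I → ℝ≥0}
    (hU : GaussWeights P 𝓖 (N.weights m W V) (N.weightVar m n v)) :
    GaussWeights P (𝓖 ⊔ sigmaOf (N.weights m W V) (N.weightsUpTo m m I)) V v :=
  hU.comp (e := Sum.inr) Sum.inr_injective _ (by rintro p ⟨q, -, h⟩; cases h)

theorem UniformMoments.bddMoments {Y : ∀ n, X → Fin dS → ℕ → Ω n → ℝ} (h : UniformMoments P Y)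
    (hY : ∀ n x a j, Measurable (Y n x a j)) (x : X) :
    BddMoments P fun n (p : Fin dS × ℕ) => Y n x p.1 p.2 :=
  BddMoments.of_lintegral_pow_le (fun _ _ => hY _ _ _ _) id (fun _ => le_rfl) fun p =>
    (h x p).imp fun _ hC n i => hC n i.1 i.2

end NetworkOutputs

/-! ### Laws of large numbers -/

theorem exists_perm_finite_support {i j : ℕ} (hij : i ≠ j) :
    ∃ σ : Equiv.Perm ℕ, {k | σ k ≠ k}.Finite ∧ σ 0 = i ∧ σ 1 = j := by
  -- The right factor acts first: it sends `1` to the preimage of `j` under the swap of `0` and `i`.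
  -- That preimage is not `0` because `i ≠ j`, so `0` is left for the outer swap to send to `i`.
  refine ⟨Equiv.swap 0 i * Equiv.swap 1 (Equiv.swap 0 i j), ?_, ?_, ?_⟩
  · refine (Set.toFinite {0, i, 1, Equiv.swap 0 i j}).subset fun k hk => ?_
    by_contra hcon
    simp only [Set.mem_insert_iff, Set.mem_singleton_iff, not_or] at hcon
    refine hk ?_
    rw [Equiv.Perm.mul_apply, Equiv.swap_apply_of_ne_of_ne hcon.2.2.1 hcon.2.2.2,
      Equiv.swap_apply_of_ne_of_ne hcon.1 hcon.2.1]
  · rw [Equiv.Perm.mul_apply, Equiv.swap_apply_of_ne_of_ne zero_ne_one, Equiv.swap_apply_left]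
    intro h
    have := congrArg (Equiv.swap 0 i) h
    rw [Equiv.swap_apply_left, Equiv.swap_apply_self] at this
    exact hij this
  · rw [Equiv.Perm.mul_apply, Equiv.swap_apply_left, Equiv.swap_apply_self]

section LawOfLargeNumbers

variable {T : Type*} {Ω : ℕ → Type*} [∀ n, MeasurableSpace (Ω n)]
  {P : ∀ n, Measure (Ω n)} [∀ n, IsProbabilityMeasure (P n)]

/-- `XZ - xz = (X - x)(Z - z) + x(Z - z) + z(X - x)`. -/
theorem Null.mul_sub_mul {X Z : ∀ n, Ω n → ℝ} {x z : ℝ} (hX : Null P fun n ω => X n ω - x)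
    (hZ : Null P fun n ω => Z n ω - z) : Null P fun n ω => X n ω * Z n ω - x * z :=
  (((hX.mul hZ).add (hZ.const_mul x)).add (hX.const_mul z)).congr fun n ω => by ring

/-- Weak law of large numbers for functions of a convergent sequence whose correlations are
exchangeable, with independent limits. -/
theorem Null.average_of_tendstoInDistribution [Countable T] {F : ∀ n, Ω n → T → ℝ}
    {μ : ProbabilityMeasure (T → ℝ)}
    (hF : TendstoInDistribution F atTop id P (μ : Measure (T → ℝ))) {ψ : ℕ → (T → ℝ) → ℝ}
    (hψ : ∀ j, Continuous (ψ j)) (hb : BddMoments P fun n j ω => ψ j (F n ω))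
    (hind : IndepFun (ψ 0) (ψ 1) (μ : Measure (T → ℝ)))
    (hcorr : ∀ (c : ℝ) n i j, i ≠ j → ∫ ω, (ψ i (F n ω) - c) * (ψ j (F n ω) - c) ∂(P n) =
      ∫ ω, (ψ 0 (F n ω) - c) * (ψ 1 (F n ω) - c) ∂(P n))
    {d : ℕ → ℕ} (hd : Tendsto d atTop atTop) :
    Null P fun n ω => (d n : ℝ)⁻¹ * ∑ j ∈ Finset.range (d n), ψ j (F n ω) -
      ∫ x, ψ 0 x ∂(μ : Measure (T → ℝ)) := by
  set c := ∫ x, ψ 0 x ∂(μ : Measure (T → ℝ)) with hc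
  have hb' : BddMoments P fun n j ω => ψ j (F n ω) - c := hb.sub (BddMoments.const c)
  have hint : Integrable (ψ 0) (μ : Measure (T → ℝ)) :=
    (tendsto_integral_of_bddMoments hF (hψ 0) (hb.comp fun _ (_ : Unit) => 0)).1.integrable
      (by norm_num)
  -- The common correlation at stage `n` converges to that of the limit, which is zero by
  -- independence and centring.
  have hr := (tendsto_integral_of_bddMoments hF (h := fun x => (ψ 0 x - c) * (ψ 1 x - c))
    (((hψ 0).sub continuous_const).mul ((hψ 1).sub continuous_const))
    ((hb'.comp fun _ (_ : Unit) => 0).mul (hb'.comp fun _ (_ : Unit) => 1))).2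
  have h0 : ∫ x, (ψ 0 x - c) * (ψ 1 x - c) ∂(μ : Measure (T → ℝ)) = 0 := by
    have hi := hind.comp (φ := fun y => y - c) (ψ := fun y => y - c) (by fun_prop) (by fun_prop)
    have := hi.integral_mul_eq_mul_integral (by fun_prop) (by fun_prop)
    simp only [Pi.mul_apply, Function.comp_apply] at this
    rw [this, integral_sub hint (integrable_const c), integral_const, ← hc]
    simp
  rw [h0] at hr
  have h1 := Null.average hb' (fun n => Finset.range (d n)) (by simpa using hd) _ hr
    fun n i _ j _ hij => hcorr c n i j hij
  refine h1.of_eventually ?_ ?_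
  · refine BddMoments.sub (BddMoments.average (κ := ℕ)
      (Y := fun n (_ : Unit) j ω => ψ j (F n ω)) (hb.comp fun _ (q : Unit × ℕ) => q.2)
      (fun n _ => Finset.range (d n)) (fun n _ => (d n : ℝ)⁻¹) 1 fun n _ => ?_) (BddMoments.const c)
    rw [Finset.card_range, abs_of_nonneg (by positivity)]
    exact inv_mul_le_one_of_le₀ le_rfl (by positivity)
  -- The constant `c` passes through the average only if `d n ≠ 0`, which holds eventually.
  · filter_upwards [hd.eventually_gt_atTop 0] with n hn ω
    have : (d n : ℝ) ≠ 0 := by positivity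
    rw [Finset.card_range, Finset.sum_sub_distrib, Finset.sum_const, Finset.card_range, nsmul_eq_mul,
      mul_sub, inv_mul_cancel_left₀ this]

variable {X : Type*} {dS : ℕ}

/-- A finitely supported permutation moves any pair of distinct channels to the pair `0, 1`, so
exchangeability equalises the correlations; independent channels in the limit make them vanish. -/
theorem Null.average_channels [Countable X] {f : ∀ n, Ω n → X × Fin dS × ℕ → ℝ}
    {μ : ProbabilityMeasure (X × Fin dS × ℕ → ℝ)} {κ : X → X → Matrix (Fin dS) (Fin dS) ℝ}
    (hμ : IsChannelGP (μ : Measure (X × Fin dS × ℕ → ℝ)) κ)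
    (hconv : TendstoInDistribution f atTop id P (μ : Measure (X × Fin dS × ℕ → ℝ)))
    (hexch : ∀ n, ChannelExchangeable ((P n).map (f n))) {φ : ℝ → ℝ} (hφ : Continuous φ)
    (hb : ∀ x, BddMoments P fun n (p : Fin dS × ℕ) ω => φ (f n ω (x, p.1, p.2)))
    {d : ℕ → ℕ} (hd : Tendsto d atTop atTop) (x x' : X) (a b : Fin dS) :
    Null P fun n ω => (d n : ℝ)⁻¹ * ∑ j ∈ Finset.range (d n),
      φ (f n ω (x, a, j)) * φ (f n ω (x', b, j)) -
        postKernel φ (μ : Measure (X × Fin dS × ℕ → ℝ)) x x' a b := by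
  have hcont : ∀ j, Continuous fun F : X × Fin dS × ℕ → ℝ => φ (F (x, a, j)) * φ (F (x', b, j)) :=
    fun j => by fun_prop
  refine Null.average_of_tendstoInDistribution (ψ := fun j F => φ (F (x, a, j)) * φ (F (x', b, j)))
    hconv hcont (((hb x).comp fun _ j => (a, j)).mul ((hb x').comp fun _ j => (b, j))) ?_ ?_ hd
  · have hm : Measurable fun q : X × Fin dS → ℝ => φ (q (x, a)) * φ (q (x', b)) :=
      (hφ.measurable.comp (measurable_pi_apply _)).mul (hφ.measurable.comp (measurable_pi_apply _))
    exact (hμ.indep 0 1 zero_ne_one).comp hm hm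
  · intro c n i j hij
    obtain ⟨σ, hσ, rfl, rfl⟩ := exists_perm_finite_support hij
    have hfm : AEMeasurable (f n) (P n) := hconv.forall_aemeasurable n
    have hm : ∀ i j, Measurable fun F : X × Fin dS × ℕ → ℝ =>
        (φ (F (x, a, i)) * φ (F (x', b, i)) - c) * (φ (F (x, a, j)) * φ (F (x', b, j)) - c) :=
      fun i j => (((hcont i).sub continuous_const).mul ((hcont j).sub continuous_const)).measurable
    have h1 := integral_map (μ := (P n).map (f n)) (φ := fun ω (t : X × Fin dS × ℕ) =>
      ω (t.1, t.2.1, σ t.2.2)) (measurable_pi_iff.2 fun t => measurable_pi_apply _).aemeasurable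
      (hm 0 1).aestronglyMeasurable
    rw [hexch n σ hσ, integral_map hfm (hm _ _).aestronglyMeasurable] at h1
    rw [h1, integral_map hfm (hm (σ 0) (σ 1)).aestronglyMeasurable]

end LawOfLargeNumbers

/-! ### Invariance of the joint law under relabelling of weights -/

section HeadPermutation

variable {I J Ω E : Type*} {𝓖 : MeasurableSpace Ω} [MeasurableSpace Ω] [mE : MeasurableSpace E]
  {P : Measure Ω} [IsProbabilityMeasure P]

/-- The joint law with `𝓖` of independent Gaussian weights depends only on their variances. -/
theorem GaussWeights.map_prodMk_comp {V : I → Ω → ℝ} {v : I → ℝ≥0} (hV : GaussWeights P 𝓖 V v)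
    {Z : Ω → E} (hZ : Measurable[𝓖] Z) {e e' : J → I} (he : Function.Injective e)
    (he' : Function.Injective e') (hv : ∀ j, v (e j) = v (e' j)) :
    P.map (fun ω => (Z ω, fun j => V (e j) ω)) = P.map (fun ω => (Z ω, fun j => V (e' j) ω)) := by
  have hZm : Measurable Z := hZ.mono hV.le le_rfl
  have key : ∀ {e : J → I}, Function.Injective e →
      P.map (fun ω => (Z ω, fun j => V (e j) ω)) =
        (P.map Z).prod (Measure.infinitePi fun j => gaussianReal 0 (v (e j))) := by
    intro e he
    have hm : ∀ j, Measurable (V (e j)) := fun j => hV.measurable _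
    have h1 := (iIndepFun_iff_map_fun_eq_infinitePi_map hm).1 (hV.iIndepFun.precomp he)
    simp only [(hV.hasLaw _).map_eq] at h1
    rw [← h1]
    refine (indepFun_iff_map_prod_eq_prod_map_map hZm.aemeasurable
      (measurable_pi_iff.2 hm).aemeasurable).1 ?_
    rw [IndepFun_iff_Indep]
    refine indep_of_indep_of_le_left (indep_of_indep_of_le_right hV.indep ?_) hZ.comap_le
    exact Measurable.comap_le (@measurable_pi_iff _ _ _ (_) _ _ |>.2 fun j =>
      measurable_sigmaOf V (Set.mem_univ _))
  rw [key he, key he']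
  simp only [hv]

end HeadPermutation

/-! ### The Gaussian limit of the attention logits -/

namespace Attention

variable {X : Type*} {dS : ℕ} {Ω : ℕ → Type*}
  {𝓖 : ∀ n, MeasurableSpace (Ω n)} [∀ n, MeasurableSpace (Ω n)]
  {P : ∀ n, Measure (Ω n)} [∀ n, IsProbabilityMeasure (P n)]
  (S : Attention dS) {d : ℕ → ℕ} {V : ∀ n, AttnParam → Ω n → ℝ}
  {g : ∀ n, X → Fin dS → ℕ → Ω n → ℝ} {κt : X → X → Matrix (Fin dS) (Fin dS) ℝ}

/-- Given the inputs, the columns of keys are independent, and products of keys have mean `σ_K²`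
times the channel average of `g g'`. The column average concentrates around this mean, which
converges by `hΓ`. -/
theorem null_average_keys (hV : ∀ n, GaussWeights (P n) (𝓖 n) (V n) (S.paramVar n (d n)))
    (hg : ∀ x, BddMoments P fun n (p : Fin dS × ℕ) => g n x p.1 p.2)
    (hgm : ∀ n x a j, Measurable[𝓖 n] (g n x a j))
    (hΓ : ∀ x x' a b, Null P fun n ω => (d n : ℝ)⁻¹ * ∑ i ∈ Finset.range (d n),
      g n x a i ω * g n x' b i ω - κt x x' a b)
    (hdimG : Tendsto S.dimG atTop atTop) (h : ℕ) (x x' : X) (b b' : Fin dS) :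
    Null P fun n ω => (S.dimG n : ℝ)⁻¹ * ∑ j ∈ Finset.range (S.dimG n),
      key (d n) (fun q => V n q ω) (fun a j => g n x a j ω) h b j *
        key (d n) (fun q => V n q ω) (fun a j => g n x' a j ω) h b' j -
          (S.σK : ℝ) ^ 2 * κt x x' b b' := by
  have h1 := Null.average_quadratic (P := P) (S.gaussWeights_key hV h)
    (c := fun n r => g n x b r) (c' := fun n r => g n x' b' r) (A := fun n _ _ => 1)
    ((hg x).comp fun _ r => (b, r)) ((hg x').comp fun _ r => (b', r)) (BddMoments.const 1)
    (fun n r => (hgm n x b r).mono le_sup_left le_rfl)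
    (fun n r => (hgm n x' b' r).mono le_sup_left le_rfl) (fun n _ => measurable_const)
    (fun n => Finset.range (d n)) (S.σK ^ 2)
    (fun n => by simpa only [Finset.card_range] using div_natCast_mul_le (S.σK ^ 2) (d n))
    (fun n => Finset.range (S.dimG n)) (by simpa using hdimG)
  have h2 := h1.add ((hΓ x x' b b').const_mul ((S.σK : ℝ) ^ 2))
  refine h2.of_eventually ?_ ?_
  · refine BddMoments.sub (BddMoments.average (κ := ℕ) (Y := fun n (_ : Unit) j ω =>
      key (d n) (fun q => V n q ω) (fun a j => g n x a j ω) h b j *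
        key (d n) (fun q => V n q ω) (fun a j => g n x' a j ω) h b' j)
      (((S.bddMoments_key hV (hg x) fun n => hgm n x).comp fun _ (q : Unit × ℕ) => (h, b, q.2)).mul
        ((S.bddMoments_key hV (hg x') fun n => hgm n x').comp fun _ (q : Unit × ℕ) =>
          (h, b', q.2)))
      (fun n _ => Finset.range (S.dimG n)) (fun n _ => (S.dimG n : ℝ)⁻¹) 1 fun n _ => ?_)
      (BddMoments.const _)
    rw [Finset.card_range, abs_of_nonneg (by positivity)]
    exact inv_mul_le_one_of_le₀ le_rfl (by positivity)
  · filter_upwards [hdimG.eventually_gt_atTop 0] with n hn ω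
    have : (S.dimG n : ℝ) ≠ 0 := by positivity
    simp only [one_mul, Finset.card_range, Finset.sum_sub_distrib, Finset.sum_const, nsmul_eq_mul,
      mul_sub, inv_mul_cancel_left₀ this, key]
    push_cast
    ring

/-- With keys frozen, two logits of one head have conditional covariance summed over a row and a
column index; it factorises into the channel average and the key average. Different heads share no
query weight. -/
theorem exists_logit_limit [Countable X]
    (hV : ∀ n, GaussWeights (P n) (𝓖 n) (V n) (S.paramVar n (d n)))
    (hg : ∀ x, BddMoments P fun n (p : Fin dS × ℕ) => g n x p.1 p.2)
    (hgm : ∀ n x a j, Measurable[𝓖 n] (g n x a j))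
    (hΓ : ∀ x x' a b, Null P fun n ω => (d n : ℝ)⁻¹ * ∑ i ∈ Finset.range (d n),
      g n x a i ω * g n x' b i ω - κt x x' a b)
    (hdimG : Tendsto S.dimG atTop atTop) :
    ∃ γ : ProbabilityMeasure (X × ℕ × Fin dS × Fin dS → ℝ),
      IsCentredGP (γ : Measure (X × ℕ × Fin dS × Fin dS → ℝ))
        (fun s t => if s.2.1 = t.2.1 then
          (S.σQ : ℝ) ^ 2 * (S.σK : ℝ) ^ 2 *
            (κt s.1 t.1 s.2.2.1 t.2.2.1 * κt s.1 t.1 s.2.2.2 t.2.2.2) else 0) ∧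
      TendstoInDistribution
        (fun n (ω : Ω n) (t : X × ℕ × Fin dS × Fin dS) =>
          S.logit n (d n) (fun p => V n p ω) (fun a j => g n t.1 a j ω) t.2.1 t.2.2.1 t.2.2.2)
        atTop id P (γ : Measure (X × ℕ × Fin dS × Fin dS → ℝ)) := by
  classical
  -- Only the query weights of the head of `t` enter; coefficients are set to zero outside this set,
  -- as `exists_gaussian_limit` requires.
  let s : ∀ _ : ℕ, X × ℕ × Fin dS × Fin dS → Finset (ℕ × ℕ × ℕ) := fun n t =>
    {t.2.1} ×ˢ (Finset.range (d n) ×ˢ Finset.range (S.dimG n))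
  let c : ∀ n, X × ℕ × Fin dS × Fin dS → ℕ × ℕ × ℕ → Ω n → ℝ := fun n t r ω =>
    (Real.sqrt (S.dimG n))⁻¹ * (g n t.1 t.2.2.1 r.2.1 ω *
      key (d n) (fun q => V n q ω) (fun a j => g n t.1 a j ω) r.1 t.2.2.2 r.2.2)
  have hsum : ∀ n t (F : ℕ × ℕ × ℕ → ℝ), ∑ r ∈ s n t, F r =
      ∑ r ∈ Finset.range (d n) ×ˢ Finset.range (S.dimG n), F (t.2.1, r) := fun n t F => by
    rw [Finset.sum_product, Finset.sum_singleton]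
  refine exists_gaussian_limit (S.gaussWeights_query hV) s
    (b := fun n t r ω => if r ∈ s n t then c n t r ω else 0) (fun n t r => ?_)
    (fun n t r hr ω => if_neg hr) (fun n ω t => ?_) (fun t => ?_) fun t t' => ?_
  · split_ifs
    · exact (((hgm n _ _ _).mono le_sup_left le_rfl).mul
        (measurable_key_keyWeights (fun n => hgm n t.1) n _ _ _)).const_mul _
    · exact measurable_const
  · rw [logit_eq_sum]
    have e : ∀ r ∈ s n t, (if r ∈ s n t then c n t r ω else 0) * V n (.query r.1 r.2.1 r.2.2) ω =
      c n t r ω * V n (.query r.1 r.2.1 r.2.2) ω := fun r hr => by rw [if_pos hr]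
    rw [Finset.sum_congr rfl e, hsum, Finset.mul_sum]
    exact Finset.sum_congr rfl fun r _ => (mul_assoc _ _ _).symm
  · exact (S.bddMoments_logit hV (hg t.1) fun n => hgm n t.1).comp fun _ (_ : Unit) => t.2
  · by_cases hh : t.2.1 = t'.2.1
    · have hs : ∀ n, s n t' = s n t := fun n => by simp only [s, hh]
      have h1 := ((hΓ t.1 t'.1 t.2.2.1 t'.2.2.1).mul_sub_mul
        (S.null_average_keys hV hg hgm hΓ hdimG t.2.1 t.1 t'.1 t.2.2.2 t'.2.2.2)).const_mul
        ((S.σQ : ℝ) ^ 2)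
      refine h1.congr fun n ω => ?_
      have e : ∀ r ∈ s n t, (if r ∈ s n t then c n t r ω else 0) *
          (if r ∈ s n t' then c n t' r ω else 0) = c n t r ω * c n t' r ω := fun r hr => by
        rw [hs, if_pos hr, if_pos hr]
      have e2 : ∀ r : ℕ × ℕ, c n t (t.2.1, r) ω * c n t' (t.2.1, r) ω =
          (S.dimG n : ℝ)⁻¹ * ((g n t.1 t.2.2.1 r.1 ω * g n t'.1 t'.2.2.1 r.1 ω) *
          (key (d n) (fun q => V n q ω) (fun a j => g n t.1 a j ω) t.2.1 t.2.2.2 r.2 *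
            key (d n) (fun q => V n q ω) (fun a j => g n t'.1 a j ω) t.2.1 t'.2.2.2 r.2)) := by
        intro r
        have : (S.dimG n : ℝ)⁻¹ = (Real.sqrt (S.dimG n))⁻¹ * (Real.sqrt (S.dimG n))⁻¹ := by
          rw [← mul_inv, Real.mul_self_sqrt (Nat.cast_nonneg _)]
        rw [this]
        simp only [c]
        ring
      rw [Finset.sum_congr rfl e, hsum, Finset.sum_congr rfl fun r _ => e2 r, ← Finset.mul_sum,
        if_pos hh]
      simp only [Finset.sum_product, ← Finset.mul_sum, ← Finset.sum_mul]
      push_cast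
      ring
    · refine Null.zero.congr fun n ω => ?_
      rw [if_neg hh, Finset.sum_eq_zero, mul_zero, sub_zero]
      intro r hr
      have h1 : r.1 = t.2.1 := by simpa [s] using (Finset.mem_product.1 hr).1
      have h2 : r ∉ s n t' := fun hr' => hh (by
        have : r.1 = t'.2.1 := by simpa [s] using (Finset.mem_product.1 hr').1
        rw [← h1, this])
      rw [if_neg h2, mul_zero]

end Attention

/-! ### Independence from vanishing covariance -/

theorem IsCentredGP.indepFun {A B T : Type*} {μ : Measure (T → ℝ)} [IsProbabilityMeasure μ]
    {K : T → T → ℝ} (hμ : IsCentredGP μ K) {e : A → T} {e' : B → T}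
    (h : ∀ s t, K (e s) (e' t) = 0) :
    IndepFun (fun ω s => ω (e s)) (fun ω t => ω (e' t)) μ := by
  refine IsGaussianProcess.indepFun_of_covariance_eq_zero (X := fun s (ω : T → ℝ) => ω (e s))
    (Y := fun t (ω : T → ℝ) => ω (e' t)) ?_ (fun s => (measurable_pi_apply _).aemeasurable)
    (fun s => (measurable_pi_apply _).aemeasurable) fun s t => ?_
  · have : Sum.elim (fun s (ω : T → ℝ) => ω (e s)) (fun t (ω : T → ℝ) => ω (e' t)) =
        (fun (t : T) (ω : T → ℝ) => ω t) ∘ Sum.elim e e' := by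
      ext (s | t) ω <;> rfl
    rw [this]
    exact hμ.gaussian.comp_right _
  · have hL : ∀ t, MemLp (fun ω : T → ℝ => ω t) 2 μ := fun t =>
      (hμ.gaussian.hasGaussianLaw_eval t).memLp_two
    have := covariance_eq_sub (hL (e s)) (hL (e' t))
    rw [this, hμ.mean_zero, zero_mul, sub_zero]
    exact (hμ.cov _ _).trans (h s t)

/-! ### The Gaussian limit of the attention outputs -/

/-- Relabelling of the heads. -/
def AttnParam.permHeads (σ : Equiv.Perm ℕ) : AttnParam → AttnParam
  | .query h i j => .query (σ h) i j
  | .key h i j => .key (σ h) i j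
  | .value h i j => .value (σ h) i j
  | .output h k i => .output (σ h) k i

theorem AttnParam.permHeads_injective (σ : Equiv.Perm ℕ) : Function.Injective (permHeads σ) := by
  rintro (_ | _ | _ | _) (_ | _ | _ | _) h <;> simp_all [permHeads]

namespace Attention

variable {X : Type*} {dS : ℕ} {Ω : ℕ → Type*}
  {𝓖 : ∀ n, MeasurableSpace (Ω n)} [∀ n, MeasurableSpace (Ω n)]
  {P : ∀ n, Measure (Ω n)} [∀ n, IsProbabilityMeasure (P n)]
  (S : Attention dS) {d : ℕ → ℕ} {V : ∀ n, AttnParam → Ω n → ℝ}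
  {g : ∀ n, X → Fin dS → ℕ → Ω n → ℝ} {κt : X → X → Matrix (Fin dS) (Fin dS) ℝ}

theorem paramVar_permHeads (n d : ℕ) (σ : Equiv.Perm ℕ) (p : AttnParam) :
    S.paramVar n d (p.permHeads σ) = S.paramVar n d p := by
  cases p <;> rfl

/-- This is where the logit limit feeds into the outputs: in the limit distinct heads are
uncorrelated, hence independent by joint Gaussianity, and for finite `n` relabelling the heads
equalises the correlations. -/
theorem null_average_zeta [Countable X] (hS : S.Regular)
    (hV : ∀ n, GaussWeights (P n) (𝓖 n) (V n) (S.paramVar n (d n)))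
    (hg : ∀ x, BddMoments P fun n (p : Fin dS × ℕ) => g n x p.1 p.2)
    (hgm : ∀ n x a j, Measurable[𝓖 n] (g n x a j))
    {γ : ProbabilityMeasure (X × ℕ × Fin dS × Fin dS → ℝ)}
    {K : X × ℕ × Fin dS × Fin dS → X × ℕ × Fin dS × Fin dS → ℝ}
    (hγ : IsCentredGP (γ : Measure (X × ℕ × Fin dS × Fin dS → ℝ)) K)
    (hK : ∀ s t, s.2.1 ≠ t.2.1 → K s t = 0)
    (hlim : TendstoInDistribution
      (fun n (ω : Ω n) (t : X × ℕ × Fin dS × Fin dS) =>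
        S.logit n (d n) (fun p => V n p ω) (fun a j => g n t.1 a j ω) t.2.1 t.2.2.1 t.2.2.2)
      atTop id P (γ : Measure (X × ℕ × Fin dS × Fin dS → ℝ)))
    (hheads : Tendsto S.heads atTop atTop) (x x' : X) (a b a' b' : Fin dS) :
    Null P fun n ω => (S.heads n : ℝ)⁻¹ * ∑ h ∈ Finset.range (S.heads n),
      S.ζ (S.logit n (d n) (fun p => V n p ω) (fun a j => g n x a j ω) h) a b *
        S.ζ (S.logit n (d n) (fun p => V n p ω) (fun a j => g n x' a j ω) h) a' b' -
      ∫ G : X × ℕ × Fin dS × Fin dS → ℝ, S.ζ (Matrix.of fun c d => G (x, 0, c, d)) a b *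
        S.ζ (Matrix.of fun c d => G (x', 0, c, d)) a' b'
        ∂(γ : Measure (X × ℕ × Fin dS × Fin dS → ℝ)) := by
  have hζ : ∀ a b, Continuous fun F : Fin dS → Fin dS → ℝ => S.ζ (Matrix.of F) a b := fun a b =>
    (continuous_apply b).comp ((continuous_apply a).comp (hS.1.comp continuous_id))
  have hcont : ∀ h : ℕ, Continuous fun G : X × ℕ × Fin dS × Fin dS → ℝ =>
      S.ζ (Matrix.of fun c d => G (x, h, c, d)) a b *
        S.ζ (Matrix.of fun c d => G (x', h, c, d)) a' b' := fun h =>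
    ((hζ a b).comp (continuous_pi fun c => continuous_pi fun e => continuous_apply _)).mul
      ((hζ a' b').comp (continuous_pi fun c => continuous_pi fun e => continuous_apply _))
  refine Null.average_of_tendstoInDistribution
    (ψ := fun h G => S.ζ (Matrix.of fun c d => G (x, h, c, d)) a b *
        S.ζ (Matrix.of fun c d => G (x', h, c, d)) a' b') hlim hcont ?_ ?_ ?_ hheads
  · exact ((S.bddMoments_zeta hS hV (hg x) fun n => hgm n x).comp fun _ h => (h, a, b)).mul
      ((S.bddMoments_zeta hS hV (hg x') fun n => hgm n x').comp fun _ h => (h, a', b'))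
  · have hi := hγ.indepFun (e := fun p : X × Fin dS × Fin dS => (p.1, 0, p.2))
      (e' := fun p : X × Fin dS × Fin dS => (p.1, 1, p.2)) fun s t => hK _ _ zero_ne_one
    have hm : Measurable fun G : X × Fin dS × Fin dS → ℝ =>
        S.ζ (Matrix.of fun c d => G (x, c, d)) a b *
          S.ζ (Matrix.of fun c d => G (x', c, d)) a' b' :=
      ((hζ a b).measurable.comp (measurable_pi_iff.2 fun c => measurable_pi_iff.2 fun e =>
        measurable_pi_apply _)).mul ((hζ a' b').measurable.comp
        (measurable_pi_iff.2 fun c => measurable_pi_iff.2 fun e => measurable_pi_apply _))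
    exact hi.comp hm hm
  · intro c n i j hij
    obtain ⟨σ, -, rfl, rfl⟩ := exists_perm_finite_support hij
    -- Written as a function of inputs and weights, `Φ h` at the relabelled weights is by definition
    -- `Φ (σ h)` at the original ones; the two weight families have the same joint law with the
    -- inputs.
    let Φ : ℕ → (X × Fin dS × ℕ → ℝ) × (AttnParam → ℝ) → ℝ := fun h q =>
      S.ζ (S.logit n (d n) q.2 (fun a j => q.1 (x, a, j)) h) a b *
        S.ζ (S.logit n (d n) q.2 (fun a j => q.1 (x', a, j)) h) a' b' - c
    have hΦ : ∀ h, Measurable (Φ h) := fun h =>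
      ((S.measurable_zeta_logit hS.1 n (d n) (Ω := (X × Fin dS × ℕ → ℝ) × (AttnParam → ℝ))
        (W := fun p q => q.2 p) (g := fun a j q => q.1 (x, a, j)) (fun a j => by fun_prop)
        (fun i j => by fun_prop) (fun i j => by fun_prop) a b).mul
      (S.measurable_zeta_logit hS.1 n (d n) (Ω := (X × Fin dS × ℕ → ℝ) × (AttnParam → ℝ))
        (W := fun p q => q.2 p) (g := fun a j q => q.1 (x', a, j)) (fun a j => by fun_prop)
        (fun i j => by fun_prop) (fun i j => by fun_prop) a' b')).sub_const c
    have hZ : Measurable[𝓖 n] fun ω (t : X × Fin dS × ℕ) => g n t.1 t.2.1 t.2.2 ω :=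
      @measurable_pi_iff _ _ _ (𝓖 n) _ _ |>.2 fun t => hgm n _ _ _
    have hpair : ∀ e : AttnParam → AttnParam, Measurable fun ω =>
        ((fun t : X × Fin dS × ℕ => g n t.1 t.2.1 t.2.2 ω), fun p => V n (e p) ω) := fun e =>
      (hZ.mono (hV n).le le_rfl).prodMk (measurable_pi_iff.2 fun p => (hV n).measurable _)
    have hlaw := (hV n).map_prodMk_comp hZ (AttnParam.permHeads_injective σ)
      Function.injective_id fun p => S.paramVar_permHeads n (d n) σ p
    have hm := ((hΦ 0).mul (hΦ 1)).aestronglyMeasurable (μ := (P n).map fun ω =>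
      ((fun t : X × Fin dS × ℕ => g n t.1 t.2.1 t.2.2 ω), fun p => V n (p.permHeads σ) ω))
    have h1 := integral_map (hpair (AttnParam.permHeads σ)).aemeasurable hm
    rw [hlaw] at hm h1
    exact h1.symm.trans (integral_map (hpair id).aemeasurable hm)

/-- With the head outputs frozen, the layer is linear in `W^O`, and different output channels use
disjoint columns. Within a channel the conditional covariance averages over pairs of a head and a
value column, as treated in `hquad`. -/
theorem exists_output_limit [Countable X] (hS : S.Regular)
    (hV : ∀ n, GaussWeights (P n) (𝓖 n) (V n) (S.paramVar n (d n)))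
    (hg : ∀ x, BddMoments P fun n (p : Fin dS × ℕ) => g n x p.1 p.2)
    (hgm : ∀ n x a j, Measurable[𝓖 n] (g n x a j))
    (hΓ : ∀ x x' a b, Null P fun n ω => (d n : ℝ)⁻¹ * ∑ i ∈ Finset.range (d n),
      g n x a i ω * g n x' b i ω - κt x x' a b)
    {E : X → X → Fin dS → Fin dS → Fin dS → Fin dS → ℝ}
    (hE : ∀ x x' a b a' b', Null P fun n ω => (S.heads n : ℝ)⁻¹ *
      ∑ h ∈ Finset.range (S.heads n),
        S.ζ (S.logit n (d n) (fun p => V n p ω) (fun a j => g n x a j ω) h) a b *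
        S.ζ (S.logit n (d n) (fun p => V n p ω) (fun a j => g n x' a j ω) h) a' b' -
      E x x' a b a' b')
    (hheads : Tendsto S.heads atTop atTop) (hdimV : ∀ n, 0 < S.dimV n) :
    ∃ ν : ProbabilityMeasure (X × Fin dS × ℕ → ℝ),
      IsCentredGP (ν : Measure (X × Fin dS × ℕ → ℝ))
        (fun s t => if s.2.2 = t.2.2 then (S.σO : ℝ) ^ 2 * (S.σV : ℝ) ^ 2 *
          ∑ i, ∑ j, κt s.1 t.1 i j * E s.1 t.1 s.2.1 i t.2.1 j else 0) ∧
      TendstoInDistribution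
        (fun n (ω : Ω n) (t : X × Fin dS × ℕ) =>
          S.apply n (d n) (fun p => V n p ω) (fun a j => g n t.1 a j ω) t.2.1 t.2.2)
        atTop id P (ν : Measure (X × Fin dS × ℕ → ℝ)) := by
  classical
  let D : ℕ → Finset (ℕ × ℕ) := fun n => Finset.range (S.heads n) ×ˢ Finset.range (S.dimV n)
  -- The number of pairs is at least the number of heads, so a bounded value dimension does no harm.
  have hD : Tendsto (fun n => (D n).card) atTop atTop := by
    refine tendsto_atTop_mono (fun n => ?_) hheads
    rw [Finset.card_product, Finset.card_range, Finset.card_range]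
    exact Nat.le_mul_of_pos_right _ (hdimV n)
  have hquad : ∀ x x' a b a' b', Null P fun n ω => ((D n).card : ℝ)⁻¹ * ∑ q ∈ D n,
      (S.ζ (S.logit n (d n) (fun p => V n p ω) (fun a j => g n x a j ω) q.1) a b *
        S.ζ (S.logit n (d n) (fun p => V n p ω) (fun a j => g n x' a j ω) q.1) a' b') *
      (value (d n) (fun p => V n p ω) (fun a j => g n x a j ω) q.1 b q.2 *
        value (d n) (fun p => V n p ω) (fun a j => g n x' a j ω) q.1 b' q.2) -
      (S.σV : ℝ) ^ 2 * (κt x x' b b' * E x x' a b a' b') := by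
    intro x x' a b a' b'
    have hA : BddMoments P fun n (q : ℕ × ℕ) ω =>
        S.ζ (S.logit n (d n) (fun p => V n p ω) (fun a j => g n x a j ω) q.1) a b *
        S.ζ (S.logit n (d n) (fun p => V n p ω) (fun a j => g n x' a j ω) q.1) a' b' :=
      ((S.bddMoments_zeta hS hV (hg x) fun n => hgm n x).comp fun _ (q : ℕ × ℕ) => (q.1, a, b)).mul
        ((S.bddMoments_zeta hS hV (hg x') fun n => hgm n x').comp
          fun _ (q : ℕ × ℕ) => (q.1, a', b'))
    have h1 := Null.average_quadratic (P := P) (S.gaussWeights_value hV)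
      (c := fun n r => g n x b r) (c' := fun n r => g n x' b' r)
      ((hg x).comp fun _ r => (b, r)) ((hg x').comp fun _ r => (b', r)) hA
      (fun n r => (hgm n x b r).mono le_sup_left le_rfl)
      (fun n r => (hgm n x' b' r).mono le_sup_left le_rfl)
      (fun n q => (S.measurable_zeta_logitWeights hS.1 (fun n => hgm n x) n q.1 a b).mul
        (S.measurable_zeta_logitWeights hS.1 (fun n => hgm n x') n q.1 a' b'))
      (fun n => Finset.range (d n)) (S.σV ^ 2)
      (fun n => by simpa only [Finset.card_range] using div_natCast_mul_le (S.σV ^ 2) (d n))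
      D hD
    refine (h1.add (((hΓ x x' b b').mul_sub_mul (hE x x' a b a' b')).const_mul
      ((S.σV : ℝ) ^ 2))).congr fun n ω => ?_
    have hV0 : (S.dimV n : ℝ) ≠ 0 := by exact_mod_cast (hdimV n).ne'
    -- The `ζ` factors do not depend on the value column, so averaging over columns is trivial; this
    -- uses that the value dimension is nonzero.
    have e : ((D n).card : ℝ)⁻¹ * ∑ q ∈ D n,
        S.ζ (S.logit n (d n) (fun p => V n p ω) (fun a j => g n x a j ω) q.1) a b *
        S.ζ (S.logit n (d n) (fun p => V n p ω) (fun a j => g n x' a j ω) q.1) a' b' =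
        (S.heads n : ℝ)⁻¹ * ∑ h ∈ Finset.range (S.heads n),
        S.ζ (S.logit n (d n) (fun p => V n p ω) (fun a j => g n x a j ω) h) a b *
        S.ζ (S.logit n (d n) (fun p => V n p ω) (fun a j => g n x' a j ω) h) a' b' := by
      simp only [D, Finset.sum_product, Finset.sum_const, Finset.card_product, Finset.card_range,
        nsmul_eq_mul, ← Finset.mul_sum]
      push_cast
      rw [mul_inv, mul_assoc, inv_mul_cancel_left₀ hV0]
    rw [← e]
    simp only [mul_sub, Finset.sum_sub_distrib, ← Finset.sum_mul, value]
    push_cast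
    ring
  let s : ∀ _ : ℕ, X × Fin dS × ℕ → Finset (ℕ × ℕ × ℕ) := fun n t =>
    (D n).map ⟨fun q => (q.1, q.2, t.2.2), fun q q' h => by
      simp only [Prod.mk.injEq] at h; exact Prod.ext h.1 h.2.1⟩
  have hs : ∀ n t r, r ∈ s n t → r.2.2 = t.2.2 := by
    intro n t r hr
    obtain ⟨q, -, rfl⟩ := Finset.mem_map.1 hr
    rfl
  let c : ∀ n, X × Fin dS × ℕ → ℕ × ℕ × ℕ → Ω n → ℝ := fun n t r ω =>
    S.headOut n (d n) (fun q => V n q ω) (fun a j => g n t.1 a j ω) r.1 t.2.1 r.2.1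
  refine exists_gaussian_limit (S.gaussWeights_output hV) s
    (b := fun n t r ω => if r ∈ s n t then c n t r ω else 0) (fun n t r => ?_)
    (fun n t r hr ω => if_neg hr) (fun n ω t => ?_) (fun t => ?_) fun t t' => ?_
  · split_ifs
    · exact S.measurable_headOut_headWeights hS.1 (fun n => hgm n t.1) n _ _ _
    · exact measurable_const
  · rw [apply_eq_sum]
    have e : ∀ r ∈ s n t, (if r ∈ s n t then c n t r ω else 0) * V n (.output r.1 r.2.1 r.2.2) ω =
      c n t r ω * V n (.output r.1 r.2.1 r.2.2) ω := fun r hr => by rw [if_pos hr]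
    rw [Finset.sum_congr rfl e, Finset.sum_map]
    rfl
  · exact (S.bddMoments_apply hS hV (hg t.1) fun n => hgm n t.1).comp fun _ (_ : Unit) => t.2
  · by_cases hh : t.2.2 = t'.2.2
    · have hs' : ∀ n, s n t' = s n t := fun n => by simp only [s, hh]
      have h1 := (Null.sum Finset.univ fun b _ => Null.sum Finset.univ fun b' _ =>
        hquad t.1 t'.1 t.2.1 b t'.2.1 b').const_mul ((S.σO : ℝ) ^ 2)
      refine h1.congr fun n ω => ?_
      have e : ∀ r ∈ s n t, (if r ∈ s n t then c n t r ω else 0) *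
          (if r ∈ s n t' then c n t' r ω else 0) = c n t r ω * c n t' r ω := fun r hr => by
        rw [hs', if_pos hr, if_pos hr]
      have e2 : ∀ q : ℕ × ℕ, c n t (q.1, q.2, t.2.2) ω * c n t' (q.1, q.2, t.2.2) ω =
          ∑ b, ∑ b',
          (S.ζ (S.logit n (d n) (fun p => V n p ω) (fun a j => g n t.1 a j ω) q.1) t.2.1 b *
            S.ζ (S.logit n (d n) (fun p => V n p ω) (fun a j => g n t'.1 a j ω) q.1) t'.2.1 b') *
          (value (d n) (fun p => V n p ω) (fun a j => g n t.1 a j ω) q.1 b q.2 *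
            value (d n) (fun p => V n p ω) (fun a j => g n t'.1 a j ω) q.1 b' q.2) := by
        intro q
        simp only [c, headOut, Finset.sum_mul_sum]
        exact Finset.sum_congr rfl fun b _ => Finset.sum_congr rfl fun b' _ => by ring
      have e3 : ∀ F : Fin dS → Fin dS → ℕ × ℕ → ℝ, ∑ b, ∑ b', ∑ q ∈ D n, F b b' q =
          ∑ q ∈ D n, ∑ b, ∑ b', F b b' q := fun F =>
        (Finset.sum_congr rfl fun b _ => Finset.sum_comm).trans Finset.sum_comm
      have e4 : ∑ r ∈ s n t, c n t r ω * c n t' r ω = _ :=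
        (Finset.sum_map _ _ _).trans (Finset.sum_congr rfl fun q _ => e2 q)
      rw [Finset.sum_congr rfl e, e4, if_pos hh]
      simp only [Finset.sum_sub_distrib, ← Finset.mul_sum]
      rw [e3]
      simp only [D, Finset.card_product, Finset.card_range]
      push_cast
      ring
    · refine Null.zero.congr fun n ω => ?_
      rw [if_neg hh, Finset.sum_eq_zero, mul_zero, sub_zero]
      intro r hr
      have h2 : r ∉ s n t' := fun hr' => hh ((hs n t r hr).symm.trans (hs n t' r hr'))
      rw [if_neg h2, mul_zero]

end Attention

theorem IsCentredGP.isChannelGP {X : Type*} {dS : ℕ} {μ : Measure (X × Fin dS × ℕ → ℝ)}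
    [IsProbabilityMeasure μ] {K : X × Fin dS × ℕ → X × Fin dS × ℕ → ℝ} (hμ : IsCentredGP μ K)
    {κ : X → X → Matrix (Fin dS) (Fin dS) ℝ}
    (hK : ∀ s t, K s t = if s.2.2 = t.2.2 then κ s.1 t.1 s.2.1 t.2.1 else 0) :
    IsChannelGP μ κ where
  gaussian := hμ.gaussian
  mean_zero := hμ.mean_zero
  cov x x' a b j := by rw [hμ.cov, hK, if_pos rfl]
  indep j j' h := hμ.indepFun (e := fun p : X × Fin dS => (p.1, p.2, j))
    (e' := fun p : X × Fin dS => (p.1, p.2, j')) fun s t => by rw [hK, if_neg h]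

end AttentionGP

end

/-! ### Gaussian limits of the logits and outputs of the attention layer -/

theorem mainTheorem1
    {X : Type*} [Countable X] {dS : ℕ}
    -- the `n`-th random network lives on the probability space `(Ω n, P n)`
    {Ω : ℕ → Type*} [∀ n, MeasurableSpace (Ω n)]
    (P : ∀ n, Measure (Ω n)) [∀ n, IsProbabilityMeasure (P n)]
    -- the first `m` layers, followed by the attention layer `S`, which is layer `m + 1`
    (N : AttentionGP.Network dS) (m : ℕ) (S : AttentionGP.Attention dS)
    (hact : ∀ k ≤ m, Continuous (N.act k) ∧ AttentionGP.PolyBounded (N.act k))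
    (hlayer : ∀ k, 1 ≤ k → k ≤ m → (N.layer k).Regular)
    (hS : S.Regular)
    -- network inputs, weights of the first `m` layers, weights of the attention layer
    (inp : ∀ n, X → Fin dS → ℕ → Ω n → ℝ)
    (W : ∀ n, (k : ℕ) → (N.layer k).Param → Ω n → ℝ)
    (V : ∀ n, AttentionGP.AttnParam → Ω n → ℝ)
    (hinp : ∀ n x a j, Measurable (inp n x a j))
    (hmom : AttentionGP.UniformMoments P inp)
    (hW : ∀ n k p, Measurable (W n k p))
    (hV : ∀ n p, Measurable (V n p))
    -- independent Gaussian weights, independent of the network input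
    (hWlaw : ∀ n k, k < m → ∀ p, HasLaw (W n (k + 1) p)
      (gaussianReal 0 ((N.layer (k + 1)).paramVar n (N.width k n) p)) (P n))
    (hVlaw : ∀ n p, HasLaw (V n p) (gaussianReal 0 (S.paramVar n (N.width m n) p)) (P n))
    (hindep : ∀ n, iIndepFun
      (Sum.elim (fun p : (k : Set.Icc 1 m) × (N.layer k).Param => W n p.1 p.2) (V n)) (P n))
    (hinpindep : ∀ n, IndepFun
      (fun ω (t : X × Fin dS × ℕ) => inp n t.1 t.2.1 t.2.2 ω)
      (fun ω p => Sum.elim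
        (fun p : (k : Set.Icc 1 m) × (N.layer k).Param => W n p.1 p.2) (V n) p ω) (P n))
    -- the outputs of layer `m`, and the inputs of the attention layer
    (f : ∀ n, Ω n → X × Fin dS × ℕ → ℝ)
    (hf : ∀ n ω t, f n ω t =
      N.out n (fun k p => W n k p ω) (fun a j => inp n t.1 a j ω) m t.2.1 t.2.2)
    (g : ∀ n, Ω n → X → Fin dS → ℕ → ℝ)
    (hg : ∀ n ω x a j, g n ω x a j = N.act m (f n ω (x, a, j)))
    -- convergence of the outputs of layer `m` to a Gaussian process; exchangeability
    (μ : ProbabilityMeasure (X × Fin dS × ℕ → ℝ))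
    (κprev : X → X → Matrix (Fin dS) (Fin dS) ℝ)
    (hμ : AttentionGP.IsChannelGP (μ : Measure (X × Fin dS × ℕ → ℝ)) κprev)
    (hconv : TendstoInDistribution f atTop id P (μ : Measure (X × Fin dS × ℕ → ℝ)))
    (hexch : ∀ n, AttentionGP.ChannelExchangeable ((P n).map (f n)))
    -- width, number of heads and query/key dimension tend to infinity
    (hwidth : Tendsto (N.width m) atTop atTop)
    (hheads : Tendsto S.heads atTop atTop)
    (hdimG : Tendsto S.dimG atTop atTop)
    (hdimV : ∀ n, 0 < S.dimV n)
    (κt : X → X → Matrix (Fin dS) (Fin dS) ℝ)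
    (hκt : κt = AttentionGP.postKernel (N.act m) (μ : Measure (X × Fin dS × ℕ → ℝ))) :
    ∃ γ : ProbabilityMeasure (X × ℕ × Fin dS × Fin dS → ℝ),
      -- (I) the logits
      AttentionGP.IsCentredGP (γ : Measure (X × ℕ × Fin dS × Fin dS → ℝ))
        (fun s t => if s.2.1 = t.2.1 then
          (S.σQ : ℝ) ^ 2 * (S.σK : ℝ) ^ 2 *
            (κt s.1 t.1 s.2.2.1 t.2.2.1 * κt s.1 t.1 s.2.2.2 t.2.2.2) else 0) ∧
      TendstoInDistribution
        (fun n (ω : Ω n) (t : X × ℕ × Fin dS × Fin dS) =>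
          S.logit n (N.width m n) (fun p => V n p ω) (g n ω t.1) t.2.1 t.2.2.1 t.2.2.2)
        atTop id P (γ : Measure (X × ℕ × Fin dS × Fin dS → ℝ)) ∧
      -- (II) the outputs
      (∀ x x' a b i j, Integrable (fun G : X × ℕ × Fin dS × Fin dS → ℝ =>
        S.ζ (Matrix.of fun c d => G (x, 0, c, d)) a i *
          S.ζ (Matrix.of fun c d => G (x', 0, c, d)) b j)
        (γ : Measure (X × ℕ × Fin dS × Fin dS → ℝ))) ∧
      ∃ ν : ProbabilityMeasure (X × Fin dS × ℕ → ℝ),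
        AttentionGP.IsChannelGP (ν : Measure (X × Fin dS × ℕ → ℝ))
          (fun x x' => Matrix.of fun a b =>
            (S.σO : ℝ) ^ 2 * (S.σV : ℝ) ^ 2 *
              ∑ i, ∑ j, κt x x' i j *
                ∫ G : X × ℕ × Fin dS × Fin dS → ℝ,
                  S.ζ (Matrix.of fun c d => G (x, 0, c, d)) a i *
                    S.ζ (Matrix.of fun c d => G (x', 0, c, d)) b j
                  ∂(γ : Measure (X × ℕ × Fin dS × Fin dS → ℝ))) ∧
        TendstoInDistribution
          (fun n (ω : Ω n) (t : X × Fin dS × ℕ) =>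
            S.apply n (N.width m n) (fun p => V n p ω) (g n ω t.1) t.2.1 t.2.2)
          atTop id P (ν : Measure (X × Fin dS × ℕ → ℝ)) := by
  -- The first conditioning σ-algebra is generated by the network inputs, jointly over all `x`.
  have hU := fun n => AttentionGP.Network.gaussWeights_weights (hinp n) (hW n) (hV n) (hWlaw n)
    (hVlaw n) (hindep n) (hinpindep n)
  have hinpm := fun n x a j => (measurable_pi_apply (X := fun _ : X × Fin dS × ℕ => ℝ)
    (x, a, j)).comp (comap_measurable fun ω (t : X × Fin dS × ℕ) => inp n t.1 t.2.1 t.2.2 ω)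
  have hout := fun x => AttentionGP.Network.bddMoments_out hact hlayer hU
    (inp := fun n => inp n x) (fun n => hinpm n x) (hmom.bddMoments hinp x) m le_rfl
  have hVW := fun n => AttentionGP.Network.gaussWeights_last (hU n)
  obtain ⟨hφ, hφp⟩ := hact m le_rfl
  have hgeq : g = fun n ω x a j => N.act m
      (N.out n (fun k p => W n k p ω) (fun a j => inp n x a j ω) m a j) := by
    funext n ω x a j
    rw [hg, hf]
  subst hgeq
  have hgb := fun x => hφp.bddMoments_comp hφ (hout x).1
  have hgm := fun n x a j => hφ.measurable.comp ((hout x).2 n a j)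
  have hΓ := fun x x' a b => AttentionGP.Null.average_channels hμ hconv hexch hφ
    (fun x => (hφp.bddMoments_comp hφ (hout x).1).congr fun n p ω => by rw [hf]) hwidth x x' a b
  simp only [hf, ← hκt] at hΓ
  obtain ⟨γ, hγ, hlim⟩ := S.exists_logit_limit hVW hgb hgm hΓ
    hdimG
  have hE := fun x x' a b a' b' => S.null_average_zeta hS hVW
    hgb hgm hγ (fun s t h => if_neg h) hlim hheads x x' a b a' b'
  obtain ⟨ν, hν, hlim'⟩ := S.exists_output_limit hS hVW hgb hgm
    hΓ hE hheads hdimV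
  refine ⟨γ, hγ, hlim, fun x x' a b i j => ?_, ν, hν.isChannelGP fun s t => rfl, hlim'⟩
  have hζ : ∀ x a b, Continuous fun G : X × ℕ × Fin dS × Fin dS → ℝ =>
      S.ζ (Matrix.of fun c d => G (x, 0, c, d)) a b := fun x a b =>
    (continuous_apply b).comp ((continuous_apply a).comp (hS.1.comp
      (continuous_pi fun c => continuous_pi fun e => continuous_apply _)))
  -- The uniform moments of `ζ` at finite `n` pass to the weak limit, so both factors of the
  -- expectation are square integrable.
  have hmem : ∀ x a b, MemLp (fun G : X × ℕ × Fin dS × Fin dS → ℝ =>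
      S.ζ (Matrix.of fun c d => G (x, 0, c, d)) a b) 2
      (γ : Measure (X × ℕ × Fin dS × Fin dS → ℝ)) := fun x a b =>
    (AttentionGP.tendsto_integral_of_bddMoments hlim (hζ x a b)
      ((S.bddMoments_zeta hS hVW (hgb x) fun n => hgm n x).comp fun _ (_ : Unit) => (0, a, b))).1
  exact (hmem x a i).integrable_mul (hmem x' b j)
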